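/- **Setting.** For each $n\ge 1$ let $(\mu_i,\sigma_i,X_i)$, $1\le i\le n$, be independent triples with the same law: $\mu_i\sim G_{\mu}$ and $\sigma_i\sim G_{\sigma}$ are independent, and $X_i\mid\mu_i,\sigma_i\sim N(\mu_i,\sigma_i^2)$. The probability distributions $G_\mu=G_{\mu,n}$ and $G_\sigma=G_{\sigma,n}$ are arbitrary and may depend on $n$, subject to the following. 1. $|\mu_i|\le C_n$ almost surely, where $C_n=o(n^{\epsilon})$ for every $\epsilon>0$. 2. $\sigma_l\le\sigma_i\le\sigma_u$ almost surely, with constants $0<\sigma_l\le\sigma_u<\infty$ that do not depend on $n$. Let $\phi_h(z)=(\sqrt{2\pi}\,h)^{-1}e^{-z^2/(2h^2)}$. For bandwidths $h_x,h_\sigma>0$ put $w_j(\sigma)=\phi_{h_\sigma}(\sigma-\sigma_j)/\sum_{k=1}^n\phi_{h_\sigma}(\sigma-\sigma_k)$, $$\hat f_\sigma(x)=\sum_{j=1}^n w_j(\sigma)\,\phi_{h_x\sigma_j}(x-X_j),\qquad \hat\delta_i=X_i+\sigma_i^2\,\frac{\hat f^{(1)}_{\sigma_i}(X_i)}{\hat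 f_{\sigma_i}(X_i)},$$ where $\hat f^{(1)}_\sigma=\frac{d}{dx}\hat f_\sigma$; $\hat\delta_i$ is the NEST estimator of $\mu_i$. **Theorem.** Let $h_x=h_{x,n}$ and $h_\sigma=h_{\sigma,n}$ be positive bandwidths of exact orders $n^{-\eta_x}$ and $n^{-\eta_s}$ (bounded above and below by constant multiples of these for large $n$), where $\eta_x,\eta_s>0$ and $\eta_x+\eta_s<1$. Let $t\in\mathbb R$ be a fixed threshold such that, for every $\epsilon>0$, $P(X_1>t)\ge n^{-\epsilon}$ for all large $n$ (this holds automatically if $G_\mu$ and $G_\sigma$ do not depend on $n$). Then the conditional expectation below exists for all $n$ and $i$, and, as $n\to\infty$, uniformly in $1\le i\le n$, $$\mathbb E(\hat\delta_i-\mu_i\mid X_i>t)=o(1).$$ If moreover $3\eta_x+\eta_s<1$, then the same holds with $\hat\delta_i$ replaced by the truncated estimator $\min(\hat\delta_i,\tau_n)$, and also with $\hat\delta_i$ replaced by $\max\{-\tau_n,\min(\hat\delta_i,\tau_n)\}$, for every sequence of reals $\tau_n$ with $\tau_n\ge C_n$ for all large $n$. -/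

import Mathlib

open Filter MeasureTheory ProbabilityTheory Asymptotics

noncomputable section

namespace NEST

/-- The Gaussian kernel `φ_h(z) = (√(2π) h)⁻¹ exp(-z² / (2h²))`. -/
def phi (h z : ℝ) : ℝ :=
  (Real.sqrt (2 * Real.pi) * h)⁻¹ * Real.exp (-(z ^ 2) / (2 * h ^ 2))

/-- Weight of the `j`-th observation for estimating the density at standard deviation `s`:
`w_j = φ_{hσ}(s - σ_j) / ∑ k, φ_{hσ}(s - σ_k)`. -/
def weight {n : ℕ} (hσ : ℝ) (σ : Fin n → ℝ) (s : ℝ) (j : Fin n) : ℝ :=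
  phi hσ (s - σ j) / ∑ k, phi hσ (s - σ k)

/-- Weighted kernel density estimate of the marginal density `f_s` at `y`, with bandwidth
`hx * σ_j` at the `j`-th observation. -/
def fHat {n : ℕ} (hx hσ : ℝ) (x σ : Fin n → ℝ) (s y : ℝ) : ℝ :=
  ∑ j, weight hσ σ s j * phi (hx * σ j) (y - x j)

/-- The derivative of the density estimate in `y`, in closed form
(see `hasDerivAt_fHat`). -/
def fHatDeriv {n : ℕ} (hx hσ : ℝ) (x σ : Fin n → ℝ) (s y : ℝ) : ℝ :=
  ∑ j, weight hσ σ s j * phi (hx * σ j) (y - x j) * ((x j - y) / (hx * σ j) ^ 2)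

theorem hasDerivAt_fHat {n : ℕ} (hx hσ : ℝ) (x σ : Fin n → ℝ) (s y : ℝ) :
    HasDerivAt (fHat hx hσ x σ s) (fHatDeriv hx hσ x σ s y) y := by
  unfold fHat fHatDeriv
  refine HasDerivAt.fun_sum fun j _ => ?_
  have h1 : HasDerivAt (fun z : ℝ => -((z - x j) ^ 2) / (2 * (hx * σ j) ^ 2))
      ((x j - y) / (hx * σ j) ^ 2) y := by
    have h := ((((hasDerivAt_id y).sub_const (x j)).pow 2).neg).div_const (2 * (hx * σ j) ^ 2)
    refine h.congr_deriv ?_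
    by_cases h0 : hx * σ j = 0
    · simp [h0]
    · simp only [id]
      field_simp
      ring
  have h2 := (h1.exp.const_mul (Real.sqrt (2 * Real.pi) * (hx * σ j))⁻¹).const_mul
    (weight hσ σ s j)
  refine h2.congr_deriv ?_
  unfold phi
  ring

/-- The NEST estimate of the `i`-th mean from the observations `x` and the known standard
deviations `σ`. The density estimate uses all observations, including the `i`-th. -/
def nest {n : ℕ} (hx hσ : ℝ) (x σ : Fin n → ℝ) (i : Fin n) : ℝ :=
  x i + σ i ^ 2 * (fHatDeriv hx hσ x σ (σ i) (x i) / fHat hx hσ x σ (σ i) (x i))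

/-- Joint law of a triple `(μ, σ, X)` with `μ ∼ Gμ` and `σ ∼ Gσ` independent and
`X | μ, σ ∼ N(μ, σ²)`, that is `φ_σ(x - μ) dx dGσ(σ) dGμ(μ)`. -/
def tripleLaw (Gμ Gσ : Measure ℝ) : Measure (ℝ × ℝ × ℝ) :=
  (Gμ.prod (Gσ.prod volume)).withDensity
    fun p => ENNReal.ofReal (phi p.2.1 (p.2.2 - p.1))

/-- Joint law of `n` independent triples `(μ_i, σ_i, X_i)`. -/
def dataLaw (n : ℕ) (Gμ Gσ : Measure ℝ) : Measure (Fin n → ℝ × ℝ × ℝ) :=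
  Measure.pi fun _ => tripleLaw Gμ Gσ

/-- Error `est_i - μ_i` of an estimator, which sees the observations and the standard
deviations only. -/
def estError {n : ℕ} (est : (Fin n → ℝ) → (Fin n → ℝ) → Fin n → ℝ) (i : Fin n)
    (D : Fin n → ℝ × ℝ × ℝ) : ℝ :=
  est (fun j => (D j).2.2) (fun j => (D j).2.1) i - (D i).1

/-- Conditional law of the data given the selection event `X_i > t`. -/
def selectedLaw {n : ℕ} (Gμ Gσ : Measure ℝ) (t : ℝ) (i : Fin n) :
    Measure (Fin n → ℝ × ℝ × ℝ) :=
  ProbabilityTheory.cond (dataLaw n Gμ Gσ) {D | t < (D i).2.2}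

/-- `E(est_i - μ_i | X_i > t)` exists, and it is `o(1)` as `n → ∞`, uniformly in `i`. -/
def VanishingSelectionBias (Gμ Gσ : ℕ → Measure ℝ) (t : ℝ)
    (est : ∀ n : ℕ, (Fin n → ℝ) → (Fin n → ℝ) → Fin n → ℝ) : Prop :=
  (∀ (n : ℕ) (i : Fin n), Integrable (estError (est n) i) (selectedLaw (Gμ n) (Gσ n) t i)) ∧
  ∀ ε : ℝ, 0 < ε → ∀ᶠ n : ℕ in atTop, ∀ i : Fin n,
    |∫ D, estError (est n) i D ∂(selectedLaw (Gμ n) (Gσ n) t i)| < ε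

end NEST

end

/-! By Tweedie's formula the posterior mean of `μ_i` is `X_i + σ_i² f'(X_i) / f(X_i)`, where `f`
is the density of `X_i` given `σ_i`. Hence, given the scales and the other observations, the bias
on `X_i > t` is an integral over `(t, ∞)` of `σ_i² (A' / A - f' / f)` against `f`, where `A` is
the kernel estimate at the point `x` when `X_i = x`. Integrating by parts moves the derivative of
`log A` to `f`, so that only `log A - log f` has to be small: this costs the variance of `A`, of
order `(n hx hσ)⁻¹`, and not that of `A'`, of order `(n hx³ hσ)⁻¹`. A truncation destroys the
product structure needed for the integration by parts, whence the stronger condition on the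
bandwidths there.

The variance is proportional to the weight that the estimate puts on its own observation. These
weights are exchangeable and their sum is at most of order `hσ⁻¹`, so that each has mean of order
`(n hσ)⁻¹`, whatever the law of the scales. Since the own kernel contributes at `x` a term that
does not depend on `x`, it also keeps `A` from being too small for the score to be controlled. -/

namespace NEST

open Real Set

/-! ### The Gaussian kernel -/

theorem one_le_sqrt_two_pi : 1 ≤ √(2 * π) := by
  rw [Real.one_le_sqrt]; linarith [pi_gt_three]

theorem sqrt_two_pi_le_three : √(2 * π) ≤ 3 := by
  rw [Real.sqrt_le_left (by norm_num)]; linarith [pi_lt_four]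

theorem mul_exp_neg_sq_div_two_le {p c u : ℝ} (hc : 0 ≤ c)
    (hp : p ≤ c * (1 + u ^ 2 / 2 + u ^ 4 / 8)) : p * exp (-(u ^ 2) / 2) ≤ c := by
  have hexp : 1 + u ^ 2 / 2 + u ^ 4 / 8 ≤ exp (u ^ 2 / 2) := by
    linarith [quadratic_le_exp_of_nonneg (x := u ^ 2 / 2) (by positivity)]
  calc p * exp (-(u ^ 2) / 2) ≤ c * exp (u ^ 2 / 2) * exp (-(u ^ 2) / 2) := by
        gcongr; exact hp.trans (by gcongr)
    _ = c := by rw [mul_assoc, ← exp_add]; ring_nf; simp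

theorem abs_mul_exp_neg_sq_div_two_le (u : ℝ) : |u| * exp (-(u ^ 2) / 2) ≤ 1 :=
  mul_exp_neg_sq_div_two_le zero_le_one <| by
    nlinarith [sq_abs u, sq_nonneg (|u| - 1), sq_nonneg (u ^ 2)]

theorem sq_mul_exp_neg_sq_div_two_le (u : ℝ) : u ^ 2 * exp (-(u ^ 2) / 2) ≤ 1 :=
  mul_exp_neg_sq_div_two_le zero_le_one <| by nlinarith [sq_nonneg (u ^ 2 - 2)]

theorem abs_mul_exp_neg_sq_div_two_le_trunc (u : ℝ) {L : ℝ} (hL : 0 ≤ L) :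
    |u| * exp (-(u ^ 2) / 2) ≤ L * exp (-(u ^ 2) / 2) + 2 * exp (-(L ^ 2) / 4) := by
  rcases le_total |u| L with hu | hu
  · have : |u| * exp (-(u ^ 2) / 2) ≤ L * exp (-(u ^ 2) / 2) := by gcongr
    linarith [exp_pos (-(L ^ 2) / 4)]
  · have abs_le : |u| ≤ 2 * exp (u ^ 2 / 4) := by
      nlinarith [add_one_le_exp (u ^ 2 / 4), sq_abs u, sq_nonneg (|u| - 2)]
    have sq_le : L ^ 2 ≤ u ^ 2 := by rw [← sq_abs u]; gcongr
    calc |u| * exp (-(u ^ 2) / 2) ≤ 2 * exp (u ^ 2 / 4) * exp (-(u ^ 2) / 2) := by gcongr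
      _ = 2 * exp (-(u ^ 2) / 4) := by rw [mul_assoc, ← exp_add]; ring_nf
      _ ≤ 2 * exp (-(L ^ 2) / 4) := by gcongr
      _ ≤ _ := le_add_of_nonneg_left (by positivity)

theorem phi_eq (s z : ℝ) : phi s z = (√(2 * π) * s)⁻¹ * exp (-((z / s) ^ 2) / 2) := by
  rw [phi, div_pow, neg_div, neg_div, div_div, mul_comm (s ^ 2)]

theorem phi_pos {s : ℝ} (hs : 0 < s) (z : ℝ) : 0 < phi s z := by
  unfold phi; positivity

theorem phi_le_inv_mul_exp {s : ℝ} (hs : 0 < s) (z : ℝ) :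
    phi s z ≤ s⁻¹ * exp (-((z / s) ^ 2) / 2) := by
  rw [phi_eq]
  gcongr
  exact le_mul_of_one_le_left hs.le one_le_sqrt_two_pi

theorem mul_phi_le {s z p c : ℝ} (hs : 0 < s) (hp : 0 ≤ p)
    (h : p * exp (-((z / s) ^ 2) / 2) ≤ c) : p * phi s z ≤ s⁻¹ * c :=
  calc p * phi s z ≤ p * (s⁻¹ * exp (-((z / s) ^ 2) / 2)) := by
        gcongr; exact phi_le_inv_mul_exp hs z
    _ = s⁻¹ * (p * exp (-((z / s) ^ 2) / 2)) := by ring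
    _ ≤ s⁻¹ * c := by gcongr

theorem phi_zero_right (s : ℝ) : phi s 0 = (√(2 * π) * s)⁻¹ := by simp [phi]

theorem phi_le_phi_zero {s : ℝ} (hs : 0 < s) (z : ℝ) : phi s z ≤ phi s 0 := by
  rw [phi_zero_right, phi_eq]
  refine mul_le_of_le_one_right (by positivity) (exp_le_one_iff.2 ?_)
  linarith [sq_nonneg (z / s)]

theorem phi_le_inv {s : ℝ} (hs : 0 < s) (z : ℝ) : phi s z ≤ s⁻¹ := by
  refine (phi_le_inv_mul_exp hs z).trans (mul_le_of_le_one_right (by positivity) ?_)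
  exact exp_le_one_iff.2 (by linarith [sq_nonneg (z / s)])

theorem le_phi_zero {s : ℝ} (hs : 0 < s) : (3 * s)⁻¹ ≤ phi s 0 := by
  rw [phi_zero_right]
  gcongr
  exact sqrt_two_pi_le_three

@[fun_prop]
theorem continuous_phi (s : ℝ) : Continuous (phi s) := by
  unfold phi; fun_prop

@[fun_prop]
theorem measurable_phi {α : Type*} [MeasurableSpace α] {f g : α → ℝ} (hf : Measurable f)
    (hg : Measurable g) : Measurable fun a => phi (f a) (g a) := by
  unfold phi; fun_prop

/-- The derivative of the Gaussian kernel `phi s` in its argument. -/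
noncomputable def phiDeriv (s z : ℝ) : ℝ := phi s z * (-z / s ^ 2)

@[fun_prop]
theorem continuous_phiDeriv (s : ℝ) : Continuous (phiDeriv s) := by
  unfold phiDeriv; fun_prop

@[fun_prop]
theorem measurable_phiDeriv {α : Type*} [MeasurableSpace α] {f g : α → ℝ} (hf : Measurable f)
    (hg : Measurable g) : Measurable fun a => phiDeriv (f a) (g a) := by
  unfold phiDeriv; fun_prop

theorem hasDerivAt_phi (s z : ℝ) : HasDerivAt (phi s) (phiDeriv s z) z := by
  have exponent : HasDerivAt (fun z : ℝ => -(z ^ 2) / (2 * s ^ 2)) (-z / s ^ 2) z :=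
    (((hasDerivAt_id z).pow 2).neg.div_const (2 * s ^ 2)).congr_deriv <| by
      rw [← mul_div_mul_left (-z) (s ^ 2) two_ne_zero]
      simp
  refine (exponent.exp.const_mul (√(2 * π) * s)⁻¹).congr_deriv ?_
  unfold phiDeriv phi; ring

theorem abs_phiDeriv {s : ℝ} (hs : 0 < s) (z : ℝ) :
    |phiDeriv s z| = s⁻¹ * (|z / s| * phi s z) := by
  have : phiDeriv s z = -(s⁻¹ * (z / s * phi s z)) := by unfold phiDeriv; field_simp
  rw [this, abs_neg, abs_mul, abs_mul, abs_of_pos (inv_pos.2 hs), abs_of_pos (phi_pos hs z)]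

theorem abs_phiDeriv_le {s : ℝ} (hs : 0 < s) (z : ℝ) : |phiDeriv s z| ≤ (s ^ 2)⁻¹ :=
  calc |phiDeriv s z| = s⁻¹ * (|z / s| * phi s z) := abs_phiDeriv hs z
    _ ≤ s⁻¹ * (s⁻¹ * 1) := by
        exact mul_le_mul_of_nonneg_left
          (mul_phi_le hs (abs_nonneg _) (abs_mul_exp_neg_sq_div_two_le _)) (by positivity)
    _ = (s ^ 2)⁻¹ := by rw [mul_one, ← mul_inv, pow_two]

theorem phiDeriv_sq_le {s : ℝ} (hs : 0 < s) (z : ℝ) :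
    phiDeriv s z ^ 2 ≤ (s ^ 3)⁻¹ * phi s z := by
  have := phi_pos hs z
  calc phiDeriv s z ^ 2 = (z / s) ^ 2 * phi s z * (s ^ 2)⁻¹ * phi s z := by
        unfold phiDeriv; field_simp
    _ ≤ s⁻¹ * 1 * (s ^ 2)⁻¹ * phi s z := by
        gcongr ?_ * _ * _
        exact mul_phi_le hs (sq_nonneg _) (sq_mul_exp_neg_sq_div_two_le _)
    _ = (s ^ 3)⁻¹ * phi s z := by rw [mul_one, ← mul_inv, ← pow_succ']

theorem phi_sq_le {s : ℝ} (hs : 0 < s) (z : ℝ) : phi s z ^ 2 ≤ s⁻¹ * phi s z := by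
  rw [pow_two]
  exact mul_le_mul_of_nonneg_right (phi_le_inv hs z) (phi_pos hs z).le

theorem hasDerivAt_phi_scale {s : ℝ} (hs : 0 < s) (z : ℝ) :
    HasDerivAt (fun s => phi s z) (phi s z * (s⁻¹ * ((z / s) ^ 2 - 1))) s := by
  have exponent : HasDerivAt (fun s : ℝ => -(z ^ 2) / (2 * s ^ 2)) (z ^ 2 / s ^ 3) s :=
    ((((hasDerivAt_id s).pow 2).const_mul 2).inv (by simp [hs.ne'])
      |>.const_mul (-(z ^ 2))).congr_deriv <| by simp only [id]; field_simp; simp; ring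
  have prefactor : HasDerivAt (fun s : ℝ => (√(2 * π) * s)⁻¹) (-(√(2 * π) * s)⁻¹ * s⁻¹) s :=
    (((hasDerivAt_id s).const_mul √(2 * π)).inv (by positivity)).congr_deriv <| by
      simp only [id]; field_simp
  refine (prefactor.mul exponent.exp).congr_deriv ?_
  unfold phi; field_simp; ring

theorem hasDerivAt_phiDeriv_scale {s : ℝ} (hs : 0 < s) (z : ℝ) :
    HasDerivAt (fun s => phiDeriv s z)
      (phi s z * ((s ^ 2)⁻¹ * (3 * (z / s) - (z / s) ^ 3))) s := by
  have factor : HasDerivAt (fun s : ℝ => -z / s ^ 2) (2 * z / s ^ 3) s :=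
    (((hasDerivAt_id s).pow 2).inv (by simp [hs.ne']) |>.const_mul (-z)).congr_deriv <| by
      simp only [id]; field_simp; simp; ring
  refine ((hasDerivAt_phi_scale hs z).mul factor).congr_deriv ?_
  field_simp
  ring

theorem abs_sq_sub_one_mul_exp_neg_le (u : ℝ) : |u ^ 2 - 1| * exp (-(u ^ 2) / 2) ≤ 1 :=
  mul_exp_neg_sq_div_two_le zero_le_one <| abs_le.2
    ⟨by nlinarith [sq_nonneg u, sq_nonneg (u ^ 2)], by nlinarith [sq_nonneg (u ^ 2 - 2)]⟩

theorem abs_three_mul_sub_cube_mul_exp_neg_le (u : ℝ) :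
    |3 * u - u ^ 3| * exp (-(u ^ 2) / 2) ≤ 6 :=
  mul_exp_neg_sq_div_two_le (by norm_num) <| abs_le.2
    ⟨by nlinarith [sq_nonneg (u ^ 2 - u), sq_nonneg (u + 1), sq_nonneg (u ^ 2), sq_nonneg u],
      by nlinarith [sq_nonneg (u ^ 2 + u), sq_nonneg (u - 1), sq_nonneg (u ^ 2), sq_nonneg u]⟩

theorem abs_phi_sub_le {l s s' : ℝ} (hl : 0 < l) (hs : l ≤ s) (hs' : l ≤ s') (z : ℝ) :
    |phi s z - phi s' z| ≤ (l ^ 2)⁻¹ * |s - s'| := by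
  refine (convex_Ici l).norm_image_sub_le_of_norm_hasDerivWithin_le (f := fun s => phi s z)
    (fun r hr => (hasDerivAt_phi_scale (hl.trans_le hr) z).hasDerivWithinAt) ?_ hs' hs
  intro r hr
  have hr0 : 0 < r := hl.trans_le hr
  have bound := mul_phi_le hr0 (abs_nonneg _) (abs_sq_sub_one_mul_exp_neg_le (z / r))
  calc ‖phi r z * (r⁻¹ * ((z / r) ^ 2 - 1))‖ = r⁻¹ * (|(z / r) ^ 2 - 1| * phi r z) := by
        rw [norm_eq_abs, abs_mul, abs_mul, abs_of_pos (phi_pos hr0 z),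
          abs_of_pos (inv_pos.2 hr0)]
        ring
    _ ≤ r⁻¹ * (r⁻¹ * 1) := by gcongr
    _ = (r ^ 2)⁻¹ := by rw [mul_one, ← mul_inv, pow_two]
    _ ≤ (l ^ 2)⁻¹ := by gcongr; exact hr

theorem abs_phiDeriv_sub_le {l s s' : ℝ} (hl : 0 < l) (hs : l ≤ s) (hs' : l ≤ s') (z : ℝ) :
    |phiDeriv s z - phiDeriv s' z| ≤ 6 * (l ^ 3)⁻¹ * |s - s'| := by
  refine (convex_Ici l).norm_image_sub_le_of_norm_hasDerivWithin_le (f := fun s => phiDeriv s z)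
    (fun r hr => (hasDerivAt_phiDeriv_scale (hl.trans_le hr) z).hasDerivWithinAt) ?_ hs' hs
  intro r hr
  have hr0 : 0 < r := hl.trans_le hr
  have bound := mul_phi_le hr0 (abs_nonneg _) (abs_three_mul_sub_cube_mul_exp_neg_le (z / r))
  calc ‖phi r z * ((r ^ 2)⁻¹ * (3 * (z / r) - (z / r) ^ 3))‖
      = (r ^ 2)⁻¹ * (|3 * (z / r) - (z / r) ^ 3| * phi r z) := by
        rw [norm_eq_abs, abs_mul, abs_mul, abs_of_pos (phi_pos hr0 z),
          abs_of_pos (inv_pos.2 (by positivity : 0 < r ^ 2))]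
        ring
    _ ≤ (r ^ 2)⁻¹ * (r⁻¹ * 6) := by gcongr
    _ = 6 * (r ^ 3)⁻¹ := by rw [← mul_assoc, ← mul_inv, ← pow_succ, mul_comm]
    _ ≤ 6 * (l ^ 3)⁻¹ := by gcongr; exact hr

/-- The Lipschitz bound for `s ↦ log (phi s z)`, exponentiated. -/
theorem mul_phi_le_phi_of_scale {l s s' z Z : ℝ} (hl : 0 < l) (hs : l ≤ s) (hs' : l ≤ s')
    (hz : |z| ≤ Z) :
    (1 - l⁻¹ * ((Z / l) ^ 2 + 1) * |s' - s|) * phi s z ≤ phi s' z := by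
  have log_lipschitz : |log (phi s z) - log (phi s' z)| ≤
      l⁻¹ * ((Z / l) ^ 2 + 1) * |s - s'| := by
    refine (convex_Ici l).norm_image_sub_le_of_norm_hasDerivWithin_le
      (f := fun s => log (phi s z)) (fun r hr => ((hasDerivAt_phi_scale (hl.trans_le hr) z).log
        (phi_pos (hl.trans_le hr) z).ne').hasDerivWithinAt) ?_ hs' hs
    intro r hr
    have hr0 : 0 < r := hl.trans_le hr
    rw [mul_div_cancel_left₀ _ (phi_pos hr0 z).ne', norm_eq_abs, abs_mul,
      abs_of_pos (inv_pos.2 hr0)]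
    have : |(z / r) ^ 2 - 1| ≤ |z / r| ^ 2 + 1 :=
      (abs_sub _ _).trans_eq (by rw [abs_pow, abs_one])
    refine mul_le_mul (inv_anti₀ hl hr) (this.trans ?_) (abs_nonneg _) (by positivity)
    rw [abs_div, abs_of_pos hr0]
    have hZ := (abs_nonneg z).trans hz
    gcongr
    exact hr
  have hs0 := phi_pos (hl.trans_le hs) z
  calc (1 - l⁻¹ * ((Z / l) ^ 2 + 1) * |s' - s|) * phi s z
      ≤ exp (log (phi s' z) - log (phi s z)) * phi s z := by
        gcongr
        rw [abs_sub_comm s']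
        linarith [add_one_le_exp (log (phi s' z) - log (phi s z)), (abs_le.1 log_lipschitz).2]
    _ = phi s' z := by
        rw [exp_sub, exp_log hs0, exp_log (phi_pos (hl.trans_le hs') z), div_mul_cancel₀ _ hs0.ne']

theorem phi_eq_gaussianPDFReal {s : ℝ} (hs : 0 < s) (m x : ℝ) :
    phi s (x - m) = gaussianPDFReal m (s ^ 2).toNNReal x := by
  rw [phi, gaussianPDFReal, coe_toNNReal _ (sq_nonneg s), sqrt_mul (by positivity : 0 ≤ 2 * π),
    sqrt_sq hs.le]

theorem integral_phi {s : ℝ} (hs : 0 < s) (m : ℝ) : ∫ x, phi s (x - m) = 1 := by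
  simp_rw [phi_eq_gaussianPDFReal hs]
  exact integral_gaussianPDFReal_eq_one _ (by simp [hs.ne'])

/-- Completing the square. -/
theorem phi_mul_phi {r s : ℝ} (hr : 0 < r) (hs : 0 < s) (x y m : ℝ) :
    phi r (x - y) * phi s (y - m) = phi √(r ^ 2 + s ^ 2) (x - m) *
      phi (r * s / √(r ^ 2 + s ^ 2)) (y - (s ^ 2 * x + r ^ 2 * m) / (r ^ 2 + s ^ 2)) := by
  have var_pos : 0 < r ^ 2 + s ^ 2 := by positivity
  have exp_factors : ∀ a b c d : ℝ, a * exp b * (c * exp d) = a * c * exp (b + d) := by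
    intros; rw [exp_add]; ring
  simp only [phi]
  rw [exp_factors, exp_factors]
  congr 1
  · field_simp
  · rw [div_pow, mul_pow r, sq_sqrt var_pos.le]
    congr 1
    field_simp
    ring

theorem integral_phi_mul_phi {r s : ℝ} (hr : 0 < r) (hs : 0 < s) (x m : ℝ) :
    ∫ y, phi r (x - y) * phi s (y - m) = phi √(r ^ 2 + s ^ 2) (x - m) := by
  simp_rw [phi_mul_phi hr hs]
  rw [integral_const_mul, integral_phi (by positivity), mul_one]

/-! ### Gaussian mixtures -/

section Mixture

variable (G : Measure ℝ)

/-- The density of `m + s Z` with `m ∼ G` and `Z` standard normal independent. -/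
noncomputable def mixPDF (s x : ℝ) : ℝ := ∫ m, phi s (x - m) ∂G

/-- The derivative of the Gaussian mixture density `mixPDF G s`. -/
noncomputable def mixPDFDeriv (s x : ℝ) : ℝ := ∫ m, phiDeriv s (x - m) ∂G

theorem mixPDF_nonneg {s : ℝ} (hs : 0 < s) (x : ℝ) : 0 ≤ mixPDF G s x :=
  integral_nonneg fun _ => (phi_pos hs _).le

variable {G} in
theorem ae_abs_sub_le {C : ℝ} (hG : ∀ᵐ m ∂G, |m| ≤ C) (x : ℝ) : ∀ᵐ m ∂G, |x - m| ≤ |x| + C := by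
  filter_upwards [hG] with m hm
  exact (abs_sub _ _).trans (by gcongr)

variable [IsProbabilityMeasure G]

theorem integrable_phi_sub {s : ℝ} (hs : 0 < s) (x : ℝ) : Integrable (fun m => phi s (x - m)) G :=
  Integrable.of_bound (by fun_prop) s⁻¹ <| ae_of_all _ fun m => by
    rw [norm_of_nonneg (phi_pos hs _).le]; exact phi_le_inv hs _

theorem integrable_phiDeriv_sub {s : ℝ} (hs : 0 < s) (x : ℝ) :
    Integrable (fun m => phiDeriv s (x - m)) G :=
  Integrable.of_bound (by fun_prop) (s ^ 2)⁻¹ <| ae_of_all _ fun _ => abs_phiDeriv_le hs _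

theorem mixPDF_pos {s : ℝ} (hs : 0 < s) (x : ℝ) : 0 < mixPDF G s x := by
  refine (integral_pos_iff_support_of_nonneg (fun m => (phi_pos hs _).le)
    (integrable_phi_sub G hs x)).2 ?_
  rw [Function.support_eq_univ fun m => (phi_pos hs (x - m)).ne', measure_univ]
  exact zero_lt_one

theorem abs_integral_le_of_abs_le {α : Type*} [MeasurableSpace α] {P : Measure α}
    [IsProbabilityMeasure P] {g : α → ℝ} {K : ℝ} (hg : ∀ a, |g a| ≤ K) : |∫ a, g a ∂P| ≤ K := by
  simpa using norm_integral_le_of_norm_le_const (μ := P) (f := g) (ae_of_all _ hg)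

theorem mixPDF_le_inv {s : ℝ} (hs : 0 < s) (x : ℝ) : mixPDF G s x ≤ s⁻¹ :=
  (le_abs_self _).trans <| abs_integral_le_of_abs_le fun m => by
    rw [abs_of_pos (phi_pos hs _)]; exact phi_le_inv hs _

theorem abs_mixPDFDeriv_le {s : ℝ} (hs : 0 < s) (x : ℝ) : |mixPDFDeriv G s x| ≤ (s ^ 2)⁻¹ :=
  abs_integral_le_of_abs_le fun _ => abs_phiDeriv_le hs _

theorem hasDerivAt_mixPDF {s : ℝ} (hs : 0 < s) (x : ℝ) :
    HasDerivAt (mixPDF G s) (mixPDFDeriv G s x) x :=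
  (hasDerivAt_integral_of_dominated_loc_of_deriv_le (F := fun x m => phi s (x - m))
    (F' := fun x m => phiDeriv s (x - m)) (bound := fun _ => (s ^ 2)⁻¹) univ_mem
    (Eventually.of_forall fun _ => by fun_prop) (integrable_phi_sub G hs x) (by fun_prop)
    (ae_of_all _ fun _ _ _ => abs_phiDeriv_le hs _) (integrable_const _)
    (ae_of_all _ fun m x _ => (hasDerivAt_phi s (x - m)).comp_sub_const x m)).2

theorem continuous_mixPDF {s : ℝ} (hs : 0 < s) : Continuous (mixPDF G s) :=
  continuous_iff_continuousAt.2 fun x => (hasDerivAt_mixPDF G hs x).continuousAt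

theorem continuous_mixPDFDeriv {s : ℝ} (hs : 0 < s) : Continuous (mixPDFDeriv G s) :=
  continuous_of_dominated (F := fun x m => phiDeriv s (x - m)) (bound := fun _ => (s ^ 2)⁻¹)
    (fun _ => by fun_prop) (fun _ => ae_of_all _ fun _ => abs_phiDeriv_le hs _)
    (integrable_const _) (ae_of_all _ fun _ => by fun_prop)

theorem abs_mixPDF_sub_le {l s s' : ℝ} (hl : 0 < l) (hs : l ≤ s) (hs' : l ≤ s') (x : ℝ) :
    |mixPDF G s x - mixPDF G s' x| ≤ (l ^ 2)⁻¹ * |s - s'| := by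
  rw [mixPDF, mixPDF, ← integral_sub (integrable_phi_sub G (hl.trans_le hs) x)
    (integrable_phi_sub G (hl.trans_le hs') x)]
  exact abs_integral_le_of_abs_le fun m => abs_phi_sub_le hl hs hs' (x - m)

theorem abs_mixPDFDeriv_sub_le {l s s' : ℝ} (hl : 0 < l) (hs : l ≤ s) (hs' : l ≤ s') (x : ℝ) :
    |mixPDFDeriv G s x - mixPDFDeriv G s' x| ≤ 6 * (l ^ 3)⁻¹ * |s - s'| := by
  rw [mixPDFDeriv, mixPDFDeriv, ← integral_sub (integrable_phiDeriv_sub G (hl.trans_le hs) x)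
    (integrable_phiDeriv_sub G (hl.trans_le hs') x)]
  exact abs_integral_le_of_abs_le fun m => abs_phiDeriv_sub_le hl hs hs' (x - m)

variable {G} in
theorem abs_integral_mul_phi_sub_le {s K : ℝ} {g : ℝ → ℝ} (hs : 0 < s) (x : ℝ)
    (hg : ∀ᵐ m ∂G, |g m| ≤ K) : |∫ m, g m * phi s (x - m) ∂G| ≤ K * mixPDF G s x := by
  rw [mixPDF, ← integral_const_mul, ← norm_eq_abs]
  refine norm_integral_le_of_norm_le ((integrable_phi_sub G hs x).const_mul _) ?_
  filter_upwards [hg] with m hm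
  rw [norm_mul, norm_eq_abs, norm_of_nonneg (phi_pos hs _).le]
  exact mul_le_mul_of_nonneg_right hm (phi_pos hs _).le

theorem mul_phi_sub_eq {s : ℝ} (hs : 0 < s) (x m : ℝ) :
    m * phi s (x - m) = x * phi s (x - m) + s ^ 2 * phiDeriv s (x - m) := by
  unfold phiDeriv
  field_simp
  ring

theorem integrable_mul_phi_sub {s : ℝ} (hs : 0 < s) (x : ℝ) :
    Integrable (fun m => m * phi s (x - m)) G := by
  simp only [mul_phi_sub_eq hs]
  exact ((integrable_phi_sub G hs x).const_mul x).add
    ((integrable_phiDeriv_sub G hs x).const_mul (s ^ 2))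

/-- Tweedie's formula `E(m | x) = x + s² f'(x) / f(x)`, before division by `f(x)`. -/
theorem integral_mul_phi_sub {s : ℝ} (hs : 0 < s) (x : ℝ) :
    ∫ m, m * phi s (x - m) ∂G = x * mixPDF G s x + s ^ 2 * mixPDFDeriv G s x := by
  simp only [mul_phi_sub_eq hs, mixPDF, mixPDFDeriv, ← integral_const_mul]
  exact integral_add ((integrable_phi_sub G hs x).const_mul x)
    ((integrable_phiDeriv_sub G hs x).const_mul (s ^ 2))

variable {G} {C : ℝ} (hG : ∀ᵐ m ∂G, |m| ≤ C)
include hG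

theorem nonneg_of_ae_abs_le : 0 ≤ C := by
  obtain ⟨m, hm⟩ := hG.exists
  exact (abs_nonneg m).trans hm

theorem abs_mixPDFDeriv_le_mul_mixPDF {s : ℝ} (hs : 0 < s) (x : ℝ) :
    |mixPDFDeriv G s x| ≤ (|x| + C) / s ^ 2 * mixPDF G s x := by
  have : mixPDFDeriv G s x = ∫ m, -(x - m) / s ^ 2 * phi s (x - m) ∂G := by
    simp only [mixPDFDeriv, phiDeriv, mul_comm]
  rw [this]
  refine abs_integral_mul_phi_sub_le hs x ?_
  filter_upwards [ae_abs_sub_le hG x] with m hm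
  rw [abs_div, abs_neg, abs_of_pos (by positivity : 0 < s ^ 2)]
  gcongr

theorem abs_mul_mixPDF_add_le {s : ℝ} (hs : 0 < s) (x : ℝ) :
    |x * mixPDF G s x + s ^ 2 * mixPDFDeriv G s x| ≤ C * mixPDF G s x := by
  rw [← integral_mul_phi_sub G hs]
  exact abs_integral_mul_phi_sub_le hs x hG

theorem le_mixPDF {s : ℝ} (hs : 0 < s) (x : ℝ) :
    (3 * s)⁻¹ * exp (-(((|x| + C) / s) ^ 2) / 2) ≤ mixPDF G s x := by
  have pointwise : ∀ᵐ m ∂G, (3 * s)⁻¹ * exp (-(((|x| + C) / s) ^ 2) / 2) ≤ phi s (x - m) := by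
    filter_upwards [ae_abs_sub_le hG x] with m hm
    have : ((x - m) / s) ^ 2 ≤ ((|x| + C) / s) ^ 2 := by
      rw [← sq_abs, abs_div, abs_of_pos hs]
      gcongr
    rw [phi_eq]
    gcongr
    exact sqrt_two_pi_le_three
  simpa only [mixPDF, integral_const, probReal_univ, one_smul] using
    integral_mono_ae (integrable_const _) (integrable_phi_sub G hs x) pointwise

theorem mixPDF_le_exp {s : ℝ} (hs : 0 < s) {x : ℝ} (hx : 2 * C ≤ |x|) :
    mixPDF G s x ≤ s⁻¹ * exp (-(x ^ 2) / (8 * s ^ 2)) := by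
  have pointwise : ∀ᵐ m ∂G, phi s (x - m) ≤ s⁻¹ * exp (-(x ^ 2) / (8 * s ^ 2)) := by
    filter_upwards [hG] with m hm
    have half_le : |x / 2| ≤ |x - m| := by
      rw [abs_div, abs_two]
      linarith [abs_sub_abs_le_abs_sub x m]
    have := div_le_div_of_nonneg_right (sq_le_sq.2 half_le) (by positivity : 0 ≤ 2 * s ^ 2)
    refine (phi_le_inv_mul_exp hs _).trans
      (mul_le_mul_of_nonneg_left (exp_le_exp.2 ?_) (by positivity))
    calc -((x - m) / s) ^ 2 / 2 = -((x - m) ^ 2 / (2 * s ^ 2)) := by ring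
      _ ≤ -((x / 2) ^ 2 / (2 * s ^ 2)) := neg_le_neg this
      _ = -(x ^ 2) / (8 * s ^ 2) := by ring
  simpa only [mixPDF, integral_const, probReal_univ, one_smul] using
    integral_mono_ae (integrable_phi_sub G hs x) (integrable_const _) pointwise

theorem abs_log_mixPDF_le {s : ℝ} (hs : 0 < s) (x : ℝ) :
    |log (mixPDF G s x)| ≤ |log s| + log 3 + ((|x| + C) / s) ^ 2 / 2 := by
  have upper := log_le_log (mixPDF_pos G hs x) (mixPDF_le_inv G hs x)
  have lower := log_le_log (by positivity) (le_mixPDF hG hs x)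
  rw [log_inv] at upper
  rw [log_mul (by positivity) (by positivity), log_exp, log_inv, log_mul three_ne_zero hs.ne']
    at lower
  have : 0 < log 3 := log_pos (by norm_num)
  have : 0 ≤ ((|x| + C) / s) ^ 2 / 2 := by positivity
  exact abs_le.2 ⟨by linarith [le_abs_self (log s)], by linarith [neg_abs_le (log s)]⟩

theorem mul_mixPDF_le_mixPDF_of_scale {l s s' x Z : ℝ} (hl : 0 < l) (hs : l ≤ s) (hs' : l ≤ s')
    (hx : |x| + C ≤ Z) :
    (1 - l⁻¹ * ((Z / l) ^ 2 + 1) * |s' - s|) * mixPDF G s x ≤ mixPDF G s' x := by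
  rw [mixPDF, mixPDF, ← integral_const_mul]
  refine integral_mono_ae ((integrable_phi_sub G (hl.trans_le hs) x).const_mul _)
    (integrable_phi_sub G (hl.trans_le hs') x) ?_
  filter_upwards [ae_abs_sub_le hG x] with m hm
  exact mul_phi_le_phi_of_scale hl hs hs' (hm.trans hx)

end Mixture

section Noise

theorem map_affine_gaussianReal (m s : ℝ) :
    (gaussianReal 0 1).map (fun z => m + s * z) = gaussianReal m (s ^ 2).toNNReal := by
  have : (gaussianReal 0 1).map (fun z => m + s * z) =
      ((gaussianReal 0 1).map (s * ·)).map (m + ·) :=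
    (Measure.map_map (by fun_prop) (by fun_prop)).symm
  rw [this, gaussianReal_map_const_mul, gaussianReal_map_const_add, mul_zero, zero_add, mul_one]
  congr 1
  exact (toNNReal_of_nonneg (sq_nonneg s)).symm

theorem lintegral_affine_gaussianReal {s : ℝ} (hs : 0 < s) (m : ℝ) {F : ℝ → ENNReal}
    (hF : Measurable F) :
    ∫⁻ z, F (m + s * z) ∂(gaussianReal 0 1) = ∫⁻ x, ENNReal.ofReal (phi s (x - m)) * F x := by
  have var_ne_zero : (s ^ 2).toNNReal ≠ 0 := by simp [hs.ne']
  rw [← lintegral_map hF (by fun_prop : Measurable fun z => m + s * z), map_affine_gaussianReal,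
    gaussianReal_of_var_ne_zero _ var_ne_zero,
    lintegral_withDensity_eq_lintegral_mul _ (measurable_gaussianPDF _ _) hF]
  simp only [Pi.mul_apply, gaussianPDF, phi_eq_gaussianPDFReal hs]

theorem integral_affine_gaussianReal {s : ℝ} (hs : 0 < s) (m : ℝ) {F : ℝ → ℝ}
    (hF : Measurable F) :
    ∫ z, F (m + s * z) ∂(gaussianReal 0 1) = ∫ x, F x * phi s (x - m) := by
  have var_ne_zero : (s ^ 2).toNNReal ≠ 0 := by simp [hs.ne']
  rw [← integral_map (φ := fun z => m + s * z) (by fun_prop) hF.aestronglyMeasurable,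
    map_affine_gaussianReal, integral_gaussianReal_eq_integral_smul var_ne_zero]
  simp only [smul_eq_mul, phi_eq_gaussianPDFReal hs, mul_comm]

variable (G : Measure ℝ) [IsProbabilityMeasure G]

/-- The joint law of a mean and an independent standard normal noise variable. -/
noncomputable def noiseLaw : Measure (ℝ × ℝ) := G.prod (gaussianReal 0 1)

instance : IsProbabilityMeasure (noiseLaw G) := by unfold noiseLaw; infer_instance

/-- The law of an observation `m + s z` with scale `s`, where `(m, z)` has law `noiseLaw G`. -/
noncomputable def obsLaw (s : ℝ) : Measure ℝ := (noiseLaw G).map fun p => p.1 + s * p.2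

instance (s : ℝ) : IsProbabilityMeasure (obsLaw G s) :=
  Measure.isProbabilityMeasure_map (by fun_prop)

theorem mixPDF_obsLaw {r s : ℝ} (hr : 0 < r) (hs : 0 < s) (x : ℝ) :
    mixPDF (obsLaw G s) r x = mixPDF G √(r ^ 2 + s ^ 2) x := by
  have integrable : Integrable (fun p : ℝ × ℝ => phi r (x - (p.1 + s * p.2))) (noiseLaw G) :=
    (integrable_phi_sub (obsLaw G s) hr x).comp_measurable (by fun_prop)
  rw [mixPDF, obsLaw, integral_map (by fun_prop) (by fun_prop), noiseLaw,
    integral_prod _ integrable]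
  congr with m
  rw [integral_affine_gaussianReal hs m (F := fun y => phi r (x - y)) (by fun_prop),
    integral_phi_mul_phi hr hs]

theorem mixPDFDeriv_obsLaw {r s : ℝ} (hr : 0 < r) (hs : 0 < s) (x : ℝ) :
    mixPDFDeriv (obsLaw G s) r x = mixPDFDeriv G √(r ^ 2 + s ^ 2) x :=
  (funext (mixPDF_obsLaw G hr hs) ▸ hasDerivAt_mixPDF (obsLaw G s) hr x).unique
    (hasDerivAt_mixPDF G (by positivity) x)

end Noise

/-! ### Kernel averages -/

section Simplex

variable {ι : Type*} [Fintype ι] {w : ι → ℝ} (hw : w ∈ stdSimplex ℝ ι)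
include hw

theorem sum_mul_const (c : ℝ) : ∑ j, w j * c = c := by
  rw [← Finset.sum_mul, hw.2, one_mul]

theorem sum_mul_le {c : ι → ℝ} {K : ℝ} (hc : ∀ j, c j ≤ K) : ∑ j, w j * c j ≤ K :=
  calc ∑ j, w j * c j ≤ ∑ j, w j * K := by gcongr with j; exacts [hw.1 j, hc j]
    _ = K := sum_mul_const hw K

theorem abs_sum_mul_le (c : ι → ℝ) : |∑ j, w j * c j| ≤ ∑ j, w j * |c j| :=
  (Finset.abs_sum_le_sum_abs _ _).trans_eq <| by simp only [abs_mul, abs_of_nonneg (hw.1 _)]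

theorem abs_sum_mul_sub_le (c : ι → ℝ) (a : ℝ) : |∑ j, w j * c j - a| ≤ ∑ j, w j * |c j - a| := by
  have : ∑ j, w j * c j - a = ∑ j, w j * (c j - a) := by
    simp only [mul_sub, Finset.sum_sub_distrib, sum_mul_const hw]
  rw [this]
  exact abs_sum_mul_le hw _

theorem one_le_card_mul {i : ι} (hi : ∀ j, w j ≤ w i) : 1 ≤ Fintype.card ι * w i := by
  rw [← hw.2, ← nsmul_eq_mul]
  exact Finset.sum_le_card_nsmul _ _ _ fun j _ => hi j

theorem sum_mul_pos {c : ι → ℝ} (hc : ∀ j, 0 < c j) : 0 < ∑ j, w j * c j := by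
  obtain ⟨j, -, hj⟩ := Finset.exists_ne_zero_of_sum_ne_zero (hw.2.trans_ne one_ne_zero)
  exact Finset.sum_pos' (fun j _ => mul_nonneg (hw.1 j) (hc j).le)
    ⟨j, Finset.mem_univ j, mul_pos ((hw.1 j).lt_of_ne' hj) (hc j)⟩

theorem sum_sq_le {i : ι} (hi : ∀ j, w j ≤ w i) : ∑ j, w j ^ 2 ≤ w i :=
  calc ∑ j, w j ^ 2 = ∑ j, w j * w j := by simp only [pow_two]
    _ ≤ w i := sum_mul_le hw hi

end Simplex

section KernelAverage

variable {ι : Type*} [Fintype ι]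

/-- The average with weights `w` of Gaussian kernels with scales `r`, at displacements `z` from
the centres. -/
noncomputable def kde (w r z : ι → ℝ) : ℝ := ∑ j, w j * phi (r j) (z j)

/-- The derivative of `kde w r` under a common shift of the displacements. -/
noncomputable def kdeDeriv (w r z : ι → ℝ) : ℝ := ∑ j, w j * phiDeriv (r j) (z j)

variable {w r : ι → ℝ} {τ : ℝ} (hw : w ∈ stdSimplex ℝ ι) (hτ : 0 < τ) (hr : ∀ j, τ ≤ r j)
include hw hτ hr

theorem kde_pos (z : ι → ℝ) : 0 < kde w r z :=
  sum_mul_pos hw fun j => phi_pos (hτ.trans_le (hr j)) _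

theorem kde_le_inv (z : ι → ℝ) : kde w r z ≤ τ⁻¹ :=
  sum_mul_le hw fun j => (phi_le_inv (hτ.trans_le (hr j)) _).trans (inv_anti₀ hτ (hr j))

theorem abs_kdeDeriv_le (z : ι → ℝ) : |kdeDeriv w r z| ≤ (τ ^ 2)⁻¹ :=
  (abs_sum_mul_le hw _).trans <| sum_mul_le hw fun j =>
    (abs_phiDeriv_le (hτ.trans_le (hr j)) _).trans (by gcongr; exact hr j)

theorem mul_inv_le_kde {z : ι → ℝ} {i : ι} (hz : z i = 0) : w i * (3 * r i)⁻¹ ≤ kde w r z := by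
  have hr0 : ∀ j, 0 < r j := fun j => hτ.trans_le (hr j)
  calc w i * (3 * r i)⁻¹ ≤ w i * phi (r i) (z i) := by
        rw [hz]; exact mul_le_mul_of_nonneg_left (le_phi_zero (hr0 i)) (hw.1 i)
    _ ≤ kde w r z := Finset.single_le_sum (f := fun j => w j * phi (r j) (z j))
        (fun j _ => mul_nonneg (hw.1 j) (phi_pos (hr0 j) _).le) (Finset.mem_univ i)

theorem one_le_mul_kde {z : ι → ℝ} {i : ι} (hz : z i = 0) (hi : ∀ j, w j ≤ w i) :
    1 ≤ 3 * r i * Fintype.card ι * kde w r z := by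
  have hri : 0 < r i := hτ.trans_le (hr i)
  calc 1 ≤ Fintype.card ι * w i := one_le_card_mul hw hi
    _ = 3 * r i * Fintype.card ι * (w i * (3 * r i)⁻¹) := by field_simp
    _ ≤ 3 * r i * Fintype.card ι * kde w r z := by gcongr; exact mul_inv_le_kde hw hτ hr hz

theorem abs_kdeDeriv_le_trunc {L : ℝ} (hL : 0 ≤ L) (z : ι → ℝ) :
    |kdeDeriv w r z| ≤ τ⁻¹ * (L * kde w r z + τ⁻¹ * (2 * exp (-(L ^ 2) / 4))) := by
  have summand : ∀ j, |phiDeriv (r j) (z j)| ≤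
      τ⁻¹ * (L * phi (r j) (z j) + τ⁻¹ * (2 * exp (-(L ^ 2) / 4))) := by
    intro j
    have hrj : 0 < r j := hτ.trans_le (hr j)
    have prefactor : (√(2 * π) * r j)⁻¹ ≤ τ⁻¹ := by
      gcongr
      exact (hr j).trans (le_mul_of_one_le_left hrj.le one_le_sqrt_two_pi)
    calc |phiDeriv (r j) (z j)|
        = (r j)⁻¹ * ((√(2 * π) * r j)⁻¹ * (|z j / r j| * exp (-((z j / r j) ^ 2) / 2))) := by
          rw [abs_phiDeriv hrj, phi_eq]; ring
      _ ≤ (r j)⁻¹ * ((√(2 * π) * r j)⁻¹ *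
            (L * exp (-((z j / r j) ^ 2) / 2) + 2 * exp (-(L ^ 2) / 4))) := by
          gcongr; exact abs_mul_exp_neg_sq_div_two_le_trunc _ hL
      _ = (r j)⁻¹ * (L * phi (r j) (z j) + (√(2 * π) * r j)⁻¹ * (2 * exp (-(L ^ 2) / 4))) := by
          rw [phi_eq]; ring
      _ ≤ τ⁻¹ * (L * phi (r j) (z j) + τ⁻¹ * (2 * exp (-(L ^ 2) / 4))) := by
          have := (phi_pos hrj (z j)).le
          gcongr
          exact hr j
  calc |kdeDeriv w r z| ≤ ∑ j, w j * |phiDeriv (r j) (z j)| := abs_sum_mul_le hw _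
    _ ≤ ∑ j, w j * (τ⁻¹ * (L * phi (r j) (z j) + τ⁻¹ * (2 * exp (-(L ^ 2) / 4)))) := by
        gcongr with j
        exacts [hw.1 j, summand j]
    _ = τ⁻¹ * (L * kde w r z + ∑ j, w j * (τ⁻¹ * (2 * exp (-(L ^ 2) / 4)))) := by
        simp only [kde, Finset.mul_sum, ← Finset.sum_add_distrib]
        exact Finset.sum_congr rfl fun j _ => by ring
    _ = τ⁻¹ * (L * kde w r z + τ⁻¹ * (2 * exp (-(L ^ 2) / 4))) := by rw [sum_mul_const hw]

/-- A centre at displacement `0` keeps the density estimate away from zero, so that its score is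
of order `τ⁻¹` up to logarithms. -/
theorem abs_kdeDeriv_le_mul_kde {L : ℝ} (hL : 0 ≤ L) {z : ι → ℝ} {i : ι} (hz : z i = 0)
    (hi : ∀ j, w j ≤ w i) :
    |kdeDeriv w r z| ≤
      τ⁻¹ * (L + 6 * (r i / τ) * (Fintype.card ι * exp (-(L ^ 2) / 4))) * kde w r z := by
  calc |kdeDeriv w r z| ≤ τ⁻¹ * (L * kde w r z + τ⁻¹ * (2 * exp (-(L ^ 2) / 4) * 1)) := by
        rw [mul_one]; exact abs_kdeDeriv_le_trunc hw hτ hr hL z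
    _ ≤ τ⁻¹ * (L * kde w r z + τ⁻¹ * (2 * exp (-(L ^ 2) / 4) *
          (3 * r i * Fintype.card ι * kde w r z))) := by
        gcongr; exact one_le_mul_kde hw hτ hr hz hi
    _ = τ⁻¹ * (L + 6 * (r i / τ) * (Fintype.card ι * exp (-(L ^ 2) / 4))) * kde w r z := by ring

end KernelAverage

section MixtureAverage

variable {ι : Type*} [Fintype ι] (G : Measure ℝ)

/-- The average with weights `w` of the mixture densities with scales `r`. -/
noncomputable def avgMixPDF (w r : ι → ℝ) (x : ℝ) : ℝ := ∑ j, w j * mixPDF G (r j) x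

/-- The derivative of `avgMixPDF`. -/
noncomputable def avgMixPDFDeriv (w r : ι → ℝ) (x : ℝ) : ℝ := ∑ j, w j * mixPDFDeriv G (r j) x

/-- The average distance of the scales `r` to the scale `s`. -/
noncomputable def drift (w r : ι → ℝ) (s : ℝ) : ℝ := ∑ j, w j * |r j - s|

variable [IsProbabilityMeasure G] {w r : ι → ℝ} {l s : ℝ} (hw : w ∈ stdSimplex ℝ ι) (hl : 0 < l)
  (hr : ∀ j, l ≤ r j)
include hw hl hr

theorem avgMixPDF_pos (x : ℝ) : 0 < avgMixPDF G w r x :=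
  sum_mul_pos hw fun j => mixPDF_pos G (hl.trans_le (hr j)) x

theorem abs_avgMixPDF_sub_le (hs : l ≤ s) (x : ℝ) :
    |avgMixPDF G w r x - mixPDF G s x| ≤ (l ^ 2)⁻¹ * drift w r s := by
  refine (abs_sum_mul_sub_le hw _ _).trans ?_
  rw [drift, Finset.mul_sum]
  gcongr ∑ j, ?_ with j
  rw [mul_left_comm]
  exact mul_le_mul_of_nonneg_left (abs_mixPDF_sub_le G hl (hr j) hs x) (hw.1 j)

theorem abs_avgMixPDFDeriv_sub_le (hs : l ≤ s) (x : ℝ) :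
    |avgMixPDFDeriv G w r x - mixPDFDeriv G s x| ≤ 6 * (l ^ 3)⁻¹ * drift w r s := by
  refine (abs_sum_mul_sub_le hw _ _).trans ?_
  rw [drift, Finset.mul_sum]
  gcongr ∑ j, ?_ with j
  rw [mul_left_comm]
  exact mul_le_mul_of_nonneg_left (abs_mixPDFDeriv_sub_le G hl (hr j) hs x) (hw.1 j)

variable {G} {C : ℝ} (hG : ∀ᵐ m ∂G, |m| ≤ C)
include hG

theorem abs_avgMixPDFDeriv_le_mul_avgMixPDF (x : ℝ) :
    |avgMixPDFDeriv G w r x| ≤ (|x| + C) / l ^ 2 * avgMixPDF G w r x := by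
  have hC := nonneg_of_ae_abs_le hG
  refine (abs_sum_mul_le hw _).trans ?_
  rw [avgMixPDF, Finset.mul_sum]
  gcongr ∑ j, ?_ with j
  have hrj := hl.trans_le (hr j)
  have := mixPDF_nonneg G hrj x
  rw [mul_left_comm]
  refine mul_le_mul_of_nonneg_left ((abs_mixPDFDeriv_le_mul_mixPDF hG hrj x).trans ?_) (hw.1 j)
  gcongr
  exact hr j

theorem mixPDF_le_two_mul_avgMixPDF (hs : l ≤ s) {x Z : ℝ} (hx : |x| + C ≤ Z)
    (hZ : l⁻¹ * ((Z / l) ^ 2 + 1) * drift w r s ≤ 1 / 2) :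
    mixPDF G s x ≤ 2 * avgMixPDF G w r x := by
  set M := l⁻¹ * ((Z / l) ^ 2 + 1)
  have lower : (1 - M * drift w r s) * mixPDF G s x ≤ avgMixPDF G w r x :=
    calc (1 - M * drift w r s) * mixPDF G s x
        = ∑ j, w j * ((1 - M * |r j - s|) * mixPDF G s x) := by
          simp only [← mul_assoc, ← Finset.sum_mul, mul_sub, mul_one, Finset.sum_sub_distrib, hw.2,
            drift, mul_comm M]
      _ ≤ avgMixPDF G w r x := Finset.sum_le_sum fun j _ =>
          mul_le_mul_of_nonneg_left (mul_mixPDF_le_mixPDF_of_scale hG hl hs (hr j) hx) (hw.1 j)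
  have := mixPDF_nonneg G (hl.trans_le hs) x
  nlinarith

end MixtureAverage

/-! ### The weights -/

section Weights

variable {n : ℕ} {b : ℝ} (s : Fin n → ℝ) (i : Fin n)

theorem weight_mem_stdSimplex (hb : 0 < b) : weight b s (s i) ∈ stdSimplex ℝ (Fin n) := by
  have sum_pos : 0 < ∑ k, phi b (s i - s k) :=
    Finset.sum_pos (fun _ _ => phi_pos hb _) ⟨i, Finset.mem_univ i⟩
  refine ⟨fun j => div_nonneg (phi_pos hb _).le sum_pos.le, ?_⟩
  unfold weight
  rw [← Finset.sum_div, div_self sum_pos.ne']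

theorem weight_le_self (hb : 0 < b) (j : Fin n) : weight b s (s i) j ≤ weight b s (s i) i := by
  unfold weight
  rw [sub_self]
  exact div_le_div_of_nonneg_right (phi_le_phi_zero hb _)
    (Finset.sum_nonneg fun _ _ => (phi_pos hb _).le)

theorem weight_self_nonneg (hb : 0 < b) : 0 ≤ weight b s (s i) i :=
  (weight_mem_stdSimplex s i hb).1 i

theorem weight_self_le_one (hb : 0 < b) : weight b s (s i) i ≤ 1 :=
  le_of_le_of_eq (Finset.single_le_sum (fun j _ => (weight_mem_stdSimplex s i hb).1 j)
    (Finset.mem_univ i)) (weight_mem_stdSimplex s i hb).2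

theorem weight_eq_weight_self_mul_exp (j : Fin n) :
    weight b s (s i) j = weight b s (s i) i * exp (-(((s i - s j) / b) ^ 2) / 2) := by
  unfold weight
  rw [phi_eq b (s i - s j), sub_self, phi_zero_right]
  ring

theorem drift_weight_le (hb : 0 < b) {L : ℝ} (hL : 0 ≤ L) :
    drift (weight b s (s i)) s (s i) ≤ b * (L + 2 * (n * exp (-(L ^ 2) / 4))) := by
  have hw := weight_mem_stdSimplex s i hb
  have summand : ∀ j, weight b s (s i) j * |s j - s i| ≤
      b * (L * weight b s (s i) j + 2 * exp (-(L ^ 2) / 4)) := fun j =>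
    calc weight b s (s i) j * |s j - s i|
        = b * (weight b s (s i) i *
            (|(s i - s j) / b| * exp (-(((s i - s j) / b) ^ 2) / 2))) := by
          rw [weight_eq_weight_self_mul_exp, abs_div, abs_of_pos hb, abs_sub_comm]
          field_simp
      _ ≤ b * (weight b s (s i) i *
            (L * exp (-(((s i - s j) / b) ^ 2) / 2) + 2 * exp (-(L ^ 2) / 4))) := by
          gcongr
          exacts [hw.1 i, abs_mul_exp_neg_sq_div_two_le_trunc _ hL]
      _ = b * (L * weight b s (s i) j + weight b s (s i) i * (2 * exp (-(L ^ 2) / 4))) := by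
          rw [weight_eq_weight_self_mul_exp s i j]; ring
      _ ≤ b * (L * weight b s (s i) j + 2 * exp (-(L ^ 2) / 4)) := by
          gcongr b * (_ + ?_)
          exact mul_le_of_le_one_left (by positivity) (weight_self_le_one s i hb)
  refine (Finset.sum_le_sum fun j _ => summand j).trans_eq ?_
  rw [← Finset.mul_sum, Finset.sum_add_distrib, ← Finset.mul_sum, hw.2]
  simp only [mul_one, Finset.sum_const, Finset.card_univ, Fintype.card_fin, nsmul_eq_mul]
  ring

theorem card_mul_weight_self_le_two (hb : 0 < b) {T : Finset (Fin n)}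
    (hT : ∀ j ∈ T, |s i - s j| ≤ b) : T.card * weight b s (s i) i ≤ 2 := by
  have half_le : ∀ j ∈ T, weight b s (s i) i * (1 / 2) ≤ weight b s (s i) j := by
    intro j hj
    have sq_le_one : ((s i - s j) / b) ^ 2 ≤ 1 := by
      rw [sq_le_one_iff_abs_le_one, abs_div, abs_of_pos hb]
      exact div_le_one_of_le₀ (hT j hj) hb.le
    rw [weight_eq_weight_self_mul_exp s i j]
    refine mul_le_mul_of_nonneg_left ?_ (weight_self_nonneg s i hb)
    linarith [add_one_le_exp (-(((s i - s j) / b) ^ 2) / 2)]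
  have total : T.card * (weight b s (s i) i * (1 / 2)) ≤ 1 :=
    calc T.card * (weight b s (s i) i * (1 / 2)) ≤ ∑ j ∈ T, weight b s (s i) j := by
          rw [← nsmul_eq_mul]; exact Finset.card_nsmul_le_sum _ _ _ half_le
      _ ≤ ∑ j, weight b s (s i) j := Finset.sum_le_univ_sum_of_nonneg
          (weight_mem_stdSimplex s i hb).1
      _ = 1 := (weight_mem_stdSimplex s i hb).2
  linarith

theorem sum_weight_self_le_two (hb : 0 < b) {T : Finset (Fin n)}
    (hT : ∀ i ∈ T, ∀ j ∈ T, |s i - s j| ≤ b) : ∑ i ∈ T, weight b s (s i) i ≤ 2 := by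
  rcases T.eq_empty_or_nonempty with rfl | nonempty
  · simp
  have card_pos : 0 < (T.card : ℝ) := by exact_mod_cast nonempty.card_pos
  calc ∑ i ∈ T, weight b s (s i) i ≤ ∑ i ∈ T, 2 / (T.card : ℝ) := by
        gcongr with i hi
        rw [le_div_iff₀' card_pos]
        exact card_mul_weight_self_le_two s i hb (hT i hi)
    _ = 2 := by rw [Finset.sum_const, nsmul_eq_mul, mul_div_cancel₀ _ card_pos.ne']

theorem abs_sub_le_of_floor_eq {b l x y : ℝ} (hb : 0 < b) (hx : l ≤ x) (hy : l ≤ y)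
    (h : ⌊(x - l) / b⌋₊ = ⌊(y - l) / b⌋₊) : |x - y| ≤ b := by
  have hx0 : 0 ≤ (x - l) / b := div_nonneg (sub_nonneg.2 hx) hb.le
  have hy0 : 0 ≤ (y - l) / b := div_nonneg (sub_nonneg.2 hy) hb.le
  have cells : |(x - l) / b - (y - l) / b| ≤ 1 := by
    have x_floor := Nat.floor_le hx0
    have y_floor := Nat.floor_le hy0
    have x_lt := Nat.lt_floor_add_one ((x - l) / b)
    have y_lt := Nat.lt_floor_add_one ((y - l) / b)
    rw [h] at x_floor x_lt
    exact abs_sub_le_iff.2 ⟨by linarith, by linarith⟩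
  rwa [← sub_div, sub_sub_sub_cancel_right, abs_div, abs_of_pos hb, div_le_one hb] at cells

theorem sum_weight_self_le (hb : 0 < b) {l u : ℝ} (hlu : l ≤ u) (hs : ∀ j, s j ∈ Icc l u) :
    ∑ i, weight b s (s i) i ≤ 2 * ((u - l) / b + 1) := by
  set cell : Fin n → ℕ := fun j => ⌊(s j - l) / b⌋₊
  have cell_mem : ∀ j ∈ (Finset.univ : Finset (Fin n)),
      cell j ∈ Finset.range (⌊(u - l) / b⌋₊ + 1) := fun j _ =>
    Finset.mem_range_succ_iff.2 <| Nat.floor_le_floor <| by gcongr; exact (hs j).2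
  have cell_sum : ∀ k, ∑ j with cell j = k, weight b s (s j) j ≤ 2 := fun k =>
    sum_weight_self_le_two s hb fun i hi j hj =>
      abs_sub_le_of_floor_eq hb (hs i).1 (hs j).1
        ((Finset.mem_filter.1 hi).2.trans (Finset.mem_filter.1 hj).2.symm)
  calc ∑ i, weight b s (s i) i
      = ∑ k ∈ Finset.range (⌊(u - l) / b⌋₊ + 1), ∑ j with cell j = k, weight b s (s j) j :=
        (Finset.sum_fiberwise_of_maps_to cell_mem _).symm
    _ ≤ ∑ k ∈ Finset.range (⌊(u - l) / b⌋₊ + 1), 2 := Finset.sum_le_sum fun k _ => cell_sum k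
    _ = 2 * (⌊(u - l) / b⌋₊ + 1) := by
        rw [Finset.sum_const, Finset.card_range, nsmul_eq_mul]; push_cast; ring
    _ ≤ 2 * ((u - l) / b + 1) := by
        gcongr; exact Nat.floor_le (div_nonneg (sub_nonneg.2 hlu) hb.le)

theorem weight_self_comp_perm (b : ℝ) (e : Equiv.Perm (Fin n)) :
    weight b (s ∘ e) ((s ∘ e) i) i = weight b s (s (e i)) (e i) := by
  simp only [weight, Function.comp_apply, Equiv.sum_comp e fun k => phi b (s (e i) - s k)]

@[fun_prop]
theorem measurable_weight_self (b : ℝ) :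
    Measurable fun s : Fin n → ℝ => weight b s (s i) i := by
  unfold weight; fun_prop

theorem integrable_weight_self (hb : 0 < b) (ν : Measure (Fin n → ℝ)) [IsProbabilityMeasure ν] :
    Integrable (fun s => weight b s (s i) i) ν :=
  Integrable.of_bound (measurable_weight_self i b).aestronglyMeasurable 1 <| ae_of_all _ fun s => by
    rw [norm_of_nonneg (weight_self_nonneg s i hb)]; exact weight_self_le_one s i hb

end Weights

section Exchangeable

variable {α ι : Type*} [MeasurableSpace α] [Fintype ι] (P : Measure α) [IsProbabilityMeasure P]

theorem ae_pi_forall {p : α → Prop} (hp : ∀ᵐ a ∂P, p a) :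
    ∀ᵐ D ∂(Measure.pi fun _ : ι => P), ∀ j, p (D j) :=
  ae_all_iff.2 fun j =>
    (Measure.tendsto_eval_ae_ae (μ := fun _ : ι => P) (i := j)).eventually hp

theorem measurePreserving_comp_perm (e : Equiv.Perm ι) :
    MeasurePreserving (fun D : ι → α => D ∘ e) (Measure.pi fun _ => P) (Measure.pi fun _ => P) := by
  have h := measurePreserving_piCongrLeft (fun _ : ι => P) e.symm
  convert! h using 1
  ext D j
  simp [MeasurableEquiv.coe_piCongrLeft, Equiv.piCongrLeft_apply]

/-- By exchangeability every self-weight has the same mean, so that one of them is at most the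
average of the deterministic bound on their sum. -/
theorem integral_weight_self_le (H : Measure ℝ) [IsProbabilityMeasure H] {n : ℕ} {b l u : ℝ}
    (hb : 0 < b) (hH : ∀ᵐ s ∂H, s ∈ Icc l u) (i : Fin n) :
    ∫ s, weight b s (s i) i ∂(Measure.pi fun _ => H) ≤ 2 * ((u - l) / b + 1) / n := by
  have hn : 0 < (n : ℝ) := by exact_mod_cast i.pos
  have hlu : l ≤ u := by
    obtain ⟨s, hs⟩ := hH.exists
    exact hs.1.trans hs.2
  have exchangeable : ∀ j, ∫ s, weight b s (s j) j ∂(Measure.pi fun _ : Fin n => H) =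
      ∫ s, weight b s (s i) i ∂(Measure.pi fun _ : Fin n => H) := by
    intro j
    have swap := measurePreserving_comp_perm H (Equiv.swap i j)
    nth_rewrite 2 [← swap.map_eq]
    rw [integral_map swap.measurable.aemeasurable
      (measurable_weight_self i b).aestronglyMeasurable]
    simp only [weight_self_comp_perm, Equiv.swap_apply_left]
  rw [le_div_iff₀' hn]
  calc n * ∫ s, weight b s (s i) i ∂(Measure.pi fun _ => H)
      = ∫ s, ∑ j, weight b s (s j) j ∂(Measure.pi fun _ : Fin n => H) := by
        rw [integral_finsetSum _ fun j _ => integrable_weight_self j hb _]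
        simp only [exchangeable, Finset.sum_const, Finset.card_univ, Fintype.card_fin,
          nsmul_eq_mul]
    _ ≤ ∫ _, 2 * ((u - l) / b + 1) ∂(Measure.pi fun _ : Fin n => H) := by
        refine integral_mono_ae (integrable_finsetSum _ fun j _ => integrable_weight_self j hb _)
          (integrable_const _) ?_
        filter_upwards [ae_pi_forall H hH] with s hs
        exact sum_weight_self_le s hb hlu hs
    _ = 2 * ((u - l) / b + 1) := by rw [integral_const, probReal_univ, one_smul]

end Exchangeable

/-! ### Mean absolute deviation of the kernel estimates -/

section Independence

variable {α ι : Type*} [MeasurableSpace α] [Fintype ι] (Q : ι → Measure α)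
  [∀ j, IsProbabilityMeasure (Q j)]

theorem integral_pi_eval (j : ι) {g : α → ℝ} (hg : Measurable g) :
    ∫ y, g (y j) ∂(Measure.pi Q) = ∫ a, g a ∂(Q j) := by
  have eval := measurePreserving_eval Q j
  rw [← eval.map_eq, integral_map eval.measurable.aemeasurable hg.aestronglyMeasurable]

theorem abs_le_add_inv_mul_sq {θ : ℝ} (hθ : 0 < θ) (v : ℝ) : |v| ≤ θ + θ⁻¹ * v ^ 2 := by
  rw [← mul_le_mul_iff_right₀ hθ, mul_add, mul_inv_cancel_left₀ hθ.ne', ← sq_abs v]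
  nlinarith [sq_nonneg (|v| - θ), abs_nonneg v, mul_nonneg hθ.le (abs_nonneg v)]

variable {g : ι → α → ℝ} {K : ℝ} (hg : ∀ j, Measurable (g j)) (hK : ∀ j a, |g j a| ≤ K)
include hg hK

theorem memLp_eval (j : ι) : MemLp (fun y : ι → α => g j (y j)) 2 (Measure.pi Q) :=
  MemLp.of_bound ((hg j).comp (measurable_pi_apply j)).aestronglyMeasurable K
    (ae_of_all _ fun _ => hK j _)

theorem integral_sq_sum_sub_le (S : Finset ι) :
    ∫ y, (∑ j ∈ S, (g j (y j) - ∫ a, g j a ∂(Q j))) ^ 2 ∂(Measure.pi Q) ≤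
      ∑ j ∈ S, ∫ a, g j a ^ 2 ∂(Q j) := by
  set X : ι → (ι → α) → ℝ := fun j y => g j (y j)
  have memLp : ∀ j, MemLp (X j) 2 (Measure.pi Q) := memLp_eval Q hg hK
  have mean : ∫ y, (∑ j ∈ S, X j) y ∂(Measure.pi Q) = ∑ j ∈ S, ∫ a, g j a ∂(Q j) := by
    simp_rw [Finset.sum_apply]
    rw [integral_finsetSum _ fun j _ => (memLp j).integrable one_le_two]
    exact Finset.sum_congr rfl fun j _ => integral_pi_eval Q j (hg j)
  calc ∫ y, (∑ j ∈ S, (g j (y j) - ∫ a, g j a ∂(Q j))) ^ 2 ∂(Measure.pi Q)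
      = Var[∑ j ∈ S, X j; Measure.pi Q] := by
        rw [variance_eq_integral
          (memLp_finsetSum' _ fun j _ => memLp j).aestronglyMeasurable.aemeasurable, mean]
        simp only [Finset.sum_sub_distrib, Finset.sum_apply, X]
    _ = ∑ j ∈ S, Var[X j; Measure.pi Q] :=
        IndepFun.variance_sum (fun j _ => memLp j) fun _ _ _ _ hne =>
          (iIndepFun_pi (μ := Q) fun j => (hg j).aemeasurable).indepFun hne
    _ ≤ ∑ j ∈ S, ∫ a, g j a ^ 2 ∂(Q j) := Finset.sum_le_sum fun j _ =>
        (variance_le_expectation_sq (memLp j).aestronglyMeasurable).trans_eq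
          (integral_pi_eval Q j ((hg j).pow_const 2))

theorem memLp_sum_sub (S : Finset ι) :
    MemLp (fun y => ∑ j ∈ S, (g j (y j) - ∫ a, g j a ∂(Q j))) 2 (Measure.pi Q) :=
  memLp_finsetSum _ fun j _ => (memLp_eval Q hg hK j).sub (memLp_const _)

theorem integral_abs_sum_sub_le {θ : ℝ} (hθ : 0 < θ) (S : Finset ι) :
    ∫ y, |∑ j ∈ S, (g j (y j) - ∫ a, g j a ∂(Q j))| ∂(Measure.pi Q) ≤
      θ + θ⁻¹ * ∑ j ∈ S, ∫ a, g j a ^ 2 ∂(Q j) := by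
  have square := (memLp_sum_sub Q hg hK S).integrable_sq.const_mul θ⁻¹
  calc ∫ y, |∑ j ∈ S, (g j (y j) - ∫ a, g j a ∂(Q j))| ∂(Measure.pi Q)
      ≤ ∫ y, (θ + θ⁻¹ * (∑ j ∈ S, (g j (y j) - ∫ a, g j a ∂(Q j))) ^ 2) ∂(Measure.pi Q) :=
        integral_mono_of_nonneg (ae_of_all _ fun _ => abs_nonneg _)
          ((integrable_const _).add square) (ae_of_all _ fun _ => abs_le_add_inv_mul_sq hθ _)
    _ = θ + θ⁻¹ * ∫ y, (∑ j ∈ S, (g j (y j) - ∫ a, g j a ∂(Q j))) ^ 2 ∂(Measure.pi Q) := by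
        rw [integral_add (integrable_const _) square, integral_const_mul, integral_const,
          probReal_univ, one_smul]
    _ ≤ θ + θ⁻¹ * ∑ j ∈ S, ∫ a, g j a ^ 2 ∂(Q j) := by
        gcongr; exact integral_sq_sum_sub_le Q hg hK S

theorem integral_abs_sum_update_sub_le [DecidableEq ι] (i : ι) (a : α) {θ : ℝ} (hθ : 0 < θ) :
    ∫ y, |∑ j, g j (Function.update y i a j) - ∑ j, ∫ z, g j z ∂(Q j)| ∂(Measure.pi Q) ≤
      |g i a - ∫ z, g i z ∂(Q i)| + (θ + θ⁻¹ * ∑ j, ∫ z, g j z ^ 2 ∂(Q j)) := by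
  set rest : (ι → α) → ℝ := fun y => ∑ j ∈ Finset.univ.erase i, (g j (y j) - ∫ z, g j z ∂(Q j))
  have rest_integrable : Integrable (fun y => |rest y|) (Measure.pi Q) :=
    ((memLp_sum_sub Q hg hK _).integrable one_le_two).abs
  have split : ∀ y, ∑ j, g j (Function.update y i a j) - ∑ j, ∫ z, g j z ∂(Q j) =
      (g i a - ∫ z, g i z ∂(Q i)) + rest y := by
    intro y
    rw [← Finset.sum_sub_distrib, ← Finset.add_sum_erase _ _ (Finset.mem_univ i),
      Function.update_self]
    congr 1
    exact Finset.sum_congr rfl fun j hj => by rw [Function.update_of_ne (Finset.ne_of_mem_erase hj)]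
  calc ∫ y, |∑ j, g j (Function.update y i a j) - ∑ j, ∫ z, g j z ∂(Q j)| ∂(Measure.pi Q)
      ≤ ∫ y, (|g i a - ∫ z, g i z ∂(Q i)| + |rest y|) ∂(Measure.pi Q) :=
        integral_mono_of_nonneg (ae_of_all _ fun _ => abs_nonneg _)
          ((integrable_const _).add rest_integrable) <| ae_of_all _ fun y => by
            simp only [split]; exact abs_add_le _ _
    _ = |g i a - ∫ z, g i z ∂(Q i)| + ∫ y, |rest y| ∂(Measure.pi Q) := by
        rw [integral_add (integrable_const _) rest_integrable, integral_const, probReal_univ,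
          one_smul]
    _ ≤ |g i a - ∫ z, g i z ∂(Q i)| + (θ + θ⁻¹ * ∑ j, ∫ z, g j z ^ 2 ∂(Q j)) := by
        gcongr
        refine (integral_abs_sum_sub_le Q hg hK hθ _).trans ?_
        gcongr
        exact Finset.subset_univ _

end Independence

section KernelDeviation

variable {ι : Type*} [DecidableEq ι]

/-- The displacements of `x` from the observations `y` after the `i`-th of these has been replaced
by `x` itself; the estimator at its own observation `x` sees exactly these. -/
def selfDisp (i : ι) (y : ι → ℝ) (x : ℝ) : ι → ℝ := fun j => x - Function.update y i x j

theorem selfDisp_self (i : ι) (y : ι → ℝ) (x : ℝ) : selfDisp i y x i = 0 := by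
  rw [selfDisp, Function.update_self, sub_self]

theorem selfDisp_update (i : ι) (y : ι → ℝ) (a x : ℝ) :
    selfDisp i (Function.update y i a) x = selfDisp i y x := by
  unfold selfDisp
  rw [Function.update_idem]

variable [Fintype ι] (Q : ι → Measure ℝ) [∀ j, IsProbabilityMeasure (Q j)] {w r : ι → ℝ} {i : ι}
  (hw : w ∈ stdSimplex ℝ ι) (hi : ∀ j, w j ≤ w i) (hr : ∀ j, 0 < r j)
include hw hi hr

omit [DecidableEq ι] in
theorem sum_integral_sq_kernel_le {F : ℝ → ℝ → ℝ} {κ B x : ℝ} (hκ : 0 ≤ κ) (hB : 0 ≤ B)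
    (hF : ∀ j z, F (r j) z ^ 2 ≤ κ * phi (r j) z) (hQ : ∀ j, mixPDF (Q j) (r j) x ≤ B) :
    ∑ j, ∫ z, (w j * F (r j) (x - z)) ^ 2 ∂(Q j) ≤ w i * (κ * B) := by
  have second_moment : ∀ j, ∫ z, (w j * F (r j) (x - z)) ^ 2 ∂(Q j) ≤ w j ^ 2 * (κ * B) := by
    intro j
    simp_rw [mul_pow]
    rw [integral_const_mul]
    gcongr
    calc ∫ z, F (r j) (x - z) ^ 2 ∂(Q j) ≤ ∫ z, κ * phi (r j) (x - z) ∂(Q j) :=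
          integral_mono_of_nonneg (ae_of_all _ fun _ => sq_nonneg _)
            ((integrable_phi_sub (Q j) (hr j) x).const_mul κ) (ae_of_all _ fun _ => hF j _)
      _ = κ * mixPDF (Q j) (r j) x := integral_const_mul _ _
      _ ≤ κ * B := by gcongr; exact hQ j
  calc ∑ j, ∫ z, (w j * F (r j) (x - z)) ^ 2 ∂(Q j) ≤ ∑ j, w j ^ 2 * (κ * B) :=
        Finset.sum_le_sum fun j _ => second_moment j
    _ ≤ w i * (κ * B) := by
        rw [← Finset.sum_mul]
        gcongr
        exact sum_sq_le hw hi

theorem integral_abs_kernel_sum_sub_le {F : ℝ → ℝ → ℝ} {κ B K x θ : ℝ} (hκ : 0 ≤ κ) (hB : 0 ≤ B)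
    (hθ : 0 < θ) (hFm : ∀ s, Measurable (F s)) (hK : ∀ j z, |F (r j) z| ≤ K)
    (hF : ∀ j z, F (r j) z ^ 2 ≤ κ * phi (r j) z) (hQ : ∀ j, mixPDF (Q j) (r j) x ≤ B) :
    ∫ y, |∑ j, w j * F (r j) (selfDisp i y x j) - ∑ j, w j * ∫ z, F (r j) (x - z) ∂(Q j)|
        ∂(Measure.pi Q) ≤
      w i * |F (r i) 0 - ∫ z, F (r i) (x - z) ∂(Q i)| + (θ + θ⁻¹ * (w i * (κ * B))) := by
  have bound : ∀ j z, |w j * F (r j) (x - z)| ≤ w i * K := fun j z => by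
    rw [abs_mul, abs_of_nonneg (hw.1 j)]
    exact mul_le_mul (hi j) (hK j _) (abs_nonneg _) (hw.1 i)
  have deviation := integral_abs_sum_update_sub_le Q
    (g := fun j z => w j * F (r j) (x - z)) (fun j => by fun_prop) bound i x hθ
  simp only [integral_const_mul, sub_self, ← mul_sub, abs_mul, abs_of_nonneg (hw.1 i)] at deviation
  refine deviation.trans ?_
  gcongr
  exact sum_integral_sq_kernel_le Q hw hi hr hκ hB hF hQ

end KernelDeviation

section EffectiveScale

/-- The scale of the sum of two independent centred normals with scales `h * s` and `s`: the kernel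
estimate with bandwidth `h * s` of the law of `m + s z` has mean `mixPDF G (effScale h s)`. -/
noncomputable def effScale (h s : ℝ) : ℝ := √((h * s) ^ 2 + s ^ 2)

theorem le_effScale (h : ℝ) {l s : ℝ} (hl : 0 ≤ l) (hs : l ≤ s) : l ≤ effScale h s :=
  le_sqrt_of_sq_le <| by nlinarith [sq_nonneg (h * s)]

theorem abs_effScale_sub_self_le (h : ℝ) {s : ℝ} (hs : 0 ≤ s) :
    |effScale h s - s| ≤ s * h ^ 2 := by
  rw [abs_of_nonneg (sub_nonneg.2 (le_effScale h hs le_rfl)), sub_le_iff_le_add]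
  refine sqrt_le_iff.2 ⟨by positivity, ?_⟩
  nlinarith [mul_nonneg (sq_nonneg s) (sq_nonneg h), sq_nonneg (s * h ^ 2)]

theorem drift_effScale_le {ι : Type*} [Fintype ι] {w s : ι → ℝ} (hw : w ∈ stdSimplex ℝ ι) (h : ℝ)
    {u : ℝ} (hs : ∀ j, s j ∈ Icc 0 u) (a : ℝ) :
    drift w (fun j => effScale h (s j)) a ≤ drift w s a + u * h ^ 2 := by
  rw [drift, drift, ← sum_mul_const hw (u * h ^ 2), ← Finset.sum_add_distrib]
  refine Finset.sum_le_sum fun j _ => ?_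
  rw [← mul_add]
  refine mul_le_mul_of_nonneg_left ?_ (hw.1 j)
  calc |effScale h (s j) - a| ≤ |effScale h (s j) - s j| + |s j - a| := abs_sub_le _ _ _
    _ ≤ s j * h ^ 2 + |s j - a| := by gcongr; exact abs_effScale_sub_self_le h (hs j).1
    _ ≤ |s j - a| + u * h ^ 2 := by rw [add_comm]; gcongr; exact (hs j).2

end EffectiveScale

section ObservationDeviation

variable (G : Measure ℝ) [IsProbabilityMeasure G] {ι : Type*} [Fintype ι] [DecidableEq ι]
  {w s : ι → ℝ} {i : ι} (hw : w ∈ stdSimplex ℝ ι) (hi : ∀ j, w j ≤ w i) {h l : ℝ} (hh : 0 < h)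
  (hl : 0 < l) (hs : ∀ j, l ≤ s j) {θ : ℝ} (hθ : 0 < θ) (x : ℝ)
include hw hi hh hl hs hθ

theorem integral_abs_kde_sub_le :
    ∫ y, |kde w (fun j => h * s j) (selfDisp i y x) - avgMixPDF G w (fun j => effScale h (s j)) x|
        ∂(Measure.pi fun j => obsLaw G (s j)) ≤
      w i * (h * l)⁻¹ + (θ + θ⁻¹ * (w i * ((h * l)⁻¹ * l⁻¹))) := by
  have hs0 : ∀ j, 0 < s j := fun j => hl.trans_le (hs j)
  have hr : ∀ j, 0 < h * s j := fun j => mul_pos hh (hs0 j)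
  have inv_le : ∀ j, (h * s j)⁻¹ ≤ (h * l)⁻¹ := fun j => by gcongr; exact hs j
  have mean : ∀ j, ∫ z, phi (h * s j) (x - z) ∂(obsLaw G (s j)) = mixPDF G (effScale h (s j)) x :=
    fun j => mixPDF_obsLaw G (hr j) (hs0 j) x
  have mean_le : ∀ j, mixPDF (obsLaw G (s j)) (h * s j) x ≤ l⁻¹ := fun j => by
    rw [mixPDF_obsLaw G (hr j) (hs0 j)]
    have scale_le := le_effScale h hl.le (hs j)
    exact (mixPDF_le_inv G (hl.trans_le scale_le) x).trans (inv_anti₀ hl scale_le)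
  have deviation := integral_abs_kernel_sum_sub_le (fun j => obsLaw G (s j)) hw hi hr (F := phi)
    (κ := (h * l)⁻¹) (K := (h * l)⁻¹) (by positivity) (by positivity) hθ
    (fun _ => measurable_phi measurable_const measurable_id)
    (fun j z => by
      rw [abs_of_pos (phi_pos (hr j) z)]; exact (phi_le_inv (hr j) z).trans (inv_le j))
    (fun j z => (phi_sq_le (hr j) z).trans
      (mul_le_mul_of_nonneg_right (inv_le j) (phi_pos (hr j) z).le)) mean_le
  simp only [mean] at deviation
  refine deviation.trans ?_
  have self : |phi (h * s i) 0 - mixPDF G (effScale h (s i)) x| ≤ (h * l)⁻¹ := by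
    rw [← mean]
    exact (abs_sub_le_of_nonneg_of_le (phi_pos (hr i) 0).le (phi_le_inv (hr i) 0)
      (mixPDF_nonneg _ (hr i) x) (mixPDF_le_inv _ (hr i) x)).trans (inv_le i)
  gcongr
  exact hw.1 i

theorem integral_abs_kdeDeriv_sub_le :
    ∫ y, |kdeDeriv w (fun j => h * s j) (selfDisp i y x) -
        avgMixPDFDeriv G w (fun j => effScale h (s j)) x|
        ∂(Measure.pi fun j => obsLaw G (s j)) ≤
      w i * (l ^ 2)⁻¹ + (θ + θ⁻¹ * (w i * (((h * l) ^ 3)⁻¹ * l⁻¹))) := by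
  have hs0 : ∀ j, 0 < s j := fun j => hl.trans_le (hs j)
  have hr : ∀ j, 0 < h * s j := fun j => mul_pos hh (hs0 j)
  have inv_le : ∀ (q : ℕ) j, ((h * s j) ^ q)⁻¹ ≤ ((h * l) ^ q)⁻¹ := fun q j => by
    gcongr; exact hs j
  have scale_le : ∀ j, l ≤ effScale h (s j) := fun j => le_effScale h hl.le (hs j)
  have mean : ∀ j, ∫ z, phiDeriv (h * s j) (x - z) ∂(obsLaw G (s j)) =
      mixPDFDeriv G (effScale h (s j)) x := fun j => mixPDFDeriv_obsLaw G (hr j) (hs0 j) x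
  have mean_le : ∀ j, mixPDF (obsLaw G (s j)) (h * s j) x ≤ l⁻¹ := fun j => by
    rw [mixPDF_obsLaw G (hr j) (hs0 j)]
    exact (mixPDF_le_inv G (hl.trans_le (scale_le j)) x).trans (inv_anti₀ hl (scale_le j))
  have deviation := integral_abs_kernel_sum_sub_le (fun j => obsLaw G (s j)) hw hi hr
    (F := phiDeriv) (κ := ((h * l) ^ 3)⁻¹) (K := ((h * l) ^ 2)⁻¹) (by positivity) (by positivity)
    hθ (fun _ => measurable_phiDeriv measurable_const measurable_id)
    (fun j z => (abs_phiDeriv_le (hr j) z).trans (inv_le 2 j))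
    (fun j z => (phiDeriv_sq_le (hr j) z).trans
      (mul_le_mul_of_nonneg_right (inv_le 3 j) (phi_pos (hr j) z).le)) mean_le
  simp only [mean] at deviation
  refine deviation.trans ?_
  have self : |phiDeriv (h * s i) 0 - mixPDFDeriv G (effScale h (s i)) x| ≤ (l ^ 2)⁻¹ := by
    rw [phiDeriv, neg_zero, zero_div, mul_zero, zero_sub, abs_neg]
    refine (abs_mixPDFDeriv_le G (hl.trans_le (scale_le i)) x).trans ?_
    gcongr
    exact scale_le i
  gcongr
  exact hw.1 i

end ObservationDeviation

/-! ### Integrated differences of scores -/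

section Score

theorem mul_abs_log_sub_log_le_of_half_le {a f : ℝ} (ha : 0 < a) (hf : 0 < f) (h : f / 2 ≤ a) :
    f * |log a - log f| ≤ 2 * |a - f| := by
  have half : f / a ≤ 2 := by rw [div_le_iff₀ ha]; linarith
  rcases le_total f a with hfa | hfa
  · rw [abs_of_nonneg (sub_nonneg.2 (log_le_log hf hfa)), abs_of_nonneg (sub_nonneg.2 hfa),
      ← log_div ha.ne' hf.ne']
    calc f * log (a / f) ≤ f * (a / f - 1) := by
          gcongr; exact log_le_sub_one_of_pos (by positivity)
      _ = a - f := by field_simp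
      _ ≤ 2 * (a - f) := by linarith
  · rw [abs_sub_comm, abs_sub_comm a, abs_of_nonneg (sub_nonneg.2 (log_le_log ha hfa)),
      abs_of_nonneg (sub_nonneg.2 hfa), ← log_div hf.ne' ha.ne']
    calc f * log (f / a) ≤ f * (f / a - 1) := by
          gcongr; exact log_le_sub_one_of_pos (by positivity)
      _ = f / a * (f - a) := by field_simp
      _ ≤ 2 * (f - a) := mul_le_mul_of_nonneg_right half (sub_nonneg.2 hfa)

theorem mul_abs_log_sub_log_le {a f c : ℝ} (ha : 0 < a) (hf : 0 < f)
    (hc : |log a - log f| ≤ c) : f * |log a - log f| ≤ 2 * (1 + c) * |a - f| := by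
  have hc0 : 0 ≤ c := (abs_nonneg _).trans hc
  rcases le_or_gt (f / 2) a with h | h
  · refine (mul_abs_log_sub_log_le_of_half_le ha hf h).trans ?_
    nlinarith [mul_nonneg hc0 (abs_nonneg (a - f))]
  · have half_le : f / 2 ≤ |a - f| := by rw [abs_of_neg (by linarith)]; linarith
    calc f * |log a - log f| ≤ f * c := by gcongr
      _ ≤ 2 * (1 + c) * (f / 2) := by nlinarith
      _ ≤ 2 * (1 + c) * |a - f| := by gcongr

theorem mul_abs_div_sub_div_le (a a' f' : ℝ) {f : ℝ} (ha : 0 < a) (hf : 0 < f) :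
    f * |a' / a - f' / f| ≤ |a' / a| * |a - f| + |a' - f'| := by
  calc f * |a' / a - f' / f| = |-(a' / a * (a - f)) + (a' - f')| := by
        rw [← abs_of_pos hf, ← abs_mul, abs_of_pos hf]
        congr 1
        field_simp
        ring
    _ ≤ |a' / a| * |a - f| + |a' - f'| := by
        rw [← abs_mul, ← abs_neg (a' / a * (a - f))]; exact abs_add_le _ _

variable {A A' f f' : ℝ → ℝ} {t R : ℝ} (htR : t ≤ R) (hA : ∀ x, 0 < A x) (hf : ∀ x, 0 < f x)
  (hA' : ∀ x, HasDerivAt A (A' x) x) (hf' : ∀ x, HasDerivAt f (f' x) x) (hAc : Continuous A')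
  (hfc : Continuous f')
include htR hA hf hA' hf' hAc hfc

theorem setIntegral_score_sub_eq :
    ∫ x in Ioc t R, (A' x / A x * f x - f' x) =
      f R * (log (A R) - log (f R)) - f t * (log (A t) - log (f t)) -
        ∫ x in Ioc t R, f' x * (log (A x) - log (f x)) := by
  have continuous_A : Continuous A := continuous_iff_continuousAt.2 fun x => (hA' x).continuousAt
  have continuous_f : Continuous f := continuous_iff_continuousAt.2 fun x => (hf' x).continuousAt
  have continuous_score : Continuous fun x => A' x / A x * f x - f' x :=
    ((hAc.div continuous_A fun x => (hA x).ne').mul continuous_f).sub hfc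
  have continuous_log : Continuous fun x => f' x * (log (A x) - log (f x)) :=
    hfc.mul ((continuous_A.log fun x => (hA x).ne').sub (continuous_f.log fun x => (hf x).ne'))
  have hasDerivAt_product : ∀ x, HasDerivAt (fun x => f x * (log (A x) - log (f x)))
      (f' x * (log (A x) - log (f x)) + (A' x / A x * f x - f' x)) x := by
    intro x
    refine ((hf' x).mul (((hA' x).log (hA x).ne').sub ((hf' x).log (hf x).ne'))).congr_deriv ?_
    have := (hf x).ne'
    simp only [Pi.sub_apply]
    field_simp
  have parts := intervalIntegral.integral_eq_sub_of_hasDerivAt (fun x _ => hasDerivAt_product x)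
    ((continuous_log.add continuous_score).intervalIntegrable t R)
  rw [intervalIntegral.integral_add (continuous_log.intervalIntegrable _ _)
    (continuous_score.intervalIntegrable _ _), intervalIntegral.integral_of_le htR,
    intervalIntegral.integral_of_le htR] at parts
  linarith

/-- Integration by parts moves the derivative from the estimate `A` to the known density `f`. -/
theorem abs_integral_score_sub_le {c M : ℝ} (hM : 0 ≤ M)
    (hc : ∀ x ∈ Icc t R, |log (A x) - log (f x)| ≤ c)
    (hfM : ∀ x ∈ Icc t R, |f' x| ≤ M * f x) :
    |∫ x in Ioc t R, (A' x / A x * f x - f' x)| ≤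
      2 * (1 + c) * (|A t - f t| + |A R - f R| + M * ∫ x in Ioc t R, |A x - f x|) := by
  have continuous_A : Continuous A := continuous_iff_continuousAt.2 fun x => (hA' x).continuousAt
  have continuous_f : Continuous f := continuous_iff_continuousAt.2 fun x => (hf' x).continuousAt
  have log_bound : ∀ x ∈ Icc t R, f x * |log (A x) - log (f x)| ≤ 2 * (1 + c) * |A x - f x| :=
    fun x hx => mul_abs_log_sub_log_le (hA x) (hf x) (hc x hx)
  have boundary : ∀ x ∈ Icc t R, |f x * (log (A x) - log (f x))| ≤ 2 * (1 + c) * |A x - f x| :=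
    fun x hx => by rw [abs_mul, abs_of_pos (hf x)]; exact log_bound x hx
  have interior : |∫ x in Ioc t R, f' x * (log (A x) - log (f x))| ≤
      ∫ x in Ioc t R, M * (2 * (1 + c)) * |A x - f x| := by
    have dominating : IntegrableOn (fun x => M * (2 * (1 + c)) * |A x - f x|) (Ioc t R) :=
      (continuous_const.mul (continuous_A.sub continuous_f).abs).integrableOn_Icc.mono_set
        Ioc_subset_Icc_self
    rw [← norm_eq_abs]
    refine norm_integral_le_of_norm_le dominating ?_
    filter_upwards [ae_restrict_mem measurableSet_Ioc] with x hx
    have hx' := Ioc_subset_Icc_self hx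
    calc ‖f' x * (log (A x) - log (f x))‖ ≤ M * f x * |log (A x) - log (f x)| := by
          rw [norm_mul, norm_eq_abs, norm_eq_abs]; gcongr; exact hfM x hx'
      _ ≤ M * (2 * (1 + c) * |A x - f x|) := by
          rw [mul_assoc]; exact mul_le_mul_of_nonneg_left (log_bound x hx') hM
      _ = M * (2 * (1 + c)) * |A x - f x| := by ring
  rw [integral_const_mul] at interior
  rw [setIntegral_score_sub_eq htR hA hf hA' hf' hAc hfc]
  linarith [abs_sub (f R * (log (A R) - log (f R)) - f t * (log (A t) - log (f t)))
      (∫ x in Ioc t R, f' x * (log (A x) - log (f x))),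
    abs_sub (f R * (log (A R) - log (f R))) (f t * (log (A t) - log (f t))),
    boundary t ⟨le_rfl, htR⟩, boundary R ⟨htR, le_rfl⟩]

end Score

section Window

variable {E : Type*} [MeasurableSpace E] {ν : Measure E} [IsProbabilityMeasure ν] {F : E → ℝ → ℝ}
  {t R : ℝ}

theorem integrable_uncurry_restrict_Ioc (hF : Measurable (Function.uncurry F)) {K : ℝ}
    (hK : ∀ e, ∀ x ∈ Ioc t R, |F e x| ≤ K) :
    Integrable (Function.uncurry F) (ν.prod (volume.restrict (Ioc t R))) := by
  refine Integrable.of_bound hF.aestronglyMeasurable K ?_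
  filter_upwards [Measure.quasiMeasurePreserving_snd.ae (ae_restrict_mem measurableSet_Ioc)]
    with p hp
  exact hK p.1 p.2 hp

theorem integral_setIntegral_le (htR : t ≤ R) {B : ℝ}
    (hF : Integrable (Function.uncurry F) (ν.prod (volume.restrict (Ioc t R))))
    (hB : ∀ x ∈ Ioc t R, ∫ e, F e x ∂ν ≤ B) :
    ∫ e, (∫ x in Ioc t R, F e x) ∂ν ≤ (R - t) * B := by
  rw [integral_integral_swap hF]
  calc ∫ x in Ioc t R, (∫ e, F e x ∂ν) ≤ ∫ _ in Ioc t R, B :=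
        setIntegral_mono_on hF.integral_prod_right (integrableOn_const (by simp))
          measurableSet_Ioc hB
    _ = (R - t) * B := by simp [htR]

end Window

section Tail

variable {G : Measure ℝ} [IsProbabilityMeasure G] {C s : ℝ} (hG : ∀ᵐ m ∂G, |m| ≤ C) (hs : 0 < s)
include hs

theorem integrable_abs_mul_exp_neg_sq :
    Integrable fun x : ℝ => |x| * exp (-(x ^ 2) / (8 * s ^ 2)) := by
  refine (integrable_mul_exp_neg_mul_sq (b := (8 * s ^ 2)⁻¹) (by positivity)).abs.congr
    (ae_of_all _ fun x => ?_)
  simp only [abs_mul, abs_exp]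
  congr 2
  ring

theorem integral_Ioi_mul_exp_neg_sq {R : ℝ} (hR : 0 ≤ R) :
    ∫ x in Ioi R, |x| * exp (-(x ^ 2) / (8 * s ^ 2)) =
      4 * s ^ 2 * exp (-(R ^ 2) / (8 * s ^ 2)) := by
  have hasDerivAt : ∀ x ∈ Ici R, HasDerivAt
      (fun x => -(4 * s ^ 2 * exp (-(x ^ 2) / (8 * s ^ 2))))
      (|x| * exp (-(x ^ 2) / (8 * s ^ 2))) x := by
    intro x hx
    rw [abs_of_nonneg (hR.trans hx)]
    refine (((((hasDerivAt_pow 2 x).neg).div_const (8 * s ^ 2)).exp.const_mul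
      (4 * s ^ 2)).neg).congr_deriv ?_
    simp only [Pi.neg_apply, neg_div]
    field_simp
    ring
  have vanishing : Tendsto (fun x : ℝ => -(4 * s ^ 2 * exp (-(x ^ 2) / (8 * s ^ 2)))) atTop
      (nhds 0) := by
    have exponent : Tendsto (fun x : ℝ => -(x ^ 2) / (8 * s ^ 2)) atTop atBot :=
      (tendsto_neg_atTop_atBot.comp (tendsto_pow_atTop two_ne_zero)).atBot_div_const (by positivity)
    simpa using ((tendsto_exp_atBot.comp exponent).const_mul (4 * s ^ 2)).neg
  rw [integral_Ioi_of_hasDerivAt_of_tendsto' hasDerivAt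
    (integrable_abs_mul_exp_neg_sq hs).integrableOn vanishing, zero_sub, neg_neg]

include hG

theorem mixPDF_le_mul_exp (x : ℝ) :
    mixPDF G s x ≤ s⁻¹ * exp ((2 * C) ^ 2 / (8 * s ^ 2)) * exp (-(x ^ 2) / (8 * s ^ 2)) := by
  rcases le_total (2 * C) |x| with hx | hx
  · refine (mixPDF_le_exp hG hs hx).trans ?_
    gcongr
    exact le_mul_of_one_le_right (by positivity) (one_le_exp (by positivity))
  · refine (mixPDF_le_inv G hs x).trans ?_
    rw [mul_assoc, ← exp_add, ← add_div, ← sub_eq_add_neg]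
    refine le_mul_of_one_le_right (by positivity) (one_le_exp ?_)
    have := sq_le_sq' (by linarith [abs_nonneg x]) hx
    rw [sq_abs] at this
    exact div_nonneg (sub_nonneg.2 this) (by positivity)

theorem integrable_mixPDF_linear (a : ℝ) : Integrable fun x => (a + |x|) * mixPDF G s x := by
  have gaussian : Integrable fun x : ℝ => exp (-(x ^ 2) / (8 * s ^ 2)) := by
    refine (integrable_exp_neg_mul_sq (b := (8 * s ^ 2)⁻¹) (by positivity)).congr
      (ae_of_all _ fun x => ?_)
    simp only
    congr 1
    ring
  have continuous := continuous_mixPDF G hs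
  refine Integrable.mono' (((gaussian.const_mul |a|).add
    (integrable_abs_mul_exp_neg_sq hs)).const_mul (s⁻¹ * exp ((2 * C) ^ 2 / (8 * s ^ 2))))
    (by fun_prop) (ae_of_all _ fun x => ?_)
  rw [norm_mul, norm_eq_abs, norm_of_nonneg (mixPDF_nonneg G hs x)]
  calc |a + (|x|)| * mixPDF G s x ≤ (|a| + |x|) *
        (s⁻¹ * exp ((2 * C) ^ 2 / (8 * s ^ 2)) * exp (-(x ^ 2) / (8 * s ^ 2))) := by
        gcongr
        exacts [mixPDF_nonneg G hs x, (abs_add_le _ _).trans_eq (by rw [abs_abs]),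
          mixPDF_le_mul_exp hG hs x]
    _ = s⁻¹ * exp ((2 * C) ^ 2 / (8 * s ^ 2)) *
        (|a| * exp (-(x ^ 2) / (8 * s ^ 2)) + |x| * exp (-(x ^ 2) / (8 * s ^ 2))) := by ring

theorem setIntegral_mixPDF_linear_le {a R : ℝ} (ha : 0 ≤ a) (hR : 1 ≤ R) (hRC : 2 * C ≤ R) :
    ∫ x in Ioi R, (a + |x|) * mixPDF G s x ≤ 4 * s * (a + 1) * exp (-(R ^ 2) / (8 * s ^ 2)) := by
  calc ∫ x in Ioi R, (a + |x|) * mixPDF G s x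
      ≤ ∫ x in Ioi R, (a + 1) * s⁻¹ * (|x| * exp (-(x ^ 2) / (8 * s ^ 2))) := by
        refine setIntegral_mono_on (integrable_mixPDF_linear hG hs a).integrableOn
          ((integrable_abs_mul_exp_neg_sq hs).const_mul _).integrableOn measurableSet_Ioi
          fun x hx => ?_
        have le_abs : R ≤ |x| := le_of_lt (lt_of_lt_of_le hx (le_abs_self x))
        calc (a + |x|) * mixPDF G s x
            ≤ ((a + 1) * |x|) * (s⁻¹ * exp (-(x ^ 2) / (8 * s ^ 2))) := by
              gcongr
              exacts [mixPDF_nonneg G hs x, by nlinarith, mixPDF_le_exp hG hs (hRC.trans le_abs)]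
          _ = (a + 1) * s⁻¹ * (|x| * exp (-(x ^ 2) / (8 * s ^ 2))) := by ring
    _ = 4 * s * (a + 1) * exp (-(R ^ 2) / (8 * s ^ 2)) := by
        rw [integral_const_mul, integral_Ioi_mul_exp_neg_sq hs (zero_le_one.trans hR)]
        field_simp

end Tail

/-! ### Small bandwidths -/

theorem integral_abs_sub_le_add {α : Type*} [MeasurableSpace α] {P : Measure α}
    [IsProbabilityMeasure P] {f : α → ℝ} (hf : Integrable f P) (a b : ℝ) :
    ∫ y, |f y - b| ∂P ≤ ∫ y, |f y - a| ∂P + |a - b| := by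
  have integrable : Integrable (fun y => |f y - a|) P := (hf.sub (integrable_const a)).abs
  calc ∫ y, |f y - b| ∂P ≤ ∫ y, (|f y - a| + |a - b|) ∂P :=
        integral_mono_of_nonneg (ae_of_all _ fun _ => abs_nonneg _)
          (integrable.add (integrable_const _)) (ae_of_all _ fun _ => abs_sub_le _ _ _)
    _ = ∫ y, |f y - a| ∂P + |a - b| := by
        rw [integral_add integrable (integrable_const _), integral_const, probReal_univ, one_smul]

section SelfEstimate

variable {ι : Type*} (w r : ι → ℝ) (i : ι)

theorem continuous_selfDisp [DecidableEq ι] :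
    Continuous fun p : (ι → ℝ) × ℝ => selfDisp i p.1 p.2 :=
  continuous_pi fun j => continuous_snd.sub <|
    (continuous_apply j).comp (continuous_fst.update i continuous_snd)

variable [Fintype ι]

theorem continuous_kde : Continuous (kde w r) :=
  continuous_finsetSum _ fun j _ =>
    ((continuous_phi (r j)).comp (continuous_apply j)).const_mul (w j)

theorem continuous_kdeDeriv : Continuous (kdeDeriv w r) :=
  continuous_finsetSum _ fun j _ =>
    ((continuous_phiDeriv (r j)).comp (continuous_apply j)).const_mul (w j)

theorem hasDerivAt_kde_selfDisp [DecidableEq ι] (y : ι → ℝ) (x : ℝ) :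
    HasDerivAt (fun x => kde w r (selfDisp i y x)) (kdeDeriv w r (selfDisp i y x)) x := by
  refine HasDerivAt.fun_sum fun j _ => HasDerivAt.const_mul (w j) ?_
  rcases eq_or_ne j i with rfl | hj
  · simp only [selfDisp_self]
    exact (hasDerivAt_const x _).congr_deriv (by simp [phiDeriv])
  · simp only [selfDisp, Function.update_of_ne hj]
    exact (hasDerivAt_phi (r j) (x - y j)).comp_sub_const x (y j)

end SelfEstimate

/-- Smallness of the bandwidths `h`, `b` against a common bound `N` for all other quantities of the
problem with `n` observations: the prior means, the scales and their inverses, and the threshold. In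
the application `N` is a small power of `n`. -/
structure Regime (n : ℕ) (h b C t N : ℝ) : Prop where
  eight_le : 8 ≤ N
  h_pos : 0 < h
  b_pos : 0 < b
  bound_le : C ≤ N
  abs_threshold_le : |t| ≤ N
  bandwidths_le : N ^ 10 * (b + h ^ 2) ≤ 1
  card_mul_exp_le : n * exp (-(N ^ 2) / 8) ≤ h ^ 3

namespace Regime

variable {n : ℕ} {h b C t N : ℝ} (H : Regime n h b C t N)
include H

theorem one_le : 1 ≤ N := by linarith [H.eight_le]

theorem pos : 0 < N := one_pos.trans_le H.one_le

theorem h_le_one : h ≤ 1 := by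
  refine (sq_le_one_iff₀ H.h_pos.le).1 ?_
  calc h ^ 2 ≤ N ^ 10 * (b + h ^ 2) :=
        (le_add_of_nonneg_left H.b_pos.le).trans <| le_mul_of_one_le_left
          (add_pos_of_pos_of_nonneg H.b_pos (sq_nonneg h)).le (one_le_pow₀ H.one_le)
    _ ≤ 1 := H.bandwidths_le

theorem exp_le (hn : n ≠ 0) : exp (-(N ^ 2) / 8) ≤ h ^ 3 :=
  (le_mul_of_one_le_left (exp_pos _).le
    (Nat.one_le_cast.2 (Nat.one_le_iff_ne_zero.2 hn))).trans H.card_mul_exp_le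

theorem card_mul_exp_le_one : n * exp (-(N ^ 2) / 4) ≤ 1 :=
  calc n * exp (-(N ^ 2) / 4) ≤ n * exp (-(N ^ 2) / 8) := by
        gcongr n * exp ?_; linarith [sq_nonneg N]
    _ ≤ h ^ 3 := H.card_mul_exp_le
    _ ≤ 1 := pow_le_one₀ H.h_pos.le H.h_le_one

theorem card_le_exp : n ≤ exp (N ^ 2 / 8) :=
  calc (n : ℝ) = n * exp (-(N ^ 2) / 8) * exp (N ^ 2 / 8) := by
        rw [mul_assoc, ← exp_add]; ring_nf; simp
    _ ≤ 1 * exp (N ^ 2 / 8) := by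
        gcongr; exact H.card_mul_exp_le.trans (pow_le_one₀ H.h_pos.le H.h_le_one)
    _ = exp (N ^ 2 / 8) := one_mul _

theorem inv_h_le_exp (hn : n ≠ 0) : h⁻¹ ≤ exp (N ^ 2 / 8) := by
  have hh := H.h_pos
  rw [inv_le_comm₀ hh (exp_pos _), ← exp_neg, ← neg_div]
  exact (H.exp_le hn).trans (pow_le_of_le_one hh.le H.h_le_one three_ne_zero)

theorem three_mul_le_exp : 3 * N ≤ exp (N ^ 2 / 2) := by
  have := H.eight_le
  calc 3 * N ≤ N ^ 2 / 2 + 1 := by nlinarith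
    _ ≤ exp (N ^ 2 / 2) := add_one_le_exp _

theorem abs_le_of_mem_Icc {x : ℝ} (hx : x ∈ Icc t (N ^ 2)) : |x| ≤ N ^ 2 :=
  abs_le.2 ⟨by nlinarith [hx.1, H.one_le, neg_abs_le t, H.abs_threshold_le], hx.2⟩

theorem threshold_le : t ≤ N ^ 2 := by
  nlinarith [H.one_le, le_abs_self t, H.abs_threshold_le]

theorem window_length_le : N ^ 2 - t ≤ 2 * N ^ 2 := by
  nlinarith [H.one_le, neg_abs_le t, H.abs_threshold_le]

end Regime

section Bias

variable {ι : Type*} [Fintype ι] [DecidableEq ι] {G : Measure ℝ} [IsProbabilityMeasure G]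
  {w s : ι → ℝ} {i : ι} {h b C t N : ℝ} (H : Regime (Fintype.card ι) h b C t N)
  (hw : w ∈ stdSimplex ℝ ι) (hi : ∀ j, w j ≤ w i) (hs : ∀ j, s j ∈ Icc N⁻¹ N)
include H hs

omit [DecidableEq ι] in
theorem scale_pos (j : ι) : 0 < s j := (inv_pos.2 H.pos).trans_le (hs j).1

omit [DecidableEq ι] in
theorem mul_inv_le_bandwidth (j : ι) : h * N⁻¹ ≤ h * s j :=
  mul_le_mul_of_nonneg_left (hs j).1 H.h_pos.le

section Kernel

include hw

omit [DecidableEq ι] in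
theorem kde_bandwidth_pos (z : ι → ℝ) : 0 < kde w (fun j => h * s j) z :=
  kde_pos hw (mul_pos H.h_pos (inv_pos.2 H.pos)) (mul_inv_le_bandwidth H hs) z

include hi

theorem abs_kdeDeriv_selfDisp_le (y : ι → ℝ) (x : ℝ) :
    |kdeDeriv w (fun j => h * s j) (selfDisp i y x)| ≤
      7 * N ^ 3 * h⁻¹ * kde w (fun j => h * s j) (selfDisp i y x) := by
  have hN := H.pos
  have hh := H.h_pos
  have τ_pos : 0 < h * N⁻¹ := by positivity
  have ratio : h * s i / (h * N⁻¹) ≤ N ^ 2 := by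
    rw [div_le_iff₀ τ_pos]
    calc h * s i ≤ h * N := by gcongr; exact (hs i).2
      _ = N ^ 2 * (h * N⁻¹) := by field_simp
  refine (abs_kdeDeriv_le_mul_kde hw τ_pos (mul_inv_le_bandwidth H hs) hN.le
    (selfDisp_self i y x) hi).trans
      (mul_le_mul_of_nonneg_right ?_ (kde_bandwidth_pos H hw hs _).le)
  calc (h * N⁻¹)⁻¹ * (N + 6 * (h * s i / (h * N⁻¹)) * (Fintype.card ι * exp (-(N ^ 2) / 4)))
      ≤ (h * N⁻¹)⁻¹ * (N ^ 2 + 6 * N ^ 2 * 1) := by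
        gcongr
        exacts [le_self_pow₀ H.one_le two_ne_zero, H.card_mul_exp_le_one]
    _ = 7 * N ^ 3 * h⁻¹ := by field_simp; norm_num

theorem abs_log_kde_selfDisp_le (y : ι → ℝ) (x : ℝ) :
    |log (kde w (fun j => h * s j) (selfDisp i y x))| ≤ N ^ 2 := by
  have hN := H.pos
  have hh := H.h_pos
  have τ_pos : 0 < h * N⁻¹ := by positivity
  have bandwidth := mul_inv_le_bandwidth H hs
  have pos := kde_bandwidth_pos H hw hs (selfDisp i y x)
  have lower : 1 ≤ exp (N ^ 2) * kde w (fun j => h * s j) (selfDisp i y x) := by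
    refine (one_le_mul_kde hw τ_pos bandwidth (selfDisp_self i y x) hi).trans
      (mul_le_mul_of_nonneg_right ?_ pos.le)
    calc 3 * (h * s i) * Fintype.card ι ≤ 3 * (1 * N) * exp (N ^ 2 / 8) := by
          gcongr
          exacts [(scale_pos H hs i).le, H.h_le_one, (hs i).2, H.card_le_exp]
      _ ≤ exp (N ^ 2 / 2) * exp (N ^ 2 / 8) := by rw [one_mul]; gcongr; exact H.three_mul_le_exp
      _ ≤ exp (N ^ 2) := by rw [← exp_add]; gcongr; linarith [sq_nonneg N]
  have upper : kde w (fun j => h * s j) (selfDisp i y x) ≤ exp (N ^ 2) := by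
    refine (kde_le_inv hw τ_pos bandwidth _).trans ?_
    rw [mul_inv, inv_inv]
    calc h⁻¹ * N ≤ exp (N ^ 2 / 8) * exp (N ^ 2 / 2) := by
          gcongr
          exacts [H.inv_h_le_exp (@Fintype.card_ne_zero ι _ ⟨i⟩),
            (by linarith : N ≤ 3 * N).trans H.three_mul_le_exp]
      _ ≤ exp (N ^ 2) := by rw [← exp_add]; gcongr; linarith [sq_nonneg N]
  rw [abs_le, le_log_iff_exp_le pos, log_le_iff_le_exp pos, exp_neg]
  exact ⟨(inv_le_iff_one_le_mul₀' (exp_pos _)).2 lower, upper⟩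

end Kernel

section Density

omit H hs in
omit [Fintype ι] [DecidableEq ι] in
theorem abs_log_le_of_mem_Icc {s : ℝ} (hN : 0 < N) (hs : s ∈ Icc N⁻¹ N) : |log s| ≤ N := by
  have pos : 0 < s := (inv_pos.2 hN).trans_le hs.1
  have lower := log_le_sub_one_of_pos (inv_pos.2 pos)
  rw [log_inv] at lower
  exact abs_le.2 ⟨by linarith [inv_le_of_inv_le₀ hN hs.1],
    by linarith [log_le_sub_one_of_pos pos, hs.2]⟩

variable (hG : ∀ᵐ m ∂G, |m| ≤ C) {x : ℝ} (hx : |x| ≤ N ^ 2)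
include hG hx

omit hs [DecidableEq ι] [IsProbabilityMeasure G] hG in
theorem abs_add_bound_le : |x| + C ≤ 2 * N ^ 2 := by
  linarith [H.bound_le, le_self_pow₀ H.one_le two_ne_zero]

omit [DecidableEq ι] in
theorem abs_log_mixPDF_le_of_regime : |log (mixPDF G (s i) x)| ≤ 3 * N ^ 6 := by
  have hN := H.pos
  have hC := nonneg_of_ae_abs_le hG
  have s_pos := scale_pos H hs i
  have ratio : (|x| + C) / s i ≤ 2 * N ^ 3 := by
    rw [div_eq_mul_inv]
    calc (|x| + C) * (s i)⁻¹ ≤ 2 * N ^ 2 * N := by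
          gcongr
          exacts [abs_add_bound_le H hx, inv_le_of_inv_le₀ hN (hs i).1]
      _ = 2 * N ^ 3 := by ring
  calc |log (mixPDF G (s i) x)| ≤ |log (s i)| + log 3 + ((|x| + C) / s i) ^ 2 / 2 :=
        abs_log_mixPDF_le hG s_pos x
    _ ≤ N + 2 + (2 * N ^ 3) ^ 2 / 2 := by
        gcongr
        exacts [abs_log_le_of_mem_Icc hN (hs i),
          (log_le_sub_one_of_pos three_pos).trans_eq (by norm_num)]
    _ ≤ 3 * N ^ 6 := by
        have : N ^ 2 ≤ N ^ 6 := pow_le_pow_right₀ H.one_le (by norm_num)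
        nlinarith [H.eight_le]

omit [DecidableEq ι] in
theorem abs_mixPDFDeriv_le_of_regime :
    |mixPDFDeriv G (s i) x| ≤ 2 * N ^ 4 * mixPDF G (s i) x := by
  have hN := H.pos
  have s_pos := scale_pos H hs i
  refine (abs_mixPDFDeriv_le_mul_mixPDF hG s_pos x).trans
    (mul_le_mul_of_nonneg_right ?_ (mixPDF_nonneg G s_pos x))
  rw [div_eq_mul_inv, ← inv_pow]
  calc (|x| + C) * (s i)⁻¹ ^ 2 ≤ 2 * N ^ 2 * N ^ 2 := by
        gcongr
        exacts [abs_add_bound_le H hx, inv_le_of_inv_le₀ hN (hs i).1]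
    _ = 2 * N ^ 4 := by ring

end Density

/-- The order of the bias when the estimate weighs its own observation by `w` and its fluctuations
are balanced by `θ`; here `q = 1` for the density estimate and `q = 3` for its derivative. -/
noncomputable def biasRate (q : ℕ) (θ h b w : ℝ) : ℝ :=
  θ + (1 + θ⁻¹) * (w * (h ^ q)⁻¹) + (b + h ^ 2)

section MeanDeviation

variable {θ : ℝ} (hθ : 0 < θ) (hd : drift w s (s i) ≤ 2 * N * b) (hG : ∀ᵐ m ∂G, |m| ≤ C) {x : ℝ}
  (hx : |x| ≤ N ^ 2)
include hw

omit [DecidableEq ι] in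
include hd in
theorem drift_effScale_le_of_regime :
    drift w (fun j => effScale h (s j)) (s i) ≤ 2 * N * (b + h ^ 2) := by
  have := drift_effScale_le hw h (fun j => ⟨(scale_pos H hs j).le, (hs j).2⟩) (s i)
  nlinarith [mul_nonneg H.pos.le (sq_nonneg h)]

omit [Fintype ι] [DecidableEq ι] H hw in
theorem le_effScale_of_regime (hN : 0 < N) (j : ι) : N⁻¹ ≤ effScale h (s j) :=
  le_effScale h (inv_pos.2 hN).le (hs j).1

theorem integrable_kde_selfDisp (x : ℝ) : Integrable
    (fun y => kde w (fun j => h * s j) (selfDisp i y x)) (Measure.pi fun j => obsLaw G (s j)) :=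
  Integrable.of_bound
    ((continuous_kde w _).comp
      ((continuous_selfDisp i).comp (Continuous.prodMk_left x))).aestronglyMeasurable
    (h * N⁻¹)⁻¹ <| ae_of_all _ fun y => by
      rw [norm_of_nonneg (kde_bandwidth_pos H hw hs _).le]
      exact kde_le_inv hw (mul_pos H.h_pos (inv_pos.2 H.pos)) (mul_inv_le_bandwidth H hs) _

theorem integrable_kdeDeriv_selfDisp (x : ℝ) : Integrable
    (fun y => kdeDeriv w (fun j => h * s j) (selfDisp i y x))
      (Measure.pi fun j => obsLaw G (s j)) :=
  Integrable.of_bound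
    ((continuous_kdeDeriv w _).comp
      ((continuous_selfDisp i).comp (Continuous.prodMk_left x))).aestronglyMeasurable
    ((h * N⁻¹) ^ 2)⁻¹ <| ae_of_all _ fun _ =>
      abs_kdeDeriv_le hw (mul_pos H.h_pos (inv_pos.2 H.pos)) (mul_inv_le_bandwidth H hs) _

include hi hθ hd

theorem integral_abs_kde_sub_mixPDF_le (x : ℝ) :
    ∫ y, |kde w (fun j => h * s j) (selfDisp i y x) - mixPDF G (s i) x|
        ∂(Measure.pi fun j => obsLaw G (s j)) ≤ 2 * N ^ 3 * biasRate 1 θ h b (w i) := by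
  have hN := H.pos
  have hh := H.h_pos
  have N_inv_pos := inv_pos.2 hN
  have wi_nonneg := hw.1 i
  set S := avgMixPDF G w (fun j => effScale h (s j)) x
  have smoothing : |S - mixPDF G (s i) x| ≤ N ^ 2 * (2 * N * (b + h ^ 2)) := by
    refine (abs_avgMixPDF_sub_le G hw N_inv_pos (le_effScale_of_regime hs hN) (hs i).1 x).trans ?_
    rw [inv_pow, inv_inv]
    gcongr
    exact drift_effScale_le_of_regime H hw hs hd
  calc ∫ y, |kde w (fun j => h * s j) (selfDisp i y x) - mixPDF G (s i) x|
        ∂(Measure.pi fun j => obsLaw G (s j))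
      ≤ ∫ y, |kde w (fun j => h * s j) (selfDisp i y x) - S|
        ∂(Measure.pi fun j => obsLaw G (s j)) + |S - mixPDF G (s i) x| :=
        integral_abs_sub_le_add (integrable_kde_selfDisp H hw hs x) _ _
    _ ≤ (w i * (h * N⁻¹)⁻¹ + (θ + θ⁻¹ * (w i * ((h * N⁻¹)⁻¹ * N⁻¹⁻¹)))) +
        N ^ 2 * (2 * N * (b + h ^ 2)) :=
        add_le_add (integral_abs_kde_sub_le G hw hi hh N_inv_pos (fun j => (hs j).1) hθ x) smoothing
    _ = N * (w i * h⁻¹) + (θ + N ^ 2 * (θ⁻¹ * (w i * h⁻¹))) + N ^ 3 * (2 * (b + h ^ 2)) := by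
        simp only [mul_inv, inv_inv]; ring
    _ ≤ (2 * N ^ 3) * (w i * h⁻¹) + ((2 * N ^ 3) * θ + (2 * N ^ 3) * (θ⁻¹ * (w i * h⁻¹))) +
        N ^ 3 * (2 * (b + h ^ 2)) := by
        have one_le := H.one_le
        have one_le_cube := one_le_pow₀ one_le (n := 3)
        have le_cube := le_self_pow₀ one_le three_ne_zero
        have sq_le_cube : N ^ 2 ≤ N ^ 3 := pow_le_pow_right₀ one_le (by norm_num)
        gcongr
        exacts [by linarith, le_mul_of_one_le_left hθ.le (by linarith), by linarith]
    _ = 2 * N ^ 3 * biasRate 1 θ h b (w i) := by rw [biasRate, pow_one]; ring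

omit [DecidableEq ι] hi hθ in
include hG hx in
theorem mixPDF_mul_abs_score_sub_le :
    mixPDF G (s i) x * |avgMixPDFDeriv G w (fun j => effScale h (s j)) x /
        avgMixPDF G w (fun j => effScale h (s j)) x -
        mixPDFDeriv G (s i) x / mixPDF G (s i) x| ≤ 5 * N ^ 7 * (b + h ^ 2) := by
  have hN := H.pos
  have hh := H.h_pos
  have hb := H.b_pos
  have N_inv_pos := inv_pos.2 hN
  have scales := le_effScale_of_regime (h := h) hs hN
  have drift_le := drift_effScale_le_of_regime H hw hs hd
  have S_pos := avgMixPDF_pos G hw N_inv_pos scales x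
  have smoothed_score : |avgMixPDFDeriv G w (fun j => effScale h (s j)) x /
      avgMixPDF G w (fun j => effScale h (s j)) x| ≤ 2 * N ^ 4 := by
    rw [abs_div, abs_of_pos S_pos, div_le_iff₀ S_pos]
    refine (abs_avgMixPDFDeriv_le_mul_avgMixPDF hw N_inv_pos scales hG x).trans ?_
    rw [inv_pow, div_inv_eq_mul]
    calc (|x| + C) * N ^ 2 * _ ≤ 2 * N ^ 2 * N ^ 2 * _ := by
          gcongr; exact abs_add_bound_le H hx
      _ = _ := by ring
  calc _ ≤ |avgMixPDFDeriv G w (fun j => effScale h (s j)) x /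
          avgMixPDF G w (fun j => effScale h (s j)) x| *
        |avgMixPDF G w (fun j => effScale h (s j)) x - mixPDF G (s i) x| +
        |avgMixPDFDeriv G w (fun j => effScale h (s j)) x - mixPDFDeriv G (s i) x| :=
        mul_abs_div_sub_div_le _ _ _ S_pos (mixPDF_pos G (scale_pos H hs i) x)
    _ ≤ 2 * N ^ 4 * (N ^ 2 * (2 * N * (b + h ^ 2))) +
        6 * N ^ 3 * (2 * N * (b + h ^ 2)) := by
        gcongr
        · refine (abs_avgMixPDF_sub_le G hw N_inv_pos scales (hs i).1 x).trans ?_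
          rw [inv_pow, inv_inv]
          gcongr
        · refine (abs_avgMixPDFDeriv_sub_le G hw N_inv_pos scales (hs i).1 x).trans ?_
          rw [inv_pow, inv_inv]
          gcongr
    _ = (4 * N ^ 7 + 12 * N ^ 4) * (b + h ^ 2) := by ring
    _ ≤ 5 * N ^ 7 * (b + h ^ 2) := by
        have : 8 ^ 3 ≤ N ^ 3 := pow_le_pow_left₀ (by norm_num) H.eight_le 3
        gcongr
        nlinarith [pow_pos hN 4]

omit [DecidableEq ι] hi hθ in
include hG hx in
theorem mixPDF_le_two_mul_avgMixPDF_of_regime :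
    mixPDF G (s i) x ≤ 2 * avgMixPDF G w (fun j => effScale h (s j)) x := by
  have hN := H.pos
  refine mixPDF_le_two_mul_avgMixPDF hw (inv_pos.2 hN) (le_effScale_of_regime hs hN) hG (hs i).1
    (abs_add_bound_le H hx) ?_
  have bandwidths_nonneg : 0 ≤ b + h ^ 2 := by nlinarith [H.b_pos]
  calc N⁻¹⁻¹ * ((2 * N ^ 2 / N⁻¹) ^ 2 + 1) * drift w (fun j => effScale h (s j)) (s i)
      = N * (4 * N ^ 6 + 1) * drift w (fun j => effScale h (s j)) (s i) := by
        rw [inv_inv, div_inv_eq_mul]; ring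
    _ ≤ N * (4 * N ^ 6 + 1) * (2 * N * (b + h ^ 2)) := by
        gcongr; exact drift_effScale_le_of_regime H hw hs hd
    _ = (8 * N ^ 8 + 2 * N ^ 2) * (b + h ^ 2) := by ring
    _ ≤ N ^ 10 / 2 * (b + h ^ 2) := by
        have : 8 ^ 2 ≤ N ^ 2 := pow_le_pow_left₀ (by norm_num) H.eight_le 2
        have : N ^ 2 ≤ N ^ 8 := pow_le_pow_right₀ H.one_le (by norm_num)
        gcongr
        nlinarith [pow_pos hN 8]
    _ ≤ 1 / 2 := by linarith [H.bandwidths_le]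

omit hd in
theorem integral_fluctuation_le (x : ℝ) :
    ∫ y, (7 * N ^ 3 * h⁻¹ * |kde w (fun j => h * s j) (selfDisp i y x) -
          avgMixPDF G w (fun j => effScale h (s j)) x| +
        |kdeDeriv w (fun j => h * s j) (selfDisp i y x) -
          avgMixPDFDeriv G w (fun j => effScale h (s j)) x|)
        ∂(Measure.pi fun j => obsLaw G (s j)) ≤
      8 * N ^ 5 * (θ + (1 + θ⁻¹) * (w i * (h ^ 3)⁻¹)) := by
  have hN := H.pos
  have hh := H.h_pos
  have one_le := H.one_le
  have wi_nonneg := hw.1 i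
  have N_inv_pos := inv_pos.2 hN
  rw [integral_add, integral_const_mul]
  · calc _ ≤ 7 * N ^ 3 * h⁻¹ * (w i * (h * N⁻¹)⁻¹ +
            (h * θ + (h * θ)⁻¹ * (w i * ((h * N⁻¹)⁻¹ * N⁻¹⁻¹)))) +
          (w i * (N⁻¹ ^ 2)⁻¹ + (θ + θ⁻¹ * (w i * (((h * N⁻¹) ^ 3)⁻¹ * N⁻¹⁻¹)))) := by
          gcongr
          exacts [integral_abs_kde_sub_le G hw hi hh N_inv_pos (fun j => (hs j).1)
              (mul_pos hh hθ) x,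
            integral_abs_kdeDeriv_sub_le G hw hi hh N_inv_pos (fun j => (hs j).1) hθ x]
      _ = (7 * N ^ 3 + 1) * θ + (7 * N ^ 4 * h + N ^ 2 * h ^ 3) * (w i * (h ^ 3)⁻¹) +
          (7 * N ^ 5 + N ^ 4) * (θ⁻¹ * (w i * (h ^ 3)⁻¹)) := by field_simp; ring
      _ ≤ (7 * N ^ 5 + N ^ 5) * θ + (7 * N ^ 5 * 1 + N ^ 5 * 1) * (w i * (h ^ 3)⁻¹) +
          (7 * N ^ 5 + N ^ 5) * (θ⁻¹ * (w i * (h ^ 3)⁻¹)) := by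
          gcongr
          exacts [by norm_num, one_le_pow₀ one_le, by norm_num, H.h_le_one, by norm_num,
            pow_le_one₀ hh.le H.h_le_one, by norm_num]
      _ = 8 * N ^ 5 * (θ + (1 + θ⁻¹) * (w i * (h ^ 3)⁻¹)) := by ring
  · exact ((integrable_kde_selfDisp H hw hs x).sub (integrable_const _)).abs.const_mul _
  · exact ((integrable_kdeDeriv_selfDisp H hw hs x).sub (integrable_const _)).abs

omit hθ in
include hG hx in
theorem mixPDF_mul_abs_kde_score_sub_le (y : ι → ℝ) :
    mixPDF G (s i) x * |kdeDeriv w (fun j => h * s j) (selfDisp i y x) /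
        kde w (fun j => h * s j) (selfDisp i y x) - mixPDFDeriv G (s i) x / mixPDF G (s i) x| ≤
      2 * (7 * N ^ 3 * h⁻¹ * |kde w (fun j => h * s j) (selfDisp i y x) -
          avgMixPDF G w (fun j => effScale h (s j)) x| +
        |kdeDeriv w (fun j => h * s j) (selfDisp i y x) -
          avgMixPDFDeriv G w (fun j => effScale h (s j)) x|) + 5 * N ^ 7 * (b + h ^ 2) := by
  have hN := H.pos
  have f_nonneg := mixPDF_nonneg G (scale_pos H hs i) x
  set S := avgMixPDF G w (fun j => effScale h (s j)) x
  set S' := avgMixPDFDeriv G w (fun j => effScale h (s j)) x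
  set A := kde w (fun j => h * s j) (selfDisp i y x)
  set A' := kdeDeriv w (fun j => h * s j) (selfDisp i y x)
  have S_pos : 0 < S := avgMixPDF_pos G hw (inv_pos.2 hN) (le_effScale_of_regime hs hN) x
  have A_pos : 0 < A := kde_bandwidth_pos H hw hs _
  have score_le : |A' / A| ≤ 7 * N ^ 3 * h⁻¹ := by
    rw [abs_div, abs_of_pos A_pos, div_le_iff₀ A_pos]
    exact abs_kdeDeriv_selfDisp_le H hw hi hs y x
  calc mixPDF G (s i) x * |A' / A - mixPDFDeriv G (s i) x / mixPDF G (s i) x|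
      ≤ mixPDF G (s i) x * |A' / A - S' / S| +
        mixPDF G (s i) x * |S' / S - mixPDFDeriv G (s i) x / mixPDF G (s i) x| := by
        rw [← mul_add]; gcongr; exact abs_sub_le _ _ _
    _ ≤ 2 * (S * |A' / A - S' / S|) + 5 * N ^ 7 * (b + h ^ 2) := by
        rw [← mul_assoc 2 S]
        exact add_le_add (mul_le_mul_of_nonneg_right
          (mixPDF_le_two_mul_avgMixPDF_of_regime H hw hs hd hG hx) (abs_nonneg _))
          (mixPDF_mul_abs_score_sub_le H hw hs hd hG hx)
    _ ≤ 2 * (7 * N ^ 3 * h⁻¹ * |A - S| + |A' - S'|) + 5 * N ^ 7 * (b + h ^ 2) := by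
        gcongr
        exact (mul_abs_div_sub_div_le _ _ _ A_pos S_pos).trans (by gcongr)

include hG hx in
theorem integral_mixPDF_mul_abs_score_sub_le :
    ∫ y, mixPDF G (s i) x * |kdeDeriv w (fun j => h * s j) (selfDisp i y x) /
        kde w (fun j => h * s j) (selfDisp i y x) - mixPDFDeriv G (s i) x / mixPDF G (s i) x|
        ∂(Measure.pi fun j => obsLaw G (s j)) ≤ 16 * N ^ 7 * biasRate 3 θ h b (w i) := by
  have hN := H.pos
  have hh := H.h_pos
  have hb := H.b_pos
  have wi_nonneg := hw.1 i
  have f_nonneg := mixPDF_nonneg G (scale_pos H hs i) x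
  set S := avgMixPDF G w (fun j => effScale h (s j)) x
  set S' := avgMixPDFDeriv G w (fun j => effScale h (s j)) x
  have fluctuation_integrable : Integrable (fun y => 7 * N ^ 3 * h⁻¹ *
      |kde w (fun j => h * s j) (selfDisp i y x) - S| +
        |kdeDeriv w (fun j => h * s j) (selfDisp i y x) - S'|)
      (Measure.pi fun j => obsLaw G (s j)) :=
    (((integrable_kde_selfDisp H hw hs x).sub (integrable_const _)).abs.const_mul _).add
      ((integrable_kdeDeriv_selfDisp H hw hs x).sub (integrable_const _)).abs
  refine (integral_mono_of_nonneg (ae_of_all _ fun _ => by positivity)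
    ((fluctuation_integrable.const_mul 2).add (integrable_const (5 * N ^ 7 * (b + h ^ 2))))
    (ae_of_all _ fun y => mixPDF_mul_abs_kde_score_sub_le H hw hi hs hd hG hx y)).trans ?_
  rw [integral_add' (fluctuation_integrable.const_mul 2) (integrable_const _),
    integral_const_mul, integral_const, probReal_univ, one_smul]
  calc _ ≤ 2 * (8 * N ^ 5 * (θ + (1 + θ⁻¹) * (w i * (h ^ 3)⁻¹))) + 5 * N ^ 7 * (b + h ^ 2) := by
        gcongr; exact integral_fluctuation_le H hw hi hs hθ x
    _ ≤ 2 * (8 * N ^ 7 * (θ + (1 + θ⁻¹) * (w i * (h ^ 3)⁻¹))) + 16 * N ^ 7 * (b + h ^ 2) := by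
        gcongr <;> first | exact H.one_le | norm_num
    _ = 16 * N ^ 7 * biasRate 3 θ h b (w i) := by rw [biasRate]; ring

end MeanDeviation

end Bias

/-! ### The bias at one observation -/

/-- The density at `x` of the bias of `ψ (x + s i ^ 2 * score)` when the `i`-th observation is `x`
and the others are `y`: by Tweedie's formula `x + s i ^ 2 * f' / f` is the posterior mean. -/
noncomputable def biasDensity {ι : Type*} [Fintype ι] [DecidableEq ι] (G : Measure ℝ) (ψ : ℝ → ℝ)
    (h : ℝ) (w s : ι → ℝ) (i : ι) (y : ι → ℝ) (x : ℝ) : ℝ :=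
  ψ (x + s i ^ 2 * (kdeDeriv w (fun j => h * s j) (selfDisp i y x) /
      kde w (fun j => h * s j) (selfDisp i y x))) * mixPDF G (s i) x -
    (x * mixPDF G (s i) x + s i ^ 2 * mixPDFDeriv G (s i) x)

theorem measurable_uncurry_biasDensity {ι : Type*} [Fintype ι] [DecidableEq ι] (G : Measure ℝ)
    [IsProbabilityMeasure G] {ψ : ℝ → ℝ} (hψ : Measurable ψ) (h : ℝ) (w : ι → ℝ) {s : ι → ℝ} {i : ι}
    (hs : 0 < s i) : Measurable (Function.uncurry (biasDensity G ψ h w s i)) := by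
  have kde_measurable := ((continuous_kde w fun j => h * s j).comp
    (continuous_selfDisp i)).measurable
  have kdeDeriv_measurable := ((continuous_kdeDeriv w fun j => h * s j).comp
    (continuous_selfDisp i)).measurable
  have mixPDF_measurable : Measurable fun p : (ι → ℝ) × ℝ => mixPDF G (s i) p.2 :=
    (continuous_mixPDF G hs).measurable.comp measurable_snd
  have mixPDFDeriv_measurable : Measurable fun p : (ι → ℝ) × ℝ => mixPDFDeriv G (s i) p.2 :=
    (continuous_mixPDFDeriv G hs).measurable.comp measurable_snd
  have estimate_measurable :=
    hψ.comp (measurable_snd.add ((kdeDeriv_measurable.div kde_measurable).const_mul (s i ^ 2)))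
  exact (estimate_measurable.mul mixPDF_measurable).sub
    ((measurable_snd.mul mixPDF_measurable).add (mixPDFDeriv_measurable.const_mul (s i ^ 2)))

section Bias

variable {ι : Type*} [Fintype ι] [DecidableEq ι] {G : Measure ℝ} [IsProbabilityMeasure G]
  {w s : ι → ℝ} {i : ι} {h b C t N : ℝ} (H : Regime (Fintype.card ι) h b C t N)
  (hw : w ∈ stdSimplex ℝ ι) (hi : ∀ j, w j ≤ w i) (hs : ∀ j, s j ∈ Icc N⁻¹ N)
  (hG : ∀ᵐ m ∂G, |m| ≤ C) {ψ : ℝ → ℝ} (hψ : ∀ z, |ψ z| ≤ |z|) (hψm : Measurable ψ)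
include H hs hw hi hG hψ

theorem abs_biasDensity_le (y : ι → ℝ) (x : ℝ) :
    |biasDensity G ψ h w s i y x| ≤ (8 * N ^ 5 * h⁻¹ + |x|) * mixPDF G (s i) x := by
  have hN := H.pos
  have hh := H.h_pos
  have s_pos := scale_pos H hs i
  have f_nonneg := mixPDF_nonneg G s_pos x
  have A_pos : 0 < kde w (fun j => h * s j) (selfDisp i y x) := kde_bandwidth_pos H hw hs _
  have estimate_le : |ψ (x + s i ^ 2 * (kdeDeriv w (fun j => h * s j) (selfDisp i y x) /
      kde w (fun j => h * s j) (selfDisp i y x)))| ≤ |x| + N ^ 2 * (7 * N ^ 3 * h⁻¹) := by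
    refine (hψ _).trans ((abs_add_le _ _).trans ?_)
    rw [abs_mul, abs_pow, abs_of_pos s_pos, abs_div, abs_of_pos A_pos]
    gcongr
    exacts [(hs i).2, (div_le_iff₀ A_pos).2 (abs_kdeDeriv_selfDisp_le H hw hi hs y x)]
  have bound_le : C ≤ N ^ 5 * h⁻¹ :=
    calc C ≤ N ^ 5 := H.bound_le.trans (le_self_pow₀ H.one_le (by norm_num))
      _ ≤ N ^ 5 * h⁻¹ := le_mul_of_one_le_right (by positivity) ((one_le_inv₀ hh).2 H.h_le_one)
  calc |biasDensity G ψ h w s i y x|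
      ≤ (|x| + N ^ 2 * (7 * N ^ 3 * h⁻¹)) * mixPDF G (s i) x + C * mixPDF G (s i) x := by
        refine (abs_sub _ _).trans (add_le_add ?_ (abs_mul_mixPDF_add_le hG s_pos x))
        rw [abs_mul, abs_of_nonneg f_nonneg]
        exact mul_le_mul_of_nonneg_right estimate_le f_nonneg
    _ ≤ (|x| + N ^ 2 * (7 * N ^ 3 * h⁻¹)) * mixPDF G (s i) x +
        N ^ 5 * h⁻¹ * mixPDF G (s i) x := by gcongr
    _ = (8 * N ^ 5 * h⁻¹ + |x|) * mixPDF G (s i) x := by ring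

include hψm in
theorem integrable_biasDensity (y : ι → ℝ) : Integrable (biasDensity G ψ h w s i y) :=
  (integrable_mixPDF_linear hG (scale_pos H hs i) (8 * N ^ 5 * h⁻¹)).mono'
    ((measurable_uncurry_biasDensity G hψm h w (scale_pos H hs i)).comp
      measurable_prodMk_left).aestronglyMeasurable
    (ae_of_all _ fun x => abs_biasDensity_le H hw hi hs hG hψ y x)

theorem abs_integral_Ioi_biasDensity_le (y : ι → ℝ) :
    |∫ x in Ioi (N ^ 2), biasDensity G ψ h w s i y x| ≤ 36 * N ^ 6 * h ^ 2 := by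
  have hN := H.pos
  have hh := H.h_pos
  have one_le := H.one_le
  have s_pos := scale_pos H hs i
  have exponent : N ^ 2 / 8 ≤ (N ^ 2) ^ 2 / (8 * s i ^ 2) := by
    rw [div_le_div_iff₀ (by norm_num) (by positivity)]
    have : s i ^ 2 ≤ N ^ 2 := pow_le_pow_left₀ s_pos.le (hs i).2 2
    nlinarith [sq_nonneg N]
  have one_le_coefficient : 1 ≤ N ^ 5 * h⁻¹ :=
    one_le_mul_of_one_le_of_one_le (one_le_pow₀ one_le) ((one_le_inv₀ hh).2 H.h_le_one)
  calc |∫ x in Ioi (N ^ 2), biasDensity G ψ h w s i y x|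
      ≤ ∫ x in Ioi (N ^ 2), (8 * N ^ 5 * h⁻¹ + |x|) * mixPDF G (s i) x := by
        rw [← norm_eq_abs]
        exact norm_integral_le_of_norm_le (integrable_mixPDF_linear hG s_pos _).integrableOn
          (ae_of_all _ fun x => abs_biasDensity_le H hw hi hs hG hψ y x)
    _ ≤ 4 * s i * (8 * N ^ 5 * h⁻¹ + 1) * exp (-((N ^ 2) ^ 2) / (8 * s i ^ 2)) :=
        setIntegral_mixPDF_linear_le hG s_pos (by positivity) (one_le_pow₀ one_le)
          (by nlinarith [H.eight_le, H.bound_le])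
    _ ≤ 4 * N * (8 * N ^ 5 * h⁻¹ + N ^ 5 * h⁻¹) * h ^ 3 := by
        gcongr
        · exact (hs i).2
        · refine (exp_le_exp.2 ?_).trans (H.exp_le (@Fintype.card_ne_zero ι _ ⟨i⟩))
          rw [neg_div, neg_div]
          exact neg_le_neg exponent
    _ = 36 * N ^ 6 * h ^ 2 := by field_simp; norm_num

omit [DecidableEq ι] [IsProbabilityMeasure G] hs hi hG hψ in
theorem sq_le_biasRate {θ : ℝ} (hθ : 0 < θ) (q : ℕ) : h ^ 2 ≤ biasRate q θ h b (w i) := by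
  have hh := H.h_pos
  have hb := H.b_pos
  have wi_nonneg := hw.1 i
  have : 0 ≤ (1 + θ⁻¹) * (w i * (h ^ q)⁻¹) := by positivity
  rw [biasRate]
  linarith

include hψm in
theorem abs_integral_biasDensity_le_of_window {g : (ι → ℝ) → ℝ} {θ : ℝ} (hθ : 0 < θ) {q : ℕ}
    (hg : Integrable g (Measure.pi fun j => obsLaw G (s j)))
    (hbias : ∀ y, |∫ x in Ioc t (N ^ 2), biasDensity G ψ h w s i y x| ≤ g y)
    (hrate : ∫ y, g y ∂(Measure.pi fun j => obsLaw G (s j)) ≤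
      400 * N ^ 17 * biasRate q θ h b (w i)) :
    |∫ y, (∫ x in Ioi t, biasDensity G ψ h w s i y x) ∂(Measure.pi fun j => obsLaw G (s j))| ≤
      N ^ 20 * biasRate q θ h b (w i) := by
  have pointwise : ∀ y, |∫ x in Ioi t, biasDensity G ψ h w s i y x| ≤ g y + 36 * N ^ 6 * h ^ 2 := by
    intro y
    have integrable := integrable_biasDensity H hw hi hs hG hψ hψm y
    rw [← Ioc_union_Ioi_eq_Ioi H.threshold_le, setIntegral_union
      (Ioc_disjoint_Ioi le_rfl) measurableSet_Ioi integrable.integrableOn integrable.integrableOn]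
    exact (abs_add_le _ _).trans <|
      add_le_add (hbias y) (abs_integral_Ioi_biasDensity_le H hw hi hs hG hψ y)
  have sq_le := sq_le_biasRate H hw (i := i) hθ q
  have rate_nonneg := (sq_nonneg h).trans sq_le
  have hN := H.pos
  calc _ ≤ ∫ y, (g y + 36 * N ^ 6 * h ^ 2) ∂(Measure.pi fun j => obsLaw G (s j)) := by
        rw [← norm_eq_abs]
        exact norm_integral_le_of_norm_le (hg.add (integrable_const _)) (ae_of_all _ pointwise)
    _ = ∫ y, g y ∂(Measure.pi fun j => obsLaw G (s j)) + 36 * N ^ 6 * h ^ 2 := by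
        rw [integral_add hg (integrable_const _), integral_const, probReal_univ, one_smul]
    _ ≤ 400 * N ^ 17 * biasRate q θ h b (w i) + 36 * N ^ 17 * biasRate q θ h b (w i) := by
        gcongr <;> first | exact H.one_le | norm_num
    _ = 436 * (N ^ 17 * biasRate q θ h b (w i)) := by ring
    _ ≤ N ^ 3 * (N ^ 17 * biasRate q θ h b (w i)) := by
        gcongr
        exact le_trans (by norm_num) (pow_le_pow_left₀ (by norm_num) H.eight_le 3)
    _ = N ^ 20 * biasRate q θ h b (w i) := by ring

end Bias

section Window

variable {ι : Type*} [Fintype ι] [DecidableEq ι] {G : Measure ℝ} [IsProbabilityMeasure G]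
  {w s : ι → ℝ} {i : ι} {h b C t N θ : ℝ} (H : Regime (Fintype.card ι) h b C t N)
  (hw : w ∈ stdSimplex ℝ ι) (hi : ∀ j, w j ≤ w i) (hs : ∀ j, s j ∈ Icc N⁻¹ N) (hθ : 0 < θ)
  (hd : drift w s (s i) ≤ 2 * N * b) (hG : ∀ᵐ m ∂G, |m| ≤ C)
include H hw hs

theorem integrable_uncurry_abs_kde_sub :
    Integrable (Function.uncurry fun y x =>
        |kde w (fun j => h * s j) (selfDisp i y x) - mixPDF G (s i) x|)
      ((Measure.pi fun j => obsLaw G (s j)).prod (volume.restrict (Ioc t (N ^ 2)))) := by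
  have s_pos := scale_pos H hs i
  have measurable : Measurable (Function.uncurry fun y x =>
      |kde w (fun j => h * s j) (selfDisp i y x) - mixPDF G (s i) x|) :=
    (((continuous_kde w _).comp (continuous_selfDisp i)).sub
      ((continuous_mixPDF G s_pos).comp continuous_snd)).abs.measurable
  refine integrable_uncurry_restrict_Ioc measurable (K := (h * N⁻¹)⁻¹ + (s i)⁻¹) fun y x _ => ?_
  rw [abs_abs]
  refine (abs_sub _ _).trans (add_le_add ?_ ?_)
  · rw [abs_of_pos (kde_bandwidth_pos H hw hs _)]
    exact kde_le_inv hw (mul_pos H.h_pos (inv_pos.2 H.pos)) (mul_inv_le_bandwidth H hs) _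
  · rw [abs_of_nonneg (mixPDF_nonneg G s_pos x)]
    exact mixPDF_le_inv G s_pos x

include hi hG in
theorem abs_setIntegral_biasDensity_id_le (y : ι → ℝ) :
    |∫ x in Ioc t (N ^ 2), biasDensity G id h w s i y x| ≤ 10 * N ^ 8 *
      (|kde w (fun j => h * s j) (selfDisp i y t) - mixPDF G (s i) t| +
        |kde w (fun j => h * s j) (selfDisp i y (N ^ 2)) - mixPDF G (s i) (N ^ 2)| +
        2 * N ^ 4 * ∫ x in Ioc t (N ^ 2),
          |kde w (fun j => h * s j) (selfDisp i y x) - mixPDF G (s i) x|) := by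
  have hN := H.pos
  have one_le := H.one_le
  have s_pos := scale_pos H hs i
  have biasDensity_id : ∀ x, biasDensity G id h w s i y x =
      s i ^ 2 * (kdeDeriv w (fun j => h * s j) (selfDisp i y x) /
        kde w (fun j => h * s j) (selfDisp i y x) * mixPDF G (s i) x - mixPDFDeriv G (s i) x) :=
    fun x => by simp only [biasDensity, id]; ring
  have log_bound : ∀ x ∈ Icc t (N ^ 2), |log (kde w (fun j => h * s j) (selfDisp i y x)) -
      log (mixPDF G (s i) x)| ≤ 4 * N ^ 6 := fun x hx => by
    have sq_le : N ^ 2 ≤ N ^ 6 := pow_le_pow_right₀ one_le (by norm_num)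
    linarith [abs_sub (log (kde w (fun j => h * s j) (selfDisp i y x))) (log (mixPDF G (s i) x)),
      abs_log_kde_selfDisp_le H hw hi hs y x,
      abs_log_mixPDF_le_of_regime H hs hG (i := i) (H.abs_le_of_mem_Icc hx)]
  have score_bound := abs_integral_score_sub_le H.threshold_le
    (fun x => kde_bandwidth_pos H hw hs (selfDisp i y x)) (mixPDF_pos G s_pos)
    (hasDerivAt_kde_selfDisp w _ i y) (hasDerivAt_mixPDF G s_pos)
    ((continuous_kdeDeriv w _).comp ((continuous_selfDisp i).comp (Continuous.prodMk_right y)))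
    (continuous_mixPDFDeriv G s_pos) (by positivity : 0 ≤ 2 * N ^ 4) log_bound
    fun x hx => abs_mixPDFDeriv_le_of_regime H hs hG (H.abs_le_of_mem_Icc hx)
  simp only [biasDensity_id]
  rw [integral_const_mul, abs_mul, abs_of_nonneg (sq_nonneg _)]
  refine (mul_le_mul (pow_le_pow_left₀ s_pos.le (hs i).2 2) score_bound (abs_nonneg _)
    (sq_nonneg N)).trans ?_
  rw [← mul_assoc]
  refine mul_le_mul_of_nonneg_right ?_ (by positivity)
  have : 1 ≤ N ^ 6 := one_le_pow₀ one_le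
  calc N ^ 2 * (2 * (1 + 4 * N ^ 6)) ≤ N ^ 2 * (2 * (N ^ 6 + 4 * N ^ 6)) := by gcongr
    _ = 10 * N ^ 8 := by ring

include hi hG hθ hd

theorem abs_integral_biasDensity_id_le :
    |∫ y, (∫ x in Ioi t, biasDensity G id h w s i y x) ∂(Measure.pi fun j => obsLaw G (s j))| ≤
      N ^ 20 * biasRate 1 θ h b (w i) := by
  set ν := Measure.pi fun j => obsLaw G (s j)
  set ρ := biasRate 1 θ h b (w i)
  set D : (ι → ℝ) → ℝ → ℝ :=
    fun y x => |kde w (fun j => h * s j) (selfDisp i y x) - mixPDF G (s i) x|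
  have hN := H.pos
  have ρ_nonneg : 0 ≤ ρ := (sq_nonneg h).trans (sq_le_biasRate H hw hθ 1)
  have deviation : ∀ x, ∫ y, D y x ∂ν ≤ 2 * N ^ 3 * ρ :=
    integral_abs_kde_sub_mixPDF_le H hw hi hs hθ hd
  have D_integrable : ∀ x, Integrable (fun y => D y x) ν := fun x =>
    ((integrable_kde_selfDisp H hw hs x).sub (integrable_const _)).abs
  have D_uncurry_integrable : Integrable (Function.uncurry D)
      (ν.prod (volume.restrict (Ioc t (N ^ 2)))) := integrable_uncurry_abs_kde_sub H hw hs
  have window_integrable : Integrable (fun y => ∫ x in Ioc t (N ^ 2), D y x) ν :=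
    D_uncurry_integrable.integral_prod_left
  have boundary_integrable := (D_integrable t).add (D_integrable (N ^ 2))
  refine abs_integral_biasDensity_le_of_window H hw hi hs hG (fun _ => le_rfl) measurable_id hθ
    ((boundary_integrable.add (window_integrable.const_mul (2 * N ^ 4))).const_mul (10 * N ^ 8))
    (abs_setIntegral_biasDensity_id_le H hw hi hs hG) ?_
  rw [integral_const_mul, integral_add' boundary_integrable (window_integrable.const_mul _),
    integral_add' (D_integrable t) (D_integrable _), integral_const_mul]
  calc _ ≤ 10 * N ^ 8 * (2 * N ^ 3 * ρ + 2 * N ^ 3 * ρ +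
        2 * N ^ 4 * ((N ^ 2 - t) * (2 * N ^ 3 * ρ))) := by
        gcongr
        exacts [deviation _, deviation _, integral_setIntegral_le H.threshold_le
          D_uncurry_integrable fun x _ => deviation x]
    _ ≤ 10 * N ^ 8 * (2 * N ^ 3 * ρ + 2 * N ^ 3 * ρ +
        2 * N ^ 4 * (2 * N ^ 2 * (2 * N ^ 3 * ρ))) := by
        gcongr; exact H.window_length_le
    _ = 40 * N ^ 11 * ρ + 80 * N ^ 17 * ρ := by ring
    _ ≤ 40 * N ^ 17 * ρ + 80 * N ^ 17 * ρ := by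
        gcongr <;> first | exact H.one_le | norm_num
    _ ≤ 400 * N ^ 17 * ρ := by nlinarith [mul_nonneg (pow_nonneg hN.le 17) ρ_nonneg]

end Window

/-- The absolute error at `x` of the estimated score when the observations other than the `i`-th are
`y`, weighted by the density of the `i`-th observation. -/
noncomputable def scoreError {ι : Type*} [Fintype ι] [DecidableEq ι] (G : Measure ℝ)
    (h : ℝ) (w s : ι → ℝ) (i : ι) (y : ι → ℝ) (x : ℝ) : ℝ :=
  mixPDF G (s i) x *
    |kdeDeriv w (fun j => h * s j) (selfDisp i y x) / kde w (fun j => h * s j) (selfDisp i y x) -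
      mixPDFDeriv G (s i) x / mixPDF G (s i) x|

section Lipschitz

variable {ι : Type*} [Fintype ι] [DecidableEq ι] {G : Measure ℝ} [IsProbabilityMeasure G]
  {w s : ι → ℝ} {i : ι} {h b C t N θ : ℝ} (H : Regime (Fintype.card ι) h b C t N)
  (hw : w ∈ stdSimplex ℝ ι) (hi : ∀ j, w j ≤ w i) (hs : ∀ j, s j ∈ Icc N⁻¹ N) (hθ : 0 < θ)
  (hd : drift w s (s i) ≤ 2 * N * b) (hG : ∀ᵐ m ∂G, |m| ≤ C)
  {ψ : ℝ → ℝ} (hψ : LipschitzWith 1 ψ) (hψC : ∀ z, |z| ≤ C → ψ z = z)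

include hG hψ hψC in
theorem abs_biasDensity_le_of_lipschitz (hs : 0 < s i) (y : ι → ℝ) (x : ℝ) :
    |biasDensity G ψ h w s i y x| ≤ s i ^ 2 * scoreError G h w s i y x := by
  have f_pos := mixPDF_pos G hs x
  set f := mixPDF G (s i) x
  set f' := mixPDFDeriv G (s i) x
  set score := kdeDeriv w (fun j => h * s j) (selfDisp i y x) /
    kde w (fun j => h * s j) (selfDisp i y x)
  set m := x + s i ^ 2 * (f' / f)
  have m_mul : m * f = x * f + s i ^ 2 * f' := by simp only [m]; field_simp
  have abs_m_le : |m| ≤ C := by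
    refine le_of_mul_le_mul_right ?_ f_pos
    calc |m| * f = |x * f + s i ^ 2 * f'| := by rw [← m_mul, abs_mul, abs_of_pos f_pos]
      _ ≤ C * f := abs_mul_mixPDF_add_le hG hs x
  have error : |ψ (x + s i ^ 2 * score) - ψ m| ≤ |x + s i ^ 2 * score - m| := by
    simpa [Real.dist_eq] using hψ.dist_le_mul (x + s i ^ 2 * score) m
  calc |biasDensity G ψ h w s i y x| = |ψ (x + s i ^ 2 * score) - ψ m| * f := by
        rw [← abs_of_pos f_pos, ← abs_mul, sub_mul, hψC m abs_m_le, m_mul]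
        rfl
    _ ≤ |x + s i ^ 2 * score - m| * f := by gcongr
    _ = |s i ^ 2 * (score - f' / f)| * f := by simp only [m]; ring_nf
    _ = s i ^ 2 * (f * |score - f' / f|) := by
        rw [abs_mul, abs_of_nonneg (sq_nonneg (s i))]; ring

include H hw hs in
theorem continuous_scoreError : Continuous (Function.uncurry (scoreError G h w s i)) := by
  have s_pos := scale_pos H hs i
  have f_continuous := continuous_mixPDF G s_pos
  have estimate_continuous : Continuous fun p : (ι → ℝ) × ℝ =>
      kdeDeriv w (fun j => h * s j) (selfDisp i p.1 p.2) /
        kde w (fun j => h * s j) (selfDisp i p.1 p.2) :=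
    ((continuous_kdeDeriv w _).comp (continuous_selfDisp i)).div
      ((continuous_kde w _).comp (continuous_selfDisp i))
      fun p => (kde_bandwidth_pos H hw hs (selfDisp i p.1 p.2)).ne'
  have score_continuous : Continuous fun x => mixPDFDeriv G (s i) x / mixPDF G (s i) x :=
    (continuous_mixPDFDeriv G s_pos).div f_continuous fun x => (mixPDF_pos G s_pos x).ne'
  exact (f_continuous.comp continuous_snd).mul
    (estimate_continuous.sub (score_continuous.comp continuous_snd)).abs

include H hw hi hs hG in
theorem abs_scoreError_le {x : ℝ} (hx : |x| ≤ N ^ 2) (y : ι → ℝ) :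
    |scoreError G h w s i y x| ≤ (s i)⁻¹ * (7 * N ^ 3 * h⁻¹ + 2 * N ^ 4) := by
  have s_pos := scale_pos H hs i
  have f_pos := mixPDF_pos G s_pos x
  have A_pos := kde_bandwidth_pos H hw hs (selfDisp i y x)
  rw [scoreError, abs_mul, abs_abs, abs_of_pos f_pos]
  refine mul_le_mul (mixPDF_le_inv G s_pos x) ((abs_sub _ _).trans (add_le_add ?_ ?_))
    (abs_nonneg _) (inv_nonneg.2 s_pos.le)
  · rw [abs_div, abs_of_pos A_pos, div_le_iff₀ A_pos]
    exact abs_kdeDeriv_selfDisp_le H hw hi hs y x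
  · rw [abs_div, abs_of_pos f_pos, div_le_iff₀ f_pos]
    exact abs_mixPDFDeriv_le_of_regime H hs hG hx

include H hw hi hs hG hψ hψC hθ hd in
theorem abs_integral_biasDensity_le_of_lipschitz :
    |∫ y, (∫ x in Ioi t, biasDensity G ψ h w s i y x) ∂(Measure.pi fun j => obsLaw G (s j))| ≤
      N ^ 20 * biasRate 3 θ h b (w i) := by
  set ν := Measure.pi fun j => obsLaw G (s j)
  set ρ := biasRate 3 θ h b (w i)
  have hN := H.pos
  have s_pos := scale_pos H hs i
  have ρ_nonneg : 0 ≤ ρ := (sq_nonneg h).trans (sq_le_biasRate H hw hθ 3)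
  have E_continuous := continuous_scoreError (G := G) H hw hs (i := i)
  have E_integrable : Integrable (Function.uncurry (scoreError G h w s i))
      (ν.prod (volume.restrict (Ioc t (N ^ 2)))) :=
    integrable_uncurry_restrict_Ioc E_continuous.measurable fun y x hx =>
      abs_scoreError_le H hw hi hs hG (H.abs_le_of_mem_Icc (Ioc_subset_Icc_self hx)) y
  have ψ_le : ∀ z, |ψ z| ≤ |z| := fun z => by
    have ψ_zero : ψ 0 = 0 := hψC 0 (by simpa using nonneg_of_ae_abs_le hG)
    simpa [Real.dist_eq, ψ_zero] using hψ.dist_le_mul z 0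
  refine abs_integral_biasDensity_le_of_window H hw hi hs hG ψ_le hψ.continuous.measurable hθ
    (E_integrable.integral_prod_left.const_mul (N ^ 2)) (fun y => ?_) ?_
  · rw [← integral_const_mul, ← norm_eq_abs]
    refine norm_integral_le_of_norm_le
      ((E_continuous.comp (Continuous.prodMk_right y)).integrableOn_Ioc.const_mul (N ^ 2))
      (ae_of_all _ fun x => (abs_biasDensity_le_of_lipschitz hG hψ hψC s_pos y x).trans ?_)
    exact mul_le_mul_of_nonneg_right (pow_le_pow_left₀ s_pos.le (hs i).2 2)
      (mul_nonneg (mixPDF_nonneg G s_pos x) (abs_nonneg _))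
  · rw [integral_const_mul]
    calc _ ≤ N ^ 2 * ((N ^ 2 - t) * (16 * N ^ 7 * ρ)) := by
          gcongr
          exact integral_setIntegral_le H.threshold_le E_integrable fun x hx =>
            integral_mixPDF_mul_abs_score_sub_le H hw hi hs hθ hd hG
              (H.abs_le_of_mem_Icc (Ioc_subset_Icc_self hx))
      _ ≤ N ^ 2 * (2 * N ^ 2 * (16 * N ^ 7 * ρ)) := by gcongr; exact H.window_length_le
      _ = 32 * N ^ 11 * ρ := by ring
      _ ≤ 400 * N ^ 17 * ρ := by gcongr <;> first | exact H.one_le | norm_num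

end Lipschitz

/-! ### Conditioning on the scales and on the selected observation -/

section Update

variable {ι : Type*} [Fintype ι] [DecidableEq ι] {α : ι → Type*} [∀ j, MeasurableSpace (α j)]
  (Q : ∀ j, Measure (α j)) [∀ j, IsProbabilityMeasure (Q j)] (i : ι)

theorem measurePreserving_update :
    MeasurePreserving (fun p : (∀ j, α j) × α i => Function.update p.1 i p.2)
      ((Measure.pi Q).prod (Q i)) (Measure.pi Q) := by
  refine ⟨measurable_update', (Measure.pi_eq fun S hS => ?_).symm⟩
  have preimage : (fun p : (∀ j, α j) × α i => Function.update p.1 i p.2) ⁻¹' Set.univ.pi S =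
      Set.univ.pi (Function.update S i Set.univ) ×ˢ S i := by
    ext p
    simp only [mem_preimage, mem_prod, mem_univ_pi,
      Function.forall_update_iff _ fun j a => a ∈ S j,
      Function.forall_update_iff S fun j T => p.1 j ∈ T, mem_univ, true_and, and_comm]
  rw [Measure.map_apply measurable_update' (MeasurableSet.univ_pi hS), preimage,
    Measure.prod_prod, Measure.pi_pi, ← Finset.prod_erase_mul _ _ (Finset.mem_univ i),
    ← Finset.prod_erase_mul _ (fun j => Q j (S j)) (Finset.mem_univ i), Function.update_self,
    measure_univ, mul_one]
  congr 1
  refine Finset.prod_congr rfl fun j hj => ?_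
  rw [Function.update_of_ne (Finset.ne_of_mem_erase hj)]

theorem integral_pi_eq_integral_update {F : (∀ j, α j) → ℝ} (hF : Integrable F (Measure.pi Q)) :
    ∫ y, F y ∂(Measure.pi Q) = ∫ y, ∫ a, F (Function.update y i a) ∂(Q i) ∂(Measure.pi Q) := by
  have update := measurePreserving_update Q i
  calc ∫ y, F y ∂(Measure.pi Q)
      = ∫ p : (∀ j, α j) × α i, F (Function.update p.1 i p.2) ∂((Measure.pi Q).prod (Q i)) := by
        nth_rewrite 1 [← update.map_eq]
        exact integral_map update.measurable.aemeasurable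
          (by rw [update.map_eq]; exact hF.aestronglyMeasurable)
    _ = _ := integral_prod _ (update.integrable_comp_of_integrable hF)

end Update

section Laws

variable (G H : Measure ℝ) [IsProbabilityMeasure G] [IsProbabilityMeasure H]

omit [IsProbabilityMeasure G] in
theorem map_noiseLaw {s : ℝ} (hs : 0 < s) :
    (noiseLaw G).map (fun p => (p.1, p.1 + s * p.2)) =
      (G.prod volume).withDensity fun p => ENNReal.ofReal (phi s (p.2 - p.1)) := by
  refine Measure.ext_of_lintegral _ fun F hF => ?_
  rw [lintegral_map hF (by fun_prop), noiseLaw, lintegral_prod _ (by fun_prop),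
    lintegral_withDensity_eq_lintegral_mul _ (by fun_prop) hF, lintegral_prod _ (by fun_prop)]
  congr with m
  exact lintegral_affine_gaussianReal hs m (F := fun x => F (m, x)) (by fun_prop)

theorem integral_comp_noiseLaw {s : ℝ} (hs : 0 < s) {Φ : ℝ × ℝ → ℝ} (hΦ : Measurable Φ)
    (hi : Integrable (fun p => Φ (p.1, p.1 + s * p.2)) (noiseLaw G)) :
    ∫ p, Φ (p.1, p.1 + s * p.2) ∂(noiseLaw G) = ∫ x, ∫ m, phi s (x - m) * Φ (m, x) ∂G := by
  have density_measurable : Measurable fun p : ℝ × ℝ => ENNReal.ofReal (phi s (p.2 - p.1)) := by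
    fun_prop
  have density_lt_top : ∀ᵐ p ∂(G.prod volume), ENNReal.ofReal (phi s (p.2 - p.1)) < ⊤ :=
    ae_of_all _ fun p => ENNReal.ofReal_lt_top
  have toReal_smul : ∀ p : ℝ × ℝ, (ENNReal.ofReal (phi s (p.2 - p.1))).toReal • Φ p =
      phi s (p.2 - p.1) * Φ p := fun p => by
    rw [ENNReal.toReal_ofReal (phi_pos hs _).le, smul_eq_mul]
  have integrable : Integrable (fun p : ℝ × ℝ => phi s (p.2 - p.1) * Φ p) (G.prod volume) := by
    have on_map := (integrable_map_measure hΦ.aestronglyMeasurable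
      (by fun_prop : AEMeasurable (fun p : ℝ × ℝ => (p.1, p.1 + s * p.2)) (noiseLaw G))).2 hi
    rw [map_noiseLaw G hs,
      integrable_withDensity_iff_integrable_smul' density_measurable density_lt_top] at on_map
    exact on_map.congr (ae_of_all _ toReal_smul)
  rw [← integral_prod_symm _ integrable, ← integral_map (f := Φ) (by fun_prop)
    hΦ.aestronglyMeasurable, map_noiseLaw G hs,
    integral_withDensity_eq_integral_toReal_smul density_measurable density_lt_top]
  simp only [toReal_smul]

variable {H}

theorem measurePreserving_tripleLaw (hH : ∀ᵐ s ∂H, 0 < s) :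
    MeasurePreserving (fun p : ℝ × ℝ × ℝ => (p.2.1, p.1, p.2.1 + p.1 * p.2.2))
      (H.prod (noiseLaw G)) (tripleLaw G H) := by
  refine ⟨by fun_prop, Measure.ext_of_lintegral _ fun F hF => ?_⟩
  have joint_measurable : Measurable fun q : (ℝ × ℝ) × ℝ =>
      ENNReal.ofReal (phi q.1.2 (q.2 - q.1.1)) * F (q.1.1, q.1.2, q.2) := by fun_prop
  calc ∫⁻ q, F q ∂((H.prod (noiseLaw G)).map fun p => (p.2.1, p.1, p.2.1 + p.1 * p.2.2))
      = ∫⁻ s, ∫⁻ m, ∫⁻ z, F (m, s, m + s * z) ∂(gaussianReal 0 1) ∂G ∂H := by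
        rw [lintegral_map hF (by fun_prop), lintegral_prod _ (by fun_prop)]
        congr with s
        rw [noiseLaw, lintegral_prod _ (by fun_prop)]
    _ = ∫⁻ s, ∫⁻ m, (∫⁻ x, ENNReal.ofReal (phi s (x - m)) * F (m, s, x)) ∂G ∂H := by
        refine lintegral_congr_ae (hH.mono fun s hs => lintegral_congr fun m => ?_)
        exact lintegral_affine_gaussianReal hs m (F := fun x => F (m, s, x)) (by fun_prop)
    _ = ∫⁻ m, ∫⁻ s, (∫⁻ x, ENNReal.ofReal (phi s (x - m)) * F (m, s, x)) ∂H ∂G :=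
        (lintegral_lintegral_swap joint_measurable.lintegral_prod_right'.aemeasurable).symm
    _ = ∫⁻ q, F q ∂(tripleLaw G H) := by
        rw [tripleLaw, lintegral_withDensity_eq_lintegral_mul _ (by fun_prop) hF,
          lintegral_prod _ (by fun_prop)]
        refine lintegral_congr fun m => ?_
        exact (lintegral_prod (fun q : ℝ × ℝ =>
          ENNReal.ofReal (phi q.1 (q.2 - m)) * F (m, q)) (by fun_prop)).symm

theorem isProbabilityMeasure_tripleLaw (hH : ∀ᵐ s ∂H, 0 < s) :
    IsProbabilityMeasure (tripleLaw G H) := by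
  have preserving := measurePreserving_tripleLaw G hH
  rw [← preserving.map_eq]
  exact Measure.isProbabilityMeasure_map preserving.measurable.aemeasurable

variable {n : ℕ}

/-- The observations with scales `s` built from the pairs `e` of means and standard normals. -/
def obs (s : Fin n → ℝ) (e : Fin n → ℝ × ℝ) : Fin n → ℝ := fun j => (e j).1 + s j * (e j).2

/-- The data built from the scales `p.1` and from the pairs `p.2` of means and standard normals. -/
def assemble (p : (Fin n → ℝ) × (Fin n → ℝ × ℝ)) : Fin n → ℝ × ℝ × ℝ :=
  fun j => ((p.2 j).1, p.1 j, obs p.1 p.2 j)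

theorem obs_update (s : Fin n → ℝ) (e : Fin n → ℝ × ℝ) (i : Fin n) (d : ℝ × ℝ) :
    obs s (Function.update e i d) = Function.update (obs s e) i (d.1 + s i * d.2) := by
  ext j
  rcases eq_or_ne j i with rfl | hj
  · simp only [obs, Function.update_self]
  · simp only [obs, Function.update_of_ne hj]

omit [IsProbabilityMeasure H] in
theorem measurePreserving_obs (s : Fin n → ℝ) :
    MeasurePreserving (obs s) (Measure.pi fun _ => noiseLaw G)
      (Measure.pi fun j => obsLaw G (s j)) :=
  measurePreserving_pi (fun _ => noiseLaw G) (fun j => obsLaw G (s j))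
    fun j => ⟨by fun_prop, rfl⟩

theorem measurePreserving_assemble (hH : ∀ᵐ s ∂H, 0 < s) :
    MeasurePreserving (assemble (n := n))
      ((Measure.pi fun _ => H).prod (Measure.pi fun _ => noiseLaw G)) (dataLaw n G H) := by
  have := isProbabilityMeasure_tripleLaw G hH
  exact (measurePreserving_pi (fun _ => H.prod (noiseLaw G)) (fun _ => tripleLaw G H)
    fun _ => measurePreserving_tripleLaw G hH).comp
    (measurePreserving_arrowProdEquivProdArrow ℝ (ℝ × ℝ) (Fin n) (fun _ => H)
      fun _ => noiseLaw G).symm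

theorem dataLaw_real_select (hH : ∀ᵐ s ∂H, 0 < s) (i : Fin n) (t : ℝ) :
    (dataLaw n G H).real {D | t < (D i).2.2} = (tripleLaw G H).real {p | t < p.2.2} := by
  have := isProbabilityMeasure_tripleLaw G hH
  have measurable_select : MeasurableSet {p : ℝ × ℝ × ℝ | t < p.2.2} :=
    measurableSet_lt measurable_const (by fun_prop)
  exact congrArg ENNReal.toReal ((measurePreserving_eval (fun _ : Fin n => tripleLaw G H)
    i).measure_preimage measurable_select.nullMeasurableSet)

theorem integral_selectedLaw (hH : ∀ᵐ s ∂H, 0 < s) (i : Fin n) (t : ℝ)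
    (f : (Fin n → ℝ × ℝ × ℝ) → ℝ) :
    ∫ D, f D ∂(selectedLaw G H t i) = ((tripleLaw G H).real {p | t < p.2.2})⁻¹ *
      ∫ D in {D | t < (D i).2.2}, f D ∂(dataLaw n G H) := by
  rw [selectedLaw, ProbabilityTheory.cond, integral_smul_measure, ← dataLaw_real_select G hH i t,
    smul_eq_mul, ENNReal.toReal_inv]
  rfl

end Laws

/-! ### The estimator -/

section Estimator

variable {n : ℕ}

theorem nest_eq (h b : ℝ) (x s : Fin n → ℝ) (i : Fin n) :
    nest h b x s i = x i + s i ^ 2 *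
      (kdeDeriv (weight b s (s i)) (fun j => h * s j) (selfDisp i x (x i)) /
        kde (weight b s (s i)) (fun j => h * s j) (selfDisp i x (x i))) := by
  simp only [nest, fHat, fHatDeriv, kde, kdeDeriv, phiDeriv, selfDisp, Function.update_eq_self,
    neg_sub, mul_assoc]

theorem nest_update (h b : ℝ) (y s : Fin n → ℝ) (i : Fin n) (x : ℝ) :
    nest h b (Function.update y i x) s i = x + s i ^ 2 *
      (kdeDeriv (weight b s (s i)) (fun j => h * s j) (selfDisp i y x) /
        kde (weight b s (s i)) (fun j => h * s j) (selfDisp i y x)) := by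
  simp only [nest_eq, Function.update_self, selfDisp_update]

/-- The estimator `ψ (nest h b x s i)`; the truncated estimators are of this form. -/
noncomputable def mapNest (ψ : ℝ → ℝ) (h b : ℝ) (x s : Fin n → ℝ) (i : Fin n) : ℝ :=
  ψ (nest h b x s i)

theorem measurable_mapNest {α : Type*} [MeasurableSpace α] {ψ : ℝ → ℝ} (hψ : Measurable ψ)
    (h b : ℝ) (i : Fin n) {f g : α → Fin n → ℝ} (hf : Measurable f) (hg : Measurable g) :
    Measurable fun a => mapNest ψ h b (f a) (g a) i := by
  refine hψ.comp ?_
  unfold nest fHat fHatDeriv weight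
  fun_prop

variable {h b l u : ℝ} (hh : 0 < h) (hb : 0 < b) (hl : 0 < l)
include hh hb hl

theorem abs_nest_sub_le {s : Fin n → ℝ} (hs : ∀ j, s j ∈ Icc l u) (i : Fin n) (x : Fin n → ℝ) :
    |nest h b x s i - x i| ≤ u ^ 2 * (((h * l) ^ 2)⁻¹ * (3 * (h * u) * n)) := by
  have s_pos : 0 < s i := hl.trans_le (hs i).1
  have hw := weight_mem_stdSimplex s i hb
  have bandwidth_le : ∀ j, h * l ≤ h * s j := fun j => mul_le_mul_of_nonneg_left (hs j).1 hh.le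
  set w := weight b s (s i)
  set A := kde w (fun j => h * s j) (selfDisp i x (x i))
  have A_pos : 0 < A := kde_pos hw (mul_pos hh hl) bandwidth_le _
  have one_le : 1 ≤ 3 * (h * u) * n * A :=
    calc 1 ≤ 3 * (h * s i) * Fintype.card (Fin n) * A :=
          one_le_mul_kde hw (mul_pos hh hl) bandwidth_le (selfDisp_self i x (x i))
            (weight_le_self s i hb)
      _ ≤ 3 * (h * u) * n * A := by rw [Fintype.card_fin]; gcongr; exact (hs i).2
  rw [nest_eq, add_sub_cancel_left, abs_mul, abs_pow, abs_of_pos s_pos, abs_div, abs_of_pos A_pos]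
  gcongr
  · exact (hs i).2
  · rw [div_le_iff₀ A_pos, mul_assoc]
    exact (abs_kdeDeriv_le hw (mul_pos hh hl) bandwidth_le _).trans
      (le_mul_of_one_le_right (by positivity) one_le)

theorem exists_abs_mapNest_le {ψ : ℝ → ℝ} (hψ : LipschitzWith 1 ψ) (i : Fin n) :
    ∃ K, ∀ s : Fin n → ℝ, (∀ j, s j ∈ Icc l u) →
      ∀ x : Fin n → ℝ, |mapNest ψ h b x s i| ≤ |x i| + K := by
  refine ⟨u ^ 2 * (((h * l) ^ 2)⁻¹ * (3 * (h * u) * n)) + |ψ 0|, fun s hs x => ?_⟩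
  have lipschitz : |ψ (nest h b x s i) - ψ 0| ≤ |nest h b x s i| := by
    simpa [Real.dist_eq] using hψ.dist_le_mul (nest h b x s i) 0
  have nest_sub_le := abs_nest_sub_le hh hb hl hs i x
  have := abs_sub_abs_le_abs_sub (ψ (nest h b x s i)) (ψ 0)
  have := abs_sub_abs_le_abs_sub (nest h b x s i) (x i)
  rw [mapNest]
  linarith

end Estimator

section Selection

theorem integrable_noise (G : Measure ℝ) [IsProbabilityMeasure G] :
    Integrable (fun p : ℝ × ℝ => |p.2|) (noiseLaw G) :=
  (measurePreserving_snd (μ := G) (ν := gaussianReal 0 1)).integrable_comp_of_integrable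
    IsGaussian.integrable_id.abs

theorem ae_noiseLaw_abs_fst_le {G : Measure ℝ} {C : ℝ} (hG : ∀ᵐ m ∂G, |m| ≤ C) :
    ∀ᵐ p ∂(noiseLaw G), |p.1| ≤ C :=
  Measure.quasiMeasurePreserving_fst.ae hG

/-- Tweedie's formula under selection. -/
theorem integral_noiseLaw_select {G : Measure ℝ} [IsProbabilityMeasure G] {C : ℝ}
    (hG : ∀ᵐ m ∂G, |m| ≤ C) {s : ℝ} (hs : 0 < s) {F : ℝ → ℝ} (hF : Measurable F) {K : ℝ}
    (hK : ∀ x, |F x| ≤ |x| + K) (t : ℝ) :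
    ∫ p, (Ioi t).indicator (fun x => F x - p.1) (p.1 + s * p.2) ∂(noiseLaw G) =
      ∫ x in Ioi t, (F x * mixPDF G s x - (x * mixPDF G s x + s ^ 2 * mixPDFDeriv G s x)) := by
  set Φ : ℝ × ℝ → ℝ := fun q => (Ioi t).indicator (fun x => F x - q.1) q.2
  have Φ_measurable : Measurable Φ :=
    (by fun_prop : Measurable fun q : ℝ × ℝ => F q.2 - q.1).indicator
      (measurable_snd measurableSet_Ioi)
  have Φ_integrable : Integrable (fun p : ℝ × ℝ => Φ (p.1, p.1 + s * p.2)) (noiseLaw G) := by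
    refine (((integrable_noise G).const_mul s).add (integrable_const (2 * C + K))).mono'
      (Φ_measurable.comp (by fun_prop)).aestronglyMeasurable ?_
    filter_upwards [ae_noiseLaw_abs_fst_le hG] with p hp
    have abs_obs_le := abs_add_le p.1 (s * p.2)
    rw [abs_mul, abs_of_pos hs] at abs_obs_le
    calc ‖Φ (p.1, p.1 + s * p.2)‖ ≤ |F (p.1 + s * p.2) - p.1| := norm_indicator_le_norm_self _ _
      _ ≤ s * |p.2| + (2 * C + K) := by
        linarith [abs_sub (F (p.1 + s * p.2)) p.1, hK (p.1 + s * p.2)]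
  rw [integral_comp_noiseLaw G hs Φ_measurable Φ_integrable, ← integral_indicator measurableSet_Ioi]
  congr with x
  by_cases hx : x ∈ Ioi t
  · simp only [Φ, indicator_of_mem hx]
    rw [← integral_mul_phi_sub G hs, mixPDF, ← integral_const_mul,
      ← integral_sub ((integrable_phi_sub G hs x).const_mul _) (integrable_mul_phi_sub G hs x)]
    congr with m
    ring
  · simp only [Φ, indicator_of_notMem hx, mul_zero, integral_zero]

variable {G H : Measure ℝ} [IsProbabilityMeasure G]
  {n : ℕ} {h b l u C : ℝ} (hh : 0 < h) (hb : 0 < b) (hl : 0 < l)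
  (hH : ∀ᵐ s ∂H, s ∈ Icc l u) (hG : ∀ᵐ m ∂G, |m| ≤ C) {ψ : ℝ → ℝ} (hψ : LipschitzWith 1 ψ)
  (i : Fin n)

include hψ in
omit [IsProbabilityMeasure G] in
theorem measurable_estError_mapNest : Measurable (estError (mapNest ψ h b) i) :=
  (measurable_mapNest hψ.continuous.measurable h b i (by fun_prop) (by fun_prop)).sub (by fun_prop)

include hh hb hl hG hψ

theorem integral_indicator_estError (t : ℝ) {s : Fin n → ℝ} (hs : ∀ j, s j ∈ Icc l u)
    (integrable : Integrable (fun e => (Ioi t).indicator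
      (fun _ => estError (mapNest ψ h b) i (assemble (s, e))) (obs s e i))
      (Measure.pi fun _ => noiseLaw G)) :
    ∫ e, (Ioi t).indicator (fun _ => estError (mapNest ψ h b) i (assemble (s, e))) (obs s e i)
        ∂(Measure.pi fun _ => noiseLaw G) =
      ∫ y, (∫ x in Ioi t, biasDensity G ψ h (weight b s (s i)) s i y x)
        ∂(Measure.pi fun j => obsLaw G (s j)) := by
  have s_pos : 0 < s i := hl.trans_le (hs i).1
  have hψm := hψ.continuous.measurable
  obtain ⟨K, hK⟩ := exists_abs_mapNest_le hh hb hl (u := u) hψ i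
  have select : ∀ e, ∫ d, (Ioi t).indicator
      (fun x => mapNest ψ h b (Function.update (obs s e) i x) s i - d.1) (d.1 + s i * d.2)
        ∂(noiseLaw G) =
      ∫ x in Ioi t, biasDensity G ψ h (weight b s (s i)) s i (obs s e) x := fun e => by
    rw [integral_noiseLaw_select hG s_pos
      (measurable_mapNest hψm h b i (measurable_update _) measurable_const)
      fun x => by simpa only [Function.update_self] using hK s hs (Function.update (obs s e) i x)]
    simp only [mapNest, nest_update, biasDensity]
  have density_integral_measurable : StronglyMeasurable fun y =>
      ∫ x in Ioi t, biasDensity G ψ h (weight b s (s i)) s i y x :=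
    (measurable_uncurry_biasDensity G hψm h _ s_pos).stronglyMeasurable.integral_prod_right
  have obs_preserving := measurePreserving_obs G s
  rw [integral_pi_eq_integral_update _ i integrable, ← obs_preserving.map_eq,
    integral_map obs_preserving.measurable.aemeasurable
      density_integral_measurable.aestronglyMeasurable]
  congr with e
  rw [← select]
  congr with d
  by_cases hd : d.1 + s i * d.2 ∈ Ioi t
  · simp only [estError, assemble, obs_update, Function.update_self, indicator_of_mem hd]
  · simp only [obs_update, Function.update_self, indicator_of_notMem hd]

variable [IsProbabilityMeasure H]

include hH in
theorem integrable_estError_assemble :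
    Integrable (fun p => estError (mapNest ψ h b) i (assemble p))
      ((Measure.pi fun _ => H).prod (Measure.pi fun _ => noiseLaw G)) := by
  have preserving := measurePreserving_assemble (n := n) G (hH.mono fun s hs => hl.trans_le hs.1)
  set P := (Measure.pi fun _ : Fin n => H).prod (Measure.pi fun _ : Fin n => noiseLaw G)
  have noise_preserving : MeasurePreserving (fun p => p.2 i) P (noiseLaw G) :=
    (measurePreserving_eval (fun _ : Fin n => noiseLaw G) i).comp measurePreserving_snd
  have scales_mem : ∀ᵐ p ∂P, ∀ j, p.1 j ∈ Icc l u :=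
    Measure.quasiMeasurePreserving_fst.ae (ae_pi_forall H hH)
  have mean_le : ∀ᵐ p ∂P, |(p.2 i).1| ≤ C :=
    noise_preserving.quasiMeasurePreserving.ae (ae_noiseLaw_abs_fst_le hG)
  obtain ⟨K, hK⟩ := exists_abs_mapNest_le hh hb hl (u := u) hψ i
  refine (((noise_preserving.integrable_comp_of_integrable (integrable_noise G)).const_mul u).add
    (integrable_const (2 * C + K))).mono' ((measurable_estError_mapNest hψ i).comp
      preserving.measurable).aestronglyMeasurable ?_
  filter_upwards [scales_mem, mean_le] with p hp hm
  have noise_le : |p.1 i * (p.2 i).2| ≤ u * |(p.2 i).2| := by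
    rw [abs_mul, abs_of_pos (hl.trans_le (hp i).1)]
    exact mul_le_mul_of_nonneg_right (hp i).2 (abs_nonneg _)
  have obs_le : |obs p.1 p.2 i| ≤ |(p.2 i).1| + |p.1 i * (p.2 i).2| := abs_add_le _ _
  calc |estError (mapNest ψ h b) i (assemble p)|
      ≤ |mapNest ψ h b (obs p.1 p.2) p.1 i| + |(p.2 i).1| := abs_sub _ _
    _ ≤ u * |(p.2 i).2| + (2 * C + K) := by linarith [hK p.1 hp (obs p.1 p.2)]

include hH

theorem abs_setIntegral_estError_le (t : ℝ) {a c : ℝ} (hc : 0 ≤ c)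
    (hbias : ∀ s : Fin n → ℝ, (∀ j, s j ∈ Icc l u) →
      |∫ y, (∫ x in Ioi t, biasDensity G ψ h (weight b s (s i)) s i y x)
        ∂(Measure.pi fun j => obsLaw G (s j))| ≤ a + c * weight b s (s i) i) :
    |∫ D in {D | t < (D i).2.2}, estError (mapNest ψ h b) i D ∂(dataLaw n G H)| ≤
      a + c * (2 * ((u - l) / b + 1) / n) := by
  have preserving := measurePreserving_assemble (n := n) G (hH.mono fun s hs => hl.trans_le hs.1)
  have select_measurable : MeasurableSet {D : Fin n → ℝ × ℝ × ℝ | t < (D i).2.2} :=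
    measurableSet_lt measurable_const (by fun_prop)
  have integrable : Integrable (fun p : (Fin n → ℝ) × (Fin n → ℝ × ℝ) => (Ioi t).indicator
      (fun _ => estError (mapNest ψ h b) i (assemble p)) (obs p.1 p.2 i))
      ((Measure.pi fun _ => H).prod (Measure.pi fun _ => noiseLaw G)) :=
    (integrable_estError_assemble hh hb hl hH hG hψ i).indicator
      (preserving.measurable select_measurable)
  have iterated : ∫ D in {D | t < (D i).2.2}, estError (mapNest ψ h b) i D ∂(dataLaw n G H) =
      ∫ s, (∫ e, (Ioi t).indicator (fun _ => estError (mapNest ψ h b) i (assemble (s, e)))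
        (obs s e i) ∂(Measure.pi fun _ => noiseLaw G)) ∂(Measure.pi fun _ => H) := by
    rw [← integral_indicator select_measurable, ← preserving.map_eq,
      integral_map preserving.measurable.aemeasurable ((measurable_estError_mapNest hψ
        i).indicator select_measurable).aestronglyMeasurable]
    exact integral_prod _ integrable
  have weight_integrable :=
    (integrable_weight_self i hb (Measure.pi fun _ : Fin n => H)).const_mul c
  calc _ ≤ ∫ s, (a + c * weight b s (s i) i) ∂(Measure.pi fun _ => H) := by
        rw [iterated, ← norm_eq_abs]
        refine norm_integral_le_of_norm_le ((integrable_const a).add weight_integrable) ?_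
        filter_upwards [ae_pi_forall H hH, integrable.prod_right_ae] with s hs hi
        rw [integral_indicator_estError hh hb hl hG hψ i t hs hi]
        exact hbias s hs
    _ = a + c * ∫ s, weight b s (s i) i ∂(Measure.pi fun _ => H) := by
        rw [integral_add (integrable_const a) weight_integrable, integral_const_mul,
          integral_const, probReal_univ, one_smul]
    _ ≤ a + c * (2 * ((u - l) / b + 1) / n) := by
        gcongr
        exact integral_weight_self_le H hb hH i

theorem integrable_estError_selectedLaw (t : ℝ) :
    Integrable (estError (mapNest ψ h b) i) (selectedLaw G H t i) := by
  have preserving := measurePreserving_assemble (n := n) G (hH.mono fun s hs => hl.trans_le hs.1)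
  have integrable := (preserving.integrable_comp
    (measurable_estError_mapNest hψ i).aestronglyMeasurable).1
    (integrable_estError_assemble hh hb hl hH hG hψ i)
  unfold selectedLaw
  by_cases null : dataLaw n G H {D | t < (D i).2.2} = 0
  · rw [cond_eq_zero_of_meas_eq_zero null]
    exact integrable_zero_measure
  · exact integrable.restrict.smul_measure (ENNReal.inv_ne_top.2 null)

end Selection

/-! ### Asymptotics -/

/-- Given any scales in `[N⁻¹, N]`, the selected bias of `mapNest ψ h b` is at most of the order
`biasRate q`; the factor `N ^ 20` is negligible, `N` being an arbitrarily small power of `n`. -/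
def HasBiasOrder (q n : ℕ) (G : Measure ℝ) (ψ : ℝ → ℝ) (h b C t : ℝ) : Prop :=
  ∀ ⦃N θ : ℝ⦄, Regime n h b C t N → 0 < θ → ∀ (i : Fin n) (s : Fin n → ℝ),
    (∀ j, s j ∈ Icc N⁻¹ N) →
    |∫ y, (∫ x in Ioi t, biasDensity G ψ h (weight b s (s i)) s i y x)
      ∂(Measure.pi fun j => obsLaw G (s j))| ≤ N ^ 20 * biasRate q θ h b (weight b s (s i) i)

section FixedSize

variable {n q : ℕ} {h b C t N θ : ℝ}

theorem Regime.drift_weight_le (R : Regime n h b C t N) (s : Fin n → ℝ) (i : Fin n) :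
    drift (weight b s (s i)) s (s i) ≤ 2 * N * b := by
  have hb := R.b_pos
  have := R.eight_le
  calc drift (weight b s (s i)) s (s i) ≤ b * (N + 2 * (n * exp (-(N ^ 2) / 4))) :=
        NEST.drift_weight_le s i hb R.pos.le
    _ ≤ b * (N + 2 * 1) := by gcongr; exact R.card_mul_exp_le_one
    _ ≤ b * (2 * N) := by gcongr; linarith
    _ = 2 * N * b := by ring

variable {G H : Measure ℝ} [IsProbabilityMeasure G] (hG : ∀ᵐ m ∂G, |m| ≤ C)
include hG

theorem hasBiasOrder_id : HasBiasOrder 1 n G id h b C t := fun N θ R hθ i s hs => by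
  have drift_le := R.drift_weight_le s i
  rw [← Fintype.card_fin n] at R
  exact abs_integral_biasDensity_id_le R (weight_mem_stdSimplex s i R.b_pos)
    (weight_le_self s i R.b_pos) hs hθ drift_le hG

theorem hasBiasOrder_of_lipschitz {ψ : ℝ → ℝ} (hψ : LipschitzWith 1 ψ)
    (hψC : ∀ z, |z| ≤ C → ψ z = z) : HasBiasOrder 3 n G ψ h b C t := fun N θ R hθ i s hs => by
  have drift_le := R.drift_weight_le s i
  rw [← Fintype.card_fin n] at R
  exact abs_integral_biasDensity_le_of_lipschitz R (weight_mem_stdSimplex s i R.b_pos)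
    (weight_le_self s i R.b_pos) hs hθ drift_le hG hψ hψC

variable {ψ : ℝ → ℝ} {l u : ℝ} [IsProbabilityMeasure H]

theorem HasBiasOrder.abs_integral_selectedLaw_le (bias : HasBiasOrder q n G ψ h b C t)
    (R : Regime n h b C t N) (hl : 0 < l) (hlN : l⁻¹ ≤ N) (huN : u ≤ N)
    (hH : ∀ᵐ s ∂H, s ∈ Icc l u) (hψ : LipschitzWith 1 ψ) (hθ : 0 < θ)
    (hN : N⁻¹ ≤ (tripleLaw G H).real {p | t < p.2.2}) (i : Fin n) :
    |∫ D, estError (mapNest ψ h b) i D ∂(selectedLaw G H t i)| ≤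
      N ^ 21 * biasRate q θ h b (4 * N * (b⁻¹ * (n : ℝ)⁻¹)) := by
  have hh := R.h_pos
  have hb := R.b_pos
  have hN0 := R.pos
  have b_le : b ≤ N := calc
    b ≤ N ^ 10 * (b + h ^ 2) := (le_add_of_nonneg_right (sq_nonneg h)).trans <|
        le_mul_of_one_le_left (by positivity) (one_le_pow₀ R.one_le)
    _ ≤ 1 := R.bandwidths_le
    _ ≤ N := R.one_le
  have self_weight : 2 * ((u - l) / b + 1) / n ≤ 4 * N * (b⁻¹ * (n : ℝ)⁻¹) := calc
    2 * ((u - l) / b + 1) / n ≤ 2 * ((N + N) / b) / n := by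
        rw [div_add_one hb.ne']; gcongr; linarith
    _ = 4 * N * (b⁻¹ * (n : ℝ)⁻¹) := by ring
  have on_selection := abs_setIntegral_estError_le hh hb hl hH hG hψ i t
    (a := N ^ 20 * (θ + (b + h ^ 2))) (c := N ^ 20 * ((1 + θ⁻¹) * (h ^ q)⁻¹)) (by positivity)
    fun s hs => (bias R hθ i s fun j =>
      ⟨(inv_le_of_inv_le₀ hl hlN).trans (hs j).1, (hs j).2.trans huN⟩).trans_eq
        (by rw [biasRate]; ring)
  rw [integral_selectedLaw G (hH.mono fun s hs => hl.trans_le hs.1), abs_mul,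
    abs_of_nonneg (inv_nonneg.2 measureReal_nonneg)]
  calc _ ≤ N * (N ^ 20 * (θ + (b + h ^ 2)) +
          N ^ 20 * ((1 + θ⁻¹) * (h ^ q)⁻¹) * (2 * ((u - l) / b + 1) / n)) :=
        mul_le_mul (inv_le_of_inv_le₀ hN0 hN) on_selection (abs_nonneg _) hN0.le
    _ ≤ N * (N ^ 20 * (θ + (b + h ^ 2)) +
          N ^ 20 * ((1 + θ⁻¹) * (h ^ q)⁻¹) * (4 * N * (b⁻¹ * (n : ℝ)⁻¹))) := by gcongr
    _ = N ^ 21 * biasRate q θ h b (4 * N * (b⁻¹ * (n : ℝ)⁻¹)) := by rw [biasRate]; ring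

end FixedSize

section PowersOfSampleSize

variable {f g : ℕ → ℝ} {c d ρ : ℝ}

theorem isBigO_mul_rpow (hf : f =O[atTop] fun n : ℕ => (n : ℝ) ^ c)
    (hg : g =O[atTop] fun n : ℕ => (n : ℝ) ^ d) :
    (fun n => f n * g n) =O[atTop] fun n : ℕ => (n : ℝ) ^ (c + d) := by
  refine (hf.mul hg).trans (EventuallyEq.isBigO ?_)
  filter_upwards [eventually_gt_atTop 0] with n hn
  rw [rpow_add (Nat.cast_pos.2 hn)]

theorem isBigO_pow_rpow (hf : f =O[atTop] fun n : ℕ => (n : ℝ) ^ c) (q : ℕ) :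
    (fun n => f n ^ q) =O[atTop] fun n : ℕ => (n : ℝ) ^ (q * c) := by
  refine (hf.pow q).trans (EventuallyEq.isBigO (Eventually.of_forall fun n => ?_))
  simp only [mul_comm (q : ℝ), rpow_mul n.cast_nonneg, rpow_natCast]

theorem isBigO_inv_rpow (hf : f =Θ[atTop] fun n : ℕ => (n : ℝ) ^ (-c)) :
    (fun n => (f n)⁻¹) =O[atTop] fun n : ℕ => (n : ℝ) ^ c := by
  refine hf.inv.isBigO.trans (EventuallyEq.isBigO (Eventually.of_forall fun n => ?_))
  simp only [rpow_neg n.cast_nonneg, inv_inv]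

theorem isBigO_rpow_of_le (hf : f =O[atTop] fun n : ℕ => (n : ℝ) ^ c) (hcd : c ≤ d) :
    f =O[atTop] fun n : ℕ => (n : ℝ) ^ d :=
  hf.trans <| IsBigO.of_norm_eventuallyLE <| by
    filter_upwards [eventually_ge_atTop 1] with n hn
    rw [norm_of_nonneg (rpow_nonneg n.cast_nonneg c)]
    exact rpow_le_rpow_of_exponent_le (Nat.one_le_cast.2 hn) hcd

theorem tendsto_zero_of_isBigO_rpow (hf : f =O[atTop] fun n : ℕ => (n : ℝ) ^ c) (hc : c < 0) :
    Tendsto f atTop (nhds 0) :=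
  hf.trans_tendsto <| by
    simpa only [neg_neg, Function.comp_def] using
      (tendsto_rpow_neg_atTop (neg_pos.2 hc)).comp tendsto_natCast_atTop_atTop

theorem isBigO_exp_neg_rpow (hc : 0 < c) (hρ : 0 < ρ) (d : ℝ) :
    (fun n : ℕ => exp (-c * ((n : ℝ) ^ ρ) ^ 2)) =O[atTop] fun n : ℕ => (n : ℝ) ^ d := by
  have growth : Tendsto (fun n : ℕ => ((n : ℝ) ^ ρ) ^ 2) atTop atTop :=
    (tendsto_pow_atTop two_ne_zero).comp <|
      (tendsto_rpow_atTop hρ).comp tendsto_natCast_atTop_atTop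
  refine ((isLittleO_exp_neg_mul_rpow_atTop hc (d / (2 * ρ))).isBigO.comp_tendsto growth).trans
    (EventuallyEq.isBigO (Eventually.of_forall fun n => ?_))
  simp only [Function.comp_apply]
  rw [← rpow_natCast, ← rpow_mul n.cast_nonneg, ← rpow_mul n.cast_nonneg]
  congr 1
  push_cast
  field_simp

/-- Growth slower than every positive power of the sample size. -/
def Subpolynomial (f : ℕ → ℝ) : Prop :=
  ∀ ε : ℝ, 0 < ε → f =o[atTop] fun n : ℕ => (n : ℝ) ^ ε

theorem Subpolynomial.eventually_le_rpow (hf : Subpolynomial f) (hρ : 0 < ρ) :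
    ∀ᶠ n : ℕ in atTop, f n ≤ (n : ℝ) ^ ρ := by
  filter_upwards [(hf ρ hρ).bound one_pos] with n hn
  rw [one_mul, norm_of_nonneg (rpow_nonneg n.cast_nonneg ρ)] at hn
  exact (le_abs_self _).trans hn

theorem subpolynomial_const (c : ℝ) : Subpolynomial fun _ => c := fun _ hε =>
  isLittleO_const_left.2 <| Or.inr <|
    tendsto_norm_atTop_atTop.comp ((tendsto_rpow_atTop hε).comp tendsto_natCast_atTop_atTop)

end PowersOfSampleSize

section Limit

variable {bx bs : ℕ → ℝ} {ηx ηs ρ : ℝ} (hbx : bx =Θ[atTop] fun n : ℕ => (n : ℝ) ^ (-ηx))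
  (hbs : bs =Θ[atTop] fun n : ℕ => (n : ℝ) ^ (-ηs)) (hρ : 0 < ρ)
include hbx hbs hρ

-- `θ = N ^ (-22)`, where `N = n ^ ρ`, beats the factor `N ^ 21`, and `θ⁻¹` is still a small power.
theorem tendsto_biasRate {q : ℕ} (hx : 45 * ρ ≤ ηx) (hs : 45 * ρ ≤ ηs)
    (hq : 45 * ρ ≤ 1 - q * ηx - ηs) :
    Tendsto (fun n : ℕ => ((n : ℝ) ^ ρ) ^ 21 * biasRate q (((n : ℝ) ^ ρ) ^ 22)⁻¹ (bx n) (bs n)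
      (4 * (n : ℝ) ^ ρ * ((bs n)⁻¹ * (n : ℝ)⁻¹))) atTop (nhds 0) := by
  have scale (k : ℕ) : (fun n : ℕ => ((n : ℝ) ^ ρ) ^ k) =O[atTop] fun n : ℕ => (n : ℝ) ^ (k * ρ) :=
    isBigO_pow_rpow (isBigO_refl _ _) k
  have self_weight : (fun n : ℕ => 4 * (n : ℝ) ^ ρ * ((bs n)⁻¹ * (n : ℝ)⁻¹) * (bx n ^ q)⁻¹)
      =O[atTop] fun n : ℕ => (n : ℝ) ^ (ρ + (ηs + -1) + q * ηx) := by
    simp only [← inv_pow, ← rpow_neg_one (Nat.cast _)]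
    exact isBigO_mul_rpow (isBigO_mul_rpow ((isBigO_refl _ _).const_mul_left 4)
      (isBigO_mul_rpow (isBigO_inv_rpow hbs) (isBigO_refl _ _)))
      (isBigO_pow_rpow (isBigO_inv_rpow hbx) q)
  have fluctuation : (fun n : ℕ => 1 + ((n : ℝ) ^ ρ) ^ 22) =O[atTop]
      fun n : ℕ => (n : ℝ) ^ (22 * ρ) :=
    (isBigO_rpow_of_le (c := 0) (by simp only [rpow_zero]; exact isBigO_refl _ _)
      (by positivity)).add (scale 22)
  have balance : (fun n : ℕ => (((n : ℝ) ^ ρ) ^ 22)⁻¹) =O[atTop]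
      fun n : ℕ => (n : ℝ) ^ (-(22 * ρ)) := by
    refine EventuallyEq.isBigO (Eventually.of_forall fun n => ?_)
    simp only [rpow_neg n.cast_nonneg, mul_comm 22 ρ, rpow_mul n.cast_nonneg, rpow_ofNat]
  have rate : (fun n : ℕ => biasRate q (((n : ℝ) ^ ρ) ^ 22)⁻¹ (bx n) (bs n)
      (4 * (n : ℝ) ^ ρ * ((bs n)⁻¹ * (n : ℝ)⁻¹))) =O[atTop] fun n => (n : ℝ) ^ (-(22 * ρ)) := by
    simp only [biasRate, inv_inv]
    exact (balance.add (isBigO_rpow_of_le (isBigO_mul_rpow fluctuation self_weight)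
      (by linarith))).add ((isBigO_rpow_of_le hbs.isBigO (by linarith)).add
        (isBigO_rpow_of_le (isBigO_pow_rpow hbx.isBigO 2) (by push_cast; linarith)))
  exact tendsto_zero_of_isBigO_rpow (isBigO_mul_rpow (scale 21) rate) (by push_cast; linarith)

theorem eventually_regime {C : ℕ → ℝ} (hC : Subpolynomial C) (hbx0 : ∀ n, 0 < bx n)
    (hbs0 : ∀ n, 0 < bs n) (t : ℝ) (hx : 45 * ρ ≤ ηx) (hs : 45 * ρ ≤ ηs) :
    ∀ᶠ n : ℕ in atTop, Regime n (bx n) (bs n) (C n) t ((n : ℝ) ^ ρ) := by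
  have growth : Tendsto (fun n : ℕ => (n : ℝ) ^ ρ) atTop atTop :=
    (tendsto_rpow_atTop hρ).comp tendsto_natCast_atTop_atTop
  have bandwidths : Tendsto (fun n : ℕ => ((n : ℝ) ^ ρ) ^ 10 * (bs n + bx n ^ 2)) atTop
      (nhds 0) :=
    tendsto_zero_of_isBigO_rpow (c := -(35 * ρ)) (isBigO_rpow_of_le
      (isBigO_mul_rpow (d := -(45 * ρ)) (isBigO_pow_rpow (isBigO_refl _ _) 10)
        ((isBigO_rpow_of_le hbs.isBigO (by linarith)).add (isBigO_rpow_of_le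
          (isBigO_pow_rpow hbx.isBigO 2) (by push_cast; linarith)))) (by push_cast; linarith))
      (by linarith)
  have tail : Tendsto (fun n : ℕ => n * exp (-8⁻¹ * ((n : ℝ) ^ ρ) ^ 2) * ((bx n)⁻¹) ^ 3) atTop
      (nhds 0) :=
    tendsto_zero_of_isBigO_rpow (c := -1) (isBigO_rpow_of_le (isBigO_mul_rpow
      (isBigO_mul_rpow (c := 1) (by simp only [rpow_one]; exact isBigO_refl _ _)
        (isBigO_exp_neg_rpow (by norm_num) hρ (-(2 + 3 * ηx))))
      (isBigO_pow_rpow (isBigO_inv_rpow hbx) 3)) (by push_cast; linarith)) (by norm_num)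
  filter_upwards [growth.eventually_ge_atTop 8, growth.eventually_ge_atTop |t|,
    hC.eventually_le_rpow hρ, bandwidths.eventually_le_const one_pos,
    tail.eventually_le_const one_pos] with n eight_le abs_threshold_le bound_le bandwidths_le
      tail_le
  refine ⟨eight_le, hbx0 n, hbs0 n, bound_le, abs_threshold_le, bandwidths_le, ?_⟩
  rw [inv_pow, mul_inv_le_iff₀ (pow_pos (hbx0 n) 3), one_mul] at tail_le
  simpa only [neg_mul, neg_div, inv_mul_eq_div] using tail_le

end Limit

section Vanishing

variable {Gμ Gσ : ℕ → Measure ℝ} [∀ n, IsProbabilityMeasure (Gμ n)]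
  [∀ n, IsProbabilityMeasure (Gσ n)] {C : ℕ → ℝ} (hC : Subpolynomial C)
  (hμ : ∀ n, ∀ᵐ m ∂(Gμ n), |m| ≤ C n) {l u : ℕ → ℝ} (hl : ∀ n, 0 < l n)
  (hli : Subpolynomial fun n => (l n)⁻¹) (hu : Subpolynomial u)
  (hσ : ∀ n, ∀ᵐ s ∂(Gσ n), s ∈ Icc (l n) (u n)) {ηx ηs : ℝ} (hηx : 0 < ηx) (hηs : 0 < ηs)
  {bx bs : ℕ → ℝ} (hbx0 : ∀ n, 0 < bx n) (hbs0 : ∀ n, 0 < bs n)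
  (hbx : bx =Θ[atTop] fun n : ℕ => (n : ℝ) ^ (-ηx))
  (hbs : bs =Θ[atTop] fun n : ℕ => (n : ℝ) ^ (-ηs)) {t : ℝ}
  (ht : ∀ ε : ℝ, 0 < ε → ∀ᶠ n : ℕ in atTop,
    (n : ℝ) ^ (-ε) ≤ (tripleLaw (Gμ n) (Gσ n)).real {p | t < p.2.2})
  {ψ : ℕ → ℝ → ℝ} (hψ : ∀ n, LipschitzWith 1 (ψ n))
include hC hμ hl hli hu hσ hηx hηs hbx0 hbs0 hbx hbs ht hψ

theorem vanishingSelectionBias_mapNest {q : ℕ} (hq : q * ηx + ηs < 1)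
    (bias : ∀ᶠ n in atTop, HasBiasOrder q n (Gμ n) (ψ n) (bx n) (bs n) (C n) t) :
    VanishingSelectionBias Gμ Gσ t fun n => mapNest (ψ n) (bx n) (bs n) := by
  refine ⟨fun n i => integrable_estError_selectedLaw (hbx0 n) (hbs0 n) (hl n) (hσ n) (hμ n)
    (hψ n) i t, fun ε hε => ?_⟩
  obtain ⟨ρ, ρ_pos, hx, hs, balance⟩ : ∃ ρ : ℝ,
      0 < ρ ∧ 45 * ρ ≤ ηx ∧ 45 * ρ ≤ ηs ∧ 45 * ρ ≤ 1 - q * ηx - ηs := by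
    have gap : 0 < 1 - q * ηx - ηs := by linarith
    refine ⟨min ηx (min ηs (1 - q * ηx - ηs)) / 45, by positivity, ?_⟩
    simp only [mul_div_cancel₀ _ (by norm_num : (45 : ℝ) ≠ 0)]
    exact ⟨min_le_left _ _, (min_le_right _ _).trans (min_le_left _ _),
      (min_le_right _ _).trans (min_le_right _ _)⟩
  filter_upwards [eventually_gt_atTop 0, bias, ht ρ ρ_pos, hli.eventually_le_rpow ρ_pos,
    hu.eventually_le_rpow ρ_pos, eventually_regime hbx hbs ρ_pos hC hbx0 hbs0 t hx hs,
    (tendsto_biasRate hbx hbs ρ_pos hx hs balance).eventually_lt_const hε]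
    with n n_pos bias_n selection_prob l_inv_le u_le regime rate_lt i
  rw [rpow_neg n.cast_nonneg] at selection_prob
  exact (HasBiasOrder.abs_integral_selectedLaw_le (hμ n) bias_n regime (hl n) l_inv_le u_le (hσ n)
    (hψ n) (by positivity) selection_prob i).trans_lt rate_lt

theorem vanishingSelectionBias_truncation (hη : 3 * ηx + ηs < 1)
    (hψC : ∀ᶠ n in atTop, ∀ z, |z| ≤ C n → ψ n z = z) :
    VanishingSelectionBias Gμ Gσ t fun n => mapNest (ψ n) (bx n) (bs n) :=
  vanishingSelectionBias_mapNest hC hμ hl hli hu hσ hηx hηs hbx0 hbs0 hbx hbs ht hψ (q := 3)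
    (mod_cast hη) <| hψC.mono fun n h => hasBiasOrder_of_lipschitz (hμ n) (hψ n) h

end Vanishing

end NEST

theorem theorem4p3_general (Gμ Gσ : ℕ → Measure ℝ)
    [∀ n, IsProbabilityMeasure (Gμ n)] [∀ n, IsProbabilityMeasure (Gσ n)]
    (C : ℕ → ℝ) (hC : NEST.Subpolynomial C) (hμ : ∀ n, ∀ᵐ m ∂(Gμ n), |m| ≤ C n)
    (σl σu : ℕ → ℝ) (hσl : ∀ n, 0 < σl n) (hσl' : NEST.Subpolynomial fun n => (σl n)⁻¹)
    (hσu : NEST.Subpolynomial σu) (hσ : ∀ n, ∀ᵐ s ∂(Gσ n), s ∈ Set.Icc (σl n) (σu n))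
    (ηx ηs : ℝ) (hηx : 0 < ηx) (hηs : 0 < ηs) (hη : ηx + ηs < 1)
    (bx bs : ℕ → ℝ) (hbx : ∀ n, 0 < bx n) (hbs : ∀ n, 0 < bs n)
    (hbx' : bx =Θ[atTop] fun n : ℕ => (n : ℝ) ^ (-ηx))
    (hbs' : bs =Θ[atTop] fun n : ℕ => (n : ℝ) ^ (-ηs))
    (t : ℝ)
    (ht : ∀ ε : ℝ, 0 < ε → ∀ᶠ n : ℕ in atTop,
      (n : ℝ) ^ (-ε) ≤ (NEST.tripleLaw (Gμ n) (Gσ n)).real {p | t < p.2.2}) :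
    NEST.VanishingSelectionBias Gμ Gσ t (fun n x σ i => NEST.nest (bx n) (bs n) x σ i) ∧
    (3 * ηx + ηs < 1 → ∀ τ : ℕ → ℝ, (∀ᶠ n in atTop, C n ≤ τ n) →
      NEST.VanishingSelectionBias Gμ Gσ t
        (fun n x σ i => min (NEST.nest (bx n) (bs n) x σ i) (τ n)) ∧
      NEST.VanishingSelectionBias Gμ Gσ t
        (fun n x σ i => max (-τ n) (min (NEST.nest (bx n) (bs n) x σ i) (τ n)))) := by
  refine ⟨NEST.vanishingSelectionBias_mapNest hC hμ hσl hσl' hσu hσ hηx hηs hbx hbs hbx' hbs' ht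
    (ψ := fun _ => id) (fun _ => LipschitzWith.id) (q := 1) (by simpa using hη)
    (Eventually.of_forall fun n => NEST.hasBiasOrder_id (hμ n)), fun hη3 τ hτ => ⟨?_, ?_⟩⟩
  · refine NEST.vanishingSelectionBias_truncation hC hμ hσl hσl' hσu hσ hηx hηs hbx hbs hbx' hbs' ht
      (fun n => LipschitzWith.id.min_const (τ n)) hη3 ?_
    filter_upwards [hτ] with n hn z hz
    exact min_eq_left ((le_abs_self z).trans (hz.trans hn))
  · refine NEST.vanishingSelectionBias_truncation hC hμ hσl hσl' hσu hσ hηx hηs hbx hbs hbx' hbs' ht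
      (fun n => (LipschitzWith.id.min_const (τ n)).const_max (-τ n)) hη3 ?_
    filter_upwards [hτ] with n hn z hz
    have := abs_le.1 (hz.trans hn)
    exact (congrArg _ (min_eq_left this.2)).trans (max_eq_right this.1)

theorem theorem4p3
    (Gμ Gσ : ℕ → Measure ℝ)
    [∀ n, IsProbabilityMeasure (Gμ n)] [∀ n, IsProbabilityMeasure (Gσ n)]
    -- the means are bounded by a sequence that grows slower than every power of `n`
    (C : ℕ → ℝ)
    (hC : ∀ ε : ℝ, 0 < ε → C =o[atTop] fun n : ℕ => (n : ℝ) ^ ε)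
    (hμ : ∀ n, ∀ᵐ m ∂(Gμ n), |m| ≤ C n)
    -- the standard deviations are uniformly bounded above and away from zero
    (σl σu : ℝ) (hσl : 0 < σl)
    (hσ : ∀ n, ∀ᵐ s ∂(Gσ n), s ∈ Set.Icc σl σu)
    -- the bandwidths
    (ηx ηs : ℝ) (hηx : 0 < ηx) (hηs : 0 < ηs) (hη : ηx + ηs < 1)
    (bx bs : ℕ → ℝ) (hbx : ∀ n, 0 < bx n) (hbs : ∀ n, 0 < bs n)
    (hbx' : bx =Θ[atTop] fun n : ℕ => (n : ℝ) ^ (-ηx))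
    (hbs' : bs =Θ[atTop] fun n : ℕ => (n : ℝ) ^ (-ηs))
    -- the threshold; the last hypothesis holds by itself if the priors do not depend on `n`
    (t : ℝ)
    (ht : ∀ ε : ℝ, 0 < ε → ∀ᶠ n : ℕ in atTop,
      (n : ℝ) ^ (-ε) ≤ (NEST.tripleLaw (Gμ n) (Gσ n)).real {p | t < p.2.2}) :
    NEST.VanishingSelectionBias Gμ Gσ t
        (fun n x σ i => NEST.nest (bx n) (bs n) x σ i) ∧
    (3 * ηx + ηs < 1 → ∀ τ : ℕ → ℝ, (∀ᶠ n in atTop, C n ≤ τ n) →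
      NEST.VanishingSelectionBias Gμ Gσ t
        (fun n x σ i => min (NEST.nest (bx n) (bs n) x σ i) (τ n)) ∧
      NEST.VanishingSelectionBias Gμ Gσ t
        (fun n x σ i => max (-τ n) (min (NEST.nest (bx n) (bs n) x σ i) (τ n)))) := by
  exact theorem4p3_general Gμ Gσ C hC hμ (fun _ => σl) (fun _ => σu) (fun _ => hσl)
    (NEST.subpolynomial_const _) (NEST.subpolynomial_const _) hσ ηx ηs hηx hηs hη bx bs hbx hbs
    hbx' hbs' t ht
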